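/- Conventions. Write $\varphi=A^2+A^{-2}$, in the field $\mathbb{Q}(A)$. For a link diagram $L$ let $\langle L\rangle$ be the Kauffman bracket: $\langle\bigcirc\rangle=1$, $\langle L\sqcup\bigcirc\rangle=(-A^2-A^{-2})\langle L\rangle$, and each crossing is expanded as $A\langle\cdot\rangle+A^{-1}\langle\cdot\rangle$, where at a crossing of two upward strands whose overpass runs from bottom left to top right (a positive crossing) the coefficient $A$ belongs to the vertical smoothing. For an oriented link diagram $L$ with sum of crossing signs $\omega(L)$ let $V(L)=(-A^3)^{-\omega(L)}\langle L\rangle$ (the Jones polynomial). For a diagram $D$ of a knot or of a $\theta$-curve let the bar diagram $B_D$ be the band diagram obtained by thickening $D$ in the plane (vertices become disks, strands become bands, crossings become crossings of bands), where each part of $D$ between crossings and vertices carries a bar across its band. Let $R$ be defined on bar diagrams by $$R(\text{bar})=\frac{1}{t+t^{-1}}\Big(R(\text{half-twist})+t^{-1}R(\text{no bar})+\frac{t-t^{-1}}{1-at}R(\text{smoothing})\Big),\qquad a=-A^3,\ t=A,$$ where the bar is replaced by a half-twist of the band with the two boundary strands crossing positively when both are directed along the band, by nothing, or by cutting the band,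 and by $R(B)=\langle\partial B\rangle$ if $B$ has no bar. The Jaeger polynomial is $\mathfrak{J}(D)=R(B_D)$. For a knot diagram $K$ put $\widetilde{\mathfrak{J}}(K)=A^{-8\,\omega(K)}\,\mathfrak{J}(K)$. Let $D$ be a diagram of a $\theta$-curve $\Theta$ with vertices $v_1,v_2$ and edges $e_1,e_2,e_3$ oriented from $v_1$ to $v_2$, drawn such that the counter-clockwise order of the edges is $(e_3,e_2,e_1)$ at $v_1$ and $(e_1,e_2,e_3)$ at $v_2$. Let $\omega_{ii}$ be the sum of the signs of the self-crossings of $e_i$, let $\omega_{ij}$ ($i\ne j$) be the sum of the signs of the crossings between $e_i$ and $e_j$, put $$n_i=-\omega_{ii}+\tfrac12(\omega_{ij}+\omega_{ik}-\omega_{jk}),\quad\{i,j,k\}=\{1,2,3\},\qquad \widetilde{\mathfrak{J}}(D)=(-A^4)^{2(n_1+n_2+n_3)}\,\mathfrak{J}(D).$$ The subknots of $\Theta$ are $\mathcal{K}_i=e_j\cup e_k$. The associated link $\mathcal{L}$ of $\Theta$ is the boundary of a disk with two holes that has $\Theta$ as a spine and whose Seifert form is zero (namely, the band surface of $D$ with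 suitable full twists inserted into the three bands at $v_1$); its components are oriented such that they are homologous on the surface to $e_2-e_3$, $e_3-e_1$ and $e_1-e_2$. Theorem. Let $D$ be such a diagram of a $\theta$-curve $\Theta$, let $K_i$ be any diagram of the subknot $\mathcal{K}_i$ ($i=1,2,3$) and let $L$ be any diagram of the associated link $\mathcal{L}$, where diagrams represent the same oriented link iff they are connected by planar isotopies and Reidemeister moves. Then $$\widetilde{\mathfrak{J}}(D)-V(L)=\frac1\varphi\sum_{i=1}^3\widetilde{\mathfrak{J}}(K_i)-\frac1{\varphi^2}.$$ In terms of the invariants that the diagrams compute: $\widetilde{\mathfrak{J}}(\Theta)-V(\mathcal{L})=\frac1\varphi\sum_{i=1}^3\widetilde{\mathfrak{J}}(\mathcal{K}_i)-\frac1{\varphi^2}$. -/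

import Mathlib

/-!
Diagrams are drawn in generic position with respect to the height function of the plane and are
recorded as words of elementary slices, read from bottom to top: a cup (local minimum), a cap (local
maximum), a crossing, or (for theta-curves) one of the two vertices.  Every planar diagram has
such a description, and every word in which the slices fit together is a planar diagram.
-/

namespace ThetaCurve

/-- The points of a diagram on a horizontal line, from left to right.  Each point carries the label
of the component (or edge) it lies on, and `true` if the strand is oriented upwards there, `false`
if it is oriented downwards. -/
abbrev Level (α : Type) := List (α × Bool)

/-- Exchange the entries in positions `i` and `i + 1`. -/
def swapAt {β : Type} (i : ℕ) (l : List β) : List β :=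
  l.take i ++ ((l.drop i).take 2).reverse ++ l.drop (i + 2)

/-- Elementary slices of oriented labelled link diagrams; positions are counted from `0`. -/
inductive Slice (α : Type) where
  /-- A local minimum.  It creates strands in positions `i` and `i + 1`, with label `a`; the left
  one is oriented upwards iff `up = true`. -/
  | cup (i : ℕ) (a : α) (up : Bool)
  /-- A local maximum.  It joins the strands in positions `i` and `i + 1`. -/
  | cap (i : ℕ)
  /-- A crossing of the strands in positions `i` and `i + 1`.  If `ov = true` the strand running
  from bottom left to top right is the overpass, otherwise it is the underpass. -/
  | cross (i : ℕ) (ov : Bool)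

namespace Slice

variable {α : Type}

/-- The level above a slice, given the level below it. -/
def step : Slice α → Level α → Level α
  | cup i a up, l => l.take i ++ [(a, up), (a, !up)] ++ l.drop i
  | cap i, l => l.take i ++ l.drop (i + 2)
  | cross i _, l => swapAt i l

/-- The slice can be put on top of the level: positions exist, and a cap joins two strands with the
same label and with opposite vertical directions. -/
def Valid : Slice α → Level α → Prop
  | cup i _ _, l => i ≤ l.length
  | cap i, l => ∃ a up, (l.drop i).take 2 = [(a, up), (a, !up)]
  | cross i _, l => i + 2 ≤ l.length

/-- The sign of a crossing: `+1` if both strands run upwards and the one from bottom left to top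
right is the overpass; it changes with the crossing and with the direction of each strand. -/
def crossingSign (ov up₁ up₂ : Bool) : ℤ :=
  (if ov then 1 else -1) * (if up₁ = up₂ then 1 else -1)

/-- The contribution of a slice to the sum of the signs of the crossings at which the labels of the
two strands satisfy `f`. -/
def sign (f : α → α → Bool) : Slice α → Level α → ℤ
  | cross i ov, l =>
    match (l.drop i).take 2 with
    | [(a, u), (b, v)] => if f a b then crossingSign ov u v else 0
    | _ => 0
  | _, _ => 0

/-- The leftmost position involved in a slice. -/
def pos : Slice α → ℕ
  | cup i _ _ => i
  | cap i => i
  | cross i _ => i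

/-- The same slice at another position. -/
def setPos (j : ℕ) : Slice α → Slice α
  | cup _ a up => cup j a up
  | cap _ => cap j
  | cross _ ov => cross j ov

/-- The number of strands entering from below. -/
def ins : Slice α → ℕ
  | cup _ _ _ => 0
  | cap _ => 2
  | cross _ _ => 2

/-- The number of strands leaving at the top. -/
def outs : Slice α → ℕ
  | cup _ _ _ => 2
  | cap _ => 0
  | cross _ _ => 2

end Slice

section Links

variable {α : Type}

/-- The word `w`, put on top of the level `l`, is well formed and ends with the empty level. -/
def ClosesFrom : List (Slice α) → Level α → Prop
  | [], l => l = []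
  | s :: w, l => s.Valid l ∧ ClosesFrom w (s.step l)

/-- The word is an oriented labelled link diagram. -/
def IsLinkDiagram (w : List (Slice α)) : Prop := ClosesFrom w []

/-- Sum of the crossing signs in the word `w`, put on top of the level `l`, over the crossings
at which the labels of the two strands satisfy `f`. -/
def signSumFrom (f : α → α → Bool) : List (Slice α) → Level α → ℤ
  | [], _ => 0
  | s :: w, l => s.sign f l + signSumFrom f w (s.step l)

/-- The sum of all crossing signs of a link diagram. -/
def writhe (w : List (Slice α)) : ℤ := signSumFrom (fun _ _ => true) w []

/-- Local modifications of diagrams: planar isotopy of diagrams in generic position with respect to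
height (the first five), and the three Reidemeister moves. -/
inductive LocalMove : List (Slice α) → List (Slice α) → Prop
  /-- Exchanging the heights of two slices, the second of which is to the right of the first. -/
  | exchange (s t : Slice α) (h : s.pos + s.outs ≤ t.pos) :
      LocalMove [s, t] [t.setPos (t.pos - s.outs + s.ins), s]
  /-- Straightening a strand. -/
  | zigzag_left (i : ℕ) (a : α) (up : Bool) :
      LocalMove [.cup i a up, .cap (i + 1)] []
  | zigzag_right (i : ℕ) (a : α) (up : Bool) :
      LocalMove [.cup (i + 1) a up, .cap i] []
  /-- Passing a strand from one leg of a local extremum to the other one. -/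
  | cup_slide (i : ℕ) (a : α) (up ov : Bool) :
      LocalMove [.cup i a up, .cross (i + 1) ov] [.cup (i + 1) a up, .cross i (!ov)]
  | cap_slide (i : ℕ) (ov : Bool) :
      LocalMove [.cross i ov, .cap (i + 1)] [.cross (i + 1) (!ov), .cap i]
  /-- The first Reidemeister move. -/
  | curl_right (i : ℕ) (a : α) (up ov : Bool) :
      LocalMove [.cup (i + 1) a up, .cross i ov, .cap (i + 1)] []
  | curl_left (i : ℕ) (a : α) (up ov : Bool) :
      LocalMove [.cup i a up, .cross (i + 1) ov, .cap i] []
  /-- The second Reidemeister move. -/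
  | cancel (i : ℕ) (ov : Bool) :
      LocalMove [.cross i ov, .cross i (!ov)] []
  /-- The third Reidemeister move.  The hypothesis says that the three strands lie at three different
  heights over the plane, that is, "is over" is not cyclic. -/
  | triangle (i : ℕ) (o₁₂ o₁₃ o₂₃ : Bool) (h : o₁₂ = o₂₃ → o₁₃ = o₁₂) :
      LocalMove [.cross i o₁₂, .cross (i + 1) o₁₃, .cross i o₂₃]
        [.cross (i + 1) o₂₃, .cross i o₁₃, .cross (i + 1) o₁₂]

/-- Two link diagrams differ by one local modification. -/
def Move (w w' : List (Slice α)) : Prop :=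
  IsLinkDiagram w ∧ IsLinkDiagram w' ∧
    ∃ u v x y, LocalMove x y ∧ w = u ++ x ++ v ∧ w' = u ++ y ++ v

/-- Two link diagrams represent ambient isotopic oriented (and labelled) links: they are
connected by a finite sequence of planar isotopies and Reidemeister moves. -/
def Isotopic (w w' : List (Slice α)) : Prop := Relation.EqvGen Move w w'

end Links

/-! ### The bracket polynomial and the invariant `R` of bar diagrams -/

/-- Elementary slices of bar diagrams: slices of the boundary of the band diagram, and bars.
The `i`-th band from the left is bounded by the strands in positions `2 * i` and `2 * i + 1`, and
`bar i` is a bar across that band. -/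
inductive BarSlice (α : Type) where
  | strand (s : Slice α)
  | bar (i : ℕ)

/-- In the following three definitions a list of numbers records a crossingless diagram below
a horizontal line: two points on the line have the same entry iff they are connected below it.
`openArc i` adds a new arc ending in positions `i` and `i + 1`. -/
def openArc (i : ℕ) (s : List ℕ) : List ℕ :=
  s.take i ++ [s.foldr max 0 + 1, s.foldr max 0 + 1] ++ s.drop i

/-- The points in positions `i` and `i + 1` belong to the same arc. -/
def SameArc (i : ℕ) (s : List ℕ) : Prop := s[i]? = s[i + 1]?

instance (i : ℕ) (s : List ℕ) : Decidable (SameArc i s) :=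
  inferInstanceAs (Decidable (s[i]? = s[i + 1]?))

/-- Join the arcs ending in positions `i` and `i + 1`. -/
def joinArcs (i : ℕ) (s : List ℕ) : List ℕ :=
  (s.take i ++ s.drop (i + 2)).map fun x => if s[i + 1]? = some x then s.getD i 0 else x

section Polynomials

variable {K : Type} [Field K] (A : K) {α : Type}

/-- The value `- A ^ 2 - A ^ (-2)` of a closed loop. -/
def loopValue : K := -A ^ 2 - A ^ (-2 : ℤ)

/-- The factor by which a cap in position `i` multiplies: it is the value of a loop if the cap
closes one. -/
def capFactor (i : ℕ) (s : List ℕ) : K := if SameArc i s then loopValue A else 1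

/-- Expansion of a bar diagram (with unnormalized value: the empty diagram has value `1`).  It is
carried out from bottom to top; `s` records the arcs already drawn.
* At a crossing, `⟨crossing⟩ = A ⟨vertical smoothing⟩ + A⁻¹ ⟨horizontal smoothing⟩` if the strand
  from bottom left to top right is the overpass, with `A` and `A⁻¹` exchanged otherwise.
* At a bar, with `a = - A ^ 3` and `t = A`,
  `R(bar) = (t + t⁻¹)⁻¹ (R(half-twist) + t⁻¹ R(no bar) + (t - t⁻¹) / (1 - a t) R(smoothing))`,
  where the half-twist is a crossing of the two boundary strands of the band and the smoothing cuts
  the band. -/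
def expand : List (BarSlice α) → List ℕ → K
  | [], _ => 1
  | .strand (.cup i _ _) :: w, s => expand w (openArc i s)
  | .strand (.cap i) :: w, s => capFactor A i s * expand w (joinArcs i s)
  | .strand (.cross i ov) :: w, s =>
    let vert := expand w s
    let horiz := capFactor A i s * expand w (openArc i (joinArcs i s))
    if ov then A * vert + A⁻¹ * horiz else A⁻¹ * vert + A * horiz
  | .bar i :: w, s =>
    let noBar := expand w s
    let smoothing := capFactor A (2 * i) s * expand w (openArc (2 * i) (joinArcs (2 * i) s))
    let halfTwist := A * noBar + A⁻¹ * smoothing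
    (A + A⁻¹)⁻¹ *
      (halfTwist + A⁻¹ * noBar + (A - A⁻¹) / (1 - (-A ^ 3) * A) * smoothing)

/-- The value `R` of a bar diagram, normalized such that the simple circle has value `1`. -/
def barPolynomial (w : List (BarSlice α)) : K := expand A w [] / loopValue A

/-- The bracket polynomial of a link diagram, with value `1` on the simple circle. -/
def bracket (w : List (Slice α)) : K := barPolynomial A (w.map .strand)

/-- The Jones polynomial (in the variable `A`) of an oriented link diagram. -/
def jones (w : List (Slice α)) : K := (-A ^ 3) ^ (-writhe w) * bracket A w

end Polynomials

/-! ### Bands, bars, and the polynomial of knots -/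

section Bands

variable {α β : Type}

/-- The boundary of the band diagram over a slice.  The boundary of a band is
oriented along the edge on the right-hand side of the edge and against it on the left-hand side
(hence downwards on the left and upwards on the right of each vertical band); `x a` and
`y a` are the labels of the left-hand and right-hand sides of an edge with label `a`. -/
def Slice.double (x y : α → β) : Slice α → List (Slice β)
  | .cup i a up =>
    [.cup (2 * i) (if up then x a else y a) false, .cup (2 * i + 1) (if up then y a else x a) true]
  | .cap i => [.cap (2 * i + 1), .cap (2 * i)]
  | .cross i ov =>
    [.cross (2 * i + 1) ov, .cross (2 * i) ov, .cross (2 * i + 2) ov, .cross (2 * i + 1) ov]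

/-- The bands that receive a bar immediately above a slice: those over the strands which leave it.
Every part of a diagram between crossings and vertices carries at least one bar in this way. -/
def Slice.bars : Slice α → List ℕ
  | .cup i _ _ => [i, i + 1]
  | .cap _ => []
  | .cross i _ => [i, i + 1]

/-- The bar diagram of a link diagram. -/
def barDiagram (w : List (Slice α)) : List (BarSlice α) :=
  w.flatMap fun s => (s.double id id).map .strand ++ s.bars.map .bar

variable {K : Type} [Field K] (A : K)

/-- The Jaeger polynomial `𝔍` of a knot diagram. -/
def jaegerKnot (w : List (Slice α)) : K := barPolynomial A (barDiagram w)

/-- The normalized Jaeger polynomial of a knot diagram. -/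
def jaegerKnotNormalized (w : List (Slice α)) : K := (A ^ 8) ^ (-writhe w) * jaegerKnot A w

end Bands

/-! ### Theta-curves -/

/-- Elementary slices of diagrams of theta-curves.  The edges are labelled by `0, 1, 2` (for
`e₁, e₂, e₃`) and oriented from the vertex `v₁` to the vertex `v₂`. -/
inductive ThetaSlice where
  | strand (s : Slice (Fin 3))
  /-- The vertex `v₁`, from which the edges `e₁, e₂, e₃` leave upwards in positions `i`, `i + 1`,
  `i + 2`; their counter-clockwise order is `(e₃, e₂, e₁)`. -/
  | tail (i : ℕ)
  /-- The vertex `v₂`, at which the edges `e₁, e₂, e₃` arrive from below in positions `i`, `i + 1`,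
  `i + 2`; their counter-clockwise order is `(e₁, e₂, e₃)`. -/
  | head (i : ℕ)

namespace ThetaSlice

/-- The level above a slice, given the level below it. -/
def step : ThetaSlice → Level (Fin 3) → Level (Fin 3)
  | strand s, l => s.step l
  | tail i, l => l.take i ++ [(0, true), (1, true), (2, true)] ++ l.drop i
  | head i, l => l.take i ++ l.drop (i + 3)

/-- The slice can be put on top of the level. -/
def Valid : ThetaSlice → Level (Fin 3) → Prop
  | strand s, l => s.Valid l
  | tail i, l => i ≤ l.length
  | head i, l => (l.drop i).take 3 = [(0, true), (1, true), (2, true)]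

/-- The contribution of a slice to a sum of crossing signs. -/
def sign (f : Fin 3 → Fin 3 → Bool) : ThetaSlice → Level (Fin 3) → ℤ
  | strand s, l => s.sign f l
  | _, _ => 0

/-- The slice is the vertex `v₁`. -/
def isTail : ThetaSlice → Bool
  | tail _ => true
  | _ => false

/-- The slice is the vertex `v₂`. -/
def isHead : ThetaSlice → Bool
  | head _ => true
  | _ => false

/-- What remains of a slice if the edge `i` is deleted.  The vertices become a local
minimum and a local maximum; the remaining knot is oriented along the edge `i + 1` and
against the edge `i + 2` (indices modulo `3`). -/
def deleteEdge (i : Fin 3) : ThetaSlice → Level (Fin 3) → List (Slice Unit)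
  | strand (.cup p e up), l =>
    if e = i then [] else [.cup (kept l p) () (if e = i + 1 then up else !up)]
  | strand (.cap p), l =>
    match l[p]? with
    | some (e, _) => if e = i then [] else [.cap (kept l p)]
    | none => []
  | strand (.cross p ov), l =>
    match (l.drop p).take 2 with
    | [(a, _), (b, _)] => if a = i ∨ b = i then [] else [.cross (kept l p) ov]
    | _ => []
  | tail p, l => [.cup (kept l p) () (decide (i ≠ 1))]
  | head p, l => [.cap (kept l p)]
where
  /-- The number of remaining strands to the left of position `p`. -/
  kept (l : Level (Fin 3)) (p : ℕ) : ℕ := ((l.take p).filter fun x => x.1 ≠ i).length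

/-- `n` full twists in the band in position `i`; for `n > 0` the two boundary strands, if both are
directed upwards, cross positively. -/
def fullTwists (i : ℕ) (n : ℤ) : List (Slice (Fin 3)) :=
  List.replicate (2 * n.natAbs) (.cross (2 * i) (decide (0 ≤ n)))

/-- The boundary of the band diagram over a slice, where `t k` full twists are inserted into the
band of the edge `k` next to `v₁`.  The component `l₁` of the boundary runs along `e₂ - e₃`, `l₂`
along `e₃ - e₁` and `l₃` along `e₁ - e₂`: on the left-hand side of the edge `e` there is the component
`e + 1`, on the right-hand side the component `e + 2`. -/
def bands (t : Fin 3 → ℤ) : ThetaSlice → List (Slice (Fin 3))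
  | strand s => s.double (· + 1) (· + 2)
  | tail i =>
    [.cup (2 * i) 1 false, .cup (2 * i + 1) 2 true, .cup (2 * i + 3) 0 true] ++
      (fullTwists i (t 0) ++ fullTwists (i + 1) (t 1) ++ fullTwists (i + 2) (t 2))
  | head i => [.cap (2 * i + 3), .cap (2 * i + 1), .cap (2 * i)]

/-- The bands that receive a bar immediately above a slice. -/
def bars : ThetaSlice → List ℕ
  | strand s => s.bars
  | tail i => [i, i + 1, i + 2]
  | head _ => []

end ThetaSlice

/-- The word `w`, put on top of the level `l`, is well formed and ends with the empty level. -/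
def ThetaClosesFrom : List ThetaSlice → Level (Fin 3) → Prop
  | [], l => l = []
  | s :: w, l => s.Valid l ∧ ThetaClosesFrom w (s.step l)

/-- No cap in the word closes a loop; `s` records the arcs already drawn.  This excludes closed
components disjoint from the vertices. -/
def NoClosedLoop : List ThetaSlice → List ℕ → Prop
  | [], _ => True
  | .strand (.cup i _ _) :: w, s => NoClosedLoop w (openArc i s)
  | .strand (.cap i) :: w, s => ¬ SameArc i s ∧ NoClosedLoop w (joinArcs i s)
  | .strand (.cross i _) :: w, s => NoClosedLoop w (swapAt i s)
  | .tail i :: w, s =>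
    let m := s.foldr max 0
    NoClosedLoop w (s.take i ++ [m + 1, m + 2, m + 3] ++ s.drop i)
  | .head i :: w, s => NoClosedLoop w (s.take i ++ s.drop (i + 3))

/-- A diagram of a theta-curve: one vertex `v₁`, one vertex `v₂`, three edges from `v₁` to `v₂`, and
nothing else. -/
structure ThetaDiagram where
  word : List ThetaSlice
  closes : ThetaClosesFrom word []
  one_tail : word.countP ThetaSlice.isTail = 1
  one_head : word.countP ThetaSlice.isHead = 1
  no_loop : NoClosedLoop word []

namespace ThetaDiagram

/-- Sum of the crossing signs over the crossings at which the two edges satisfy `f`. -/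
def signSumFrom (f : Fin 3 → Fin 3 → Bool) : List ThetaSlice → Level (Fin 3) → ℤ
  | [], _ => 0
  | s :: w, l => s.sign f l + signSumFrom f w (s.step l)

variable (D : ThetaDiagram)

/-- `ω i i` is the sum of the signs of the self-crossings of the edge `i`, and `ω i j` the sum of the
signs of the crossings between the edges `i` and `j`. -/
def omega (i j : Fin 3) : ℤ :=
  signSumFrom (fun a b => (a = i ∧ b = j) ∨ (a = j ∧ b = i)) D.word []

/-- The numbers `nᵢ = - ωᵢᵢ + (ωᵢⱼ + ωᵢₖ - ωⱼₖ) / 2`, where `{i, j, k} = {1, 2, 3}`.  The sum in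
parentheses is even since the diagram is planar. -/
def twistNumber (i : Fin 3) : ℤ :=
  -D.omega i i + (D.omega i (i + 1) + D.omega i (i + 2) - D.omega (i + 1) (i + 2)) / 2

/-- The diagram of the subknot that remains if the edge `i` is deleted. -/
def subknot (i : Fin 3) : List (Slice Unit) :=
  go D.word []
where
  /-- Delete the edge `i` from a word put on top of the level `l`. -/
  go : List ThetaSlice → Level (Fin 3) → List (Slice Unit)
    | [], _ => []
    | s :: w, l => s.deleteEdge i l ++ go w (s.step l)

/-- The boundary, with components `l₁, l₂, l₃`, of the disk with two holes obtained from the band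
diagram of `D` by adding `t k` full twists to the band of each edge `k`. -/
def bandLink (t : Fin 3 → ℤ) : List (Slice (Fin 3)) := D.word.flatMap (ThetaSlice.bands t)

/-- The Seifert form of the twisted band surface is zero.  As the first homology group of the surface
is generated by the boundary components `l₁, l₂, l₃` with `l₁ + l₂ + l₃ = 0`, the form is zero iff it
vanishes on pairs of different boundary components.  There its value is their linking number,
half of the sum of the signs of the crossings between them. -/
def SeifertFormZero (t : Fin 3 → ℤ) : Prop :=
  ∀ i j : Fin 3, i ≠ j →
    ThetaCurve.signSumFrom (fun a b => (a = i ∧ b = j) ∨ (a = j ∧ b = i)) (D.bandLink t) [] = 0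

/-- `L` is a diagram of the associated link of the theta-curve with diagram `D`: the boundary of a
disk with two holes which has the theta-curve as a spine and whose Seifert form is zero. -/
def IsAssociatedLink (L : List (Slice (Fin 3))) : Prop :=
  ∃ t : Fin 3 → ℤ, D.SeifertFormZero t ∧ Isotopic (D.bandLink t) L

/-- The bar diagram of a diagram of a theta-curve. -/
def barDiagram : List (BarSlice (Fin 3)) :=
  D.word.flatMap fun s => (s.bands 0).map .strand ++ s.bars.map .bar

variable {K : Type} [Field K] (A : K)

/-- The Jaeger polynomial `𝔍` of a diagram of a theta-curve. -/
def jaeger : K := barPolynomial A D.barDiagram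

/-- The normalized Jaeger polynomial of a diagram of a theta-curve. -/
def jaegerNormalized : K := (-A ^ 4) ^ (2 * ∑ i, D.twistNumber i) * D.jaeger A

end ThetaDiagram

end ThetaCurve

/-! Write `δ = loopValue A`, so `δ = -φ`. With `a = -A³`, `t = A` the bar relation says that a bar
is the element `P = 1 - δ⁻¹ e` of the Temperley-Lieb algebra of the two boundary strands of a band,
where `e` cuts the band (`bar_coefficient`). Thus `P` is the Jones-Wenzl idempotent, and `Q = 1 - P
= δ⁻¹ e` is the complementary idempotent. A crossing of the two strands acts on `P` as `A` and on
`Q` as `-A⁻³`, hence `n` full twists of a band are `A^(2n) P + A^(-6n) Q`.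

The associated link bounds the band surface of `D` with `t k` full twists in the band of the edge
`k` at `v₁`. Expanding the three twists gives eight terms, one for each choice of `P` or `Q` on each
edge (`word_bandLink`): * `P` on all edges gives the Jaeger polynomial of `D`. There the bars sit on
every part of the diagram, and it has to be shown that bars next to `v₁` suffice
(`levelProj_mul_colored`, `jaeger_smul_one`). * `Q` on one edge `k` only cuts that edge with a
factor `δ⁻¹`. Its two remnants retract through the crossings, and the barred band diagram of the
subknot remains (`colored_subknot`). * `Q` on exactly two edges gives zero: cutting one edge leaves
a single band near `v₁`, on which `P` and `Q` meet (`colored_eq_zero`). * `Q` on all edges cuts the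
surface into two disks and contributes `δ² δ⁻³ = δ⁻¹` (`colored_false`).

The powers of `A` fit because vanishing of the Seifert form forces `t k = n_k`
(`two_mul_twist_of_seifertFormZero`), the writhe of the band link is `-2 (t 0 + t 1 + t 2)`, and the
writhe of the subknot without edge `k` is minus the sum of the other two twists
(`writhe_subknot_of_seifertFormZero`). Dividing by the normalizing factor `δ`, the terms give `-δ⁻¹
∑ 𝔍̃(K_i) - δ⁻²`, which is the right-hand side.

Arbitrary diagrams of the subknots and of the link are admitted by invariance under isotopy
(`jaegerKnotNormalized_eq_of_isotopic`, `jones_eq_of_isotopic`). All computations take place in an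
algebra containing elements `cup i`, `cap i` for all positions: a word of slices becomes a product,
a closed diagram becomes a scalar, and `expand_smul_one` identifies this scalar with the recursive
state expansion. A concrete algebra of operators (`tensorModel`) shows that such elements exist in a
nontrivial ring. -/

namespace ThetaCurve

/-- The Temperley-Lieb relations for elements `cup i` and `cap i` of an algebra, where products are
read like words of slices. -/
structure TemperleyLieb {K : Type} [Field K] (A : K) (R : Type) [Ring R] [Algebra K R] where
  cup : ℕ → R
  cap : ℕ → R
  cup_cup : ∀ {i j : ℕ}, i ≤ j → cup i * cup (j + 2) = cup j * cup i
  cup_cap : ∀ {i j : ℕ}, i ≤ j → cup i * cap (j + 2) = cap j * cup i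
  cap_cup : ∀ {i j : ℕ}, i ≤ j → cap i * cup j = cup (j + 2) * cap i
  cap_cap : ∀ {i j : ℕ}, i ≤ j → cap i * cap j = cap (j + 2) * cap i
  zigzag_left : ∀ i, cup i * cap (i + 1) = 1
  zigzag_right : ∀ i, cup (i + 1) * cap i = 1
  loop : ∀ i, cup i * cap i = loopValue A • (1 : R)
  ne_zero : A ≠ 0
  loop_ne_zero : A ^ 2 + A ^ (-2 : ℤ) ≠ 0
  add_inv_ne_zero : A + A⁻¹ ≠ 0

/-! ### A model of the Temperley-Lieb relations by operators on functions of spin states. -/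

section Model

/-- Insert two entries in positions `i` and `i + 1`. -/
def insertPair (i : ℕ) (a b : Bool) (l : ℕ → Bool) : ℕ → Bool := fun k =>
  if k < i then l k else if k = i then a else if k = i + 1 then b else l (k - 2)

/-- Delete the entries in positions `i` and `i + 1`. -/
def deletePair (i : ℕ) (l : ℕ → Bool) : ℕ → Bool := fun k => if k < i then l k else l (k + 2)

theorem insertPair_self (i : ℕ) (a b : Bool) (l : ℕ → Bool) : insertPair i a b l i = a := by
  simp [insertPair]

theorem insertPair_succ (i : ℕ) (a b : Bool) (l : ℕ → Bool) :
    insertPair i a b l (i + 1) = b := by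
  simp [insertPair]

theorem deletePair_insertPair (i : ℕ) (a b : Bool) (l : ℕ → Bool) :
    deletePair i (insertPair i a b l) = l := by
  funext k
  unfold deletePair insertPair
  grind

theorem insertPair_insertPair {i j : ℕ} (h : i ≤ j) (a b c d : Bool) (l : ℕ → Bool) :
    insertPair (j + 2) c d (insertPair i a b l) = insertPair i a b (insertPair j c d l) := by
  funext k
  unfold insertPair
  grind (splits := 20)

theorem deletePair_insertPair_of_le {i j : ℕ} (h : i ≤ j) (a b : Bool) (l : ℕ → Bool) :
    deletePair (j + 2) (insertPair i a b l) = insertPair i a b (deletePair j l) := by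
  funext k
  unfold deletePair insertPair
  grind

theorem insertPair_deletePair_of_le {i j : ℕ} (h : i ≤ j) (a b : Bool) (l : ℕ → Bool) :
    insertPair j a b (deletePair i l) = deletePair i (insertPair (j + 2) a b l) := by
  funext k
  unfold deletePair insertPair
  grind

theorem deletePair_deletePair {i j : ℕ} (h : i ≤ j) (l : ℕ → Bool) :
    deletePair j (deletePair i l) = deletePair i (deletePair (j + 2) l) := by
  funext k
  unfold deletePair
  grind

theorem deletePair_succ_insertPair (i : ℕ) (a b : Bool) (l : ℕ → Bool) (h : l i = a) :
    deletePair (i + 1) (insertPair i a b l) = l := by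
  funext k
  unfold deletePair insertPair
  grind

theorem deletePair_insertPair_succ (i : ℕ) (a b : Bool) (l : ℕ → Bool) (h : l i = b) :
    deletePair i (insertPair (i + 1) a b l) = l := by
  funext k
  unfold deletePair insertPair
  grind

variable {K : Type} [Field K] (A : K)

/-- A local minimum, as an operator on tensors. -/
def cupMap (i : ℕ) : Module.End K ((ℕ → Bool) → K) where
  -- A function of the state above the slice is pulled back to a function of the state below it, so
  -- that products of operators read a word from bottom to top. States are infinite sequences: one
  -- algebra serves for any number of strands.
  toFun f l := A * f (insertPair i true false l) - A⁻¹ * f (insertPair i false true l)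
  map_add' f g := by funext l; simp only [Pi.add_apply]; ring
  map_smul' c f := by funext l; simp only [Pi.smul_apply, smul_eq_mul, RingHom.id_apply]; ring

/-- The entries of the tensor of a local maximum. -/
def capEntry : Bool → Bool → K
  | true, false => -A
  | false, true => A⁻¹
  | _, _ => 0

/-- A local maximum, as an operator on tensors. -/
def capMap (i : ℕ) : Module.End K ((ℕ → Bool) → K) where
  toFun f l := capEntry A (l i) (l (i + 1)) * f (deletePair i l)
  map_add' f g := by funext l; simp only [Pi.add_apply]; ring
  map_smul' c f := by funext l; simp only [Pi.smul_apply, smul_eq_mul, RingHom.id_apply]; ring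

theorem cupMap_apply (i : ℕ) (f : (ℕ → Bool) → K) (l : ℕ → Bool) : cupMap A i f l =
    A * f (insertPair i true false l) - A⁻¹ * f (insertPair i false true l) := rfl

theorem capMap_apply (i : ℕ) (f : (ℕ → Bool) → K) (l : ℕ → Bool) : capMap A i f l =
    capEntry A (l i) (l (i + 1)) * f (deletePair i l) := rfl

/-- The operators on tensors satisfy the Temperley-Lieb relations. -/
def tensorModel (hA : A ≠ 0) (h₁ : A ^ 2 + A ^ (-2 : ℤ) ≠ 0) (h₂ : A + A⁻¹ ≠ 0) :
    TemperleyLieb A (Module.End K ((ℕ → Bool) → K)) where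
  cup := cupMap A
  cap := capMap A
  cup_cup {i j} h := by
    ext1 f; funext l
    simp only [Module.End.mul_apply, cupMap_apply, insertPair_insertPair h]
    ring
  cup_cap {i j} h := by
    ext1 f; funext l
    have e (a b : Bool) : insertPair i a b l (j + 2) = l j := by unfold insertPair; grind
    have e' (a b : Bool) : insertPair i a b l (j + 2 + 1) = l (j + 1) := by
      unfold insertPair; grind
    simp only [Module.End.mul_apply, cupMap_apply, capMap_apply, deletePair_insertPair_of_le h,
      e, e']
    ring
  cap_cup {i j} h := by
    ext1 f; funext l
    have e (a b : Bool) : insertPair (j + 2) a b l i = l i := by unfold insertPair; grind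
    have e' (a b : Bool) : insertPair (j + 2) a b l (i + 1) = l (i + 1) := by
      unfold insertPair; grind
    simp only [Module.End.mul_apply, cupMap_apply, capMap_apply, insertPair_deletePair_of_le h,
      e, e']
    ring
  cap_cap {i j} h := by
    ext1 f; funext l
    have e : deletePair i l j = l (j + 2) := by unfold deletePair; grind
    have e' : deletePair i l (j + 1) = l (j + 2 + 1) := by unfold deletePair; grind
    have e₁ : deletePair (j + 2) l i = l i := by unfold deletePair; grind
    have e₂ : deletePair (j + 2) l (i + 1) = l (i + 1) := by unfold deletePair; grind
    simp only [Module.End.mul_apply, capMap_apply, deletePair_deletePair h, e, e', e₁, e₂]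
    ring
  zigzag_left i := by
    ext1 f; funext l
    have e (a b : Bool) : insertPair i a b l (i + 1 + 1) = l i := by unfold insertPair; grind
    simp only [Module.End.mul_apply, cupMap_apply, capMap_apply, e, insertPair_succ]
    cases h : l i
    · simp [capEntry, deletePair_succ_insertPair i false true l h, hA]
    · simp [capEntry, deletePair_succ_insertPair i true false l h, hA]
  zigzag_right i := by
    ext1 f; funext l
    have e (a b : Bool) : insertPair (i + 1) a b l i = l i := by unfold insertPair; grind
    simp only [Module.End.mul_apply, cupMap_apply, capMap_apply, e, insertPair_self]
    cases h : l i
    · simp [capEntry, deletePair_insertPair_succ i true false l h, hA]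
    · simp [capEntry, deletePair_insertPair_succ i false true l h, hA]
  loop i := by
    ext1 f; funext l
    -- The loop is `A * (-A) - A⁻¹ * A⁻¹`, the sum over its two spin states.
    simp only [Module.End.mul_apply, cupMap_apply, capMap_apply, insertPair_self, insertPair_succ,
      deletePair_insertPair, capEntry, loopValue, LinearMap.smul_apply, Pi.smul_apply,
      Module.End.one_apply, smul_eq_mul, zpow_neg, zpow_ofNat]
    field_simp
  ne_zero := hA
  loop_ne_zero := h₁
  add_inv_ne_zero := h₂

end Model
end ThetaCurve

/-! ### Crossings as Temperley-Lieb elements: commutation at a distance and Reidemeister moves. -/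

namespace ThetaCurve
namespace TemperleyLieb

variable {K : Type} [Field K] {A : K} {R : Type} [Ring R] [Algebra K R] (T : TemperleyLieb A R)

/-- A cap followed by a cup. -/
def hook (i : ℕ) : R := T.cap i * T.cup i

/-- The coefficient of the vertical smoothing of a crossing. -/
def weight (A : K) (ov : Bool) : K := if ov then A else A⁻¹

/-- A crossing. -/
def cross (ov : Bool) (i : ℕ) : R := weight A ov • (1 : R) + weight A (!ov) • T.hook i

/-- Elements `X m` with `a` strands entering and `b` strands leaving in positions `m, m + 1, …`
commute with the elements `Y j` to the right of them. -/
def Passes (X : ℕ → R) (a b : ℕ) (Y : ℕ → R) : Prop :=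
  ∀ m j, m ≤ j → X m * Y (j + b) = Y (j + a) * X m

section Passes

variable {X X' Y Y' : ℕ → R} {a b c : ℕ}

theorem Passes.mul_right (h : Passes X a b Y) (h' : Passes X a b Y') :
    Passes X a b (fun j => Y j * Y' j) := fun m j hj => by
  simp only
  rw [← mul_assoc, h m j hj, mul_assoc, h' m j hj, mul_assoc]

theorem Passes.shift_right (h : Passes X a b Y) (k : ℕ) : Passes X a b (fun j => Y (j + k)) :=
  fun m j hj => by
    have := h m (j + k) (by omega)
    simpa only [Nat.add_right_comm _ k] using this

theorem Passes.add_right (h : Passes X a b Y) (h' : Passes X a b Y') :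
    Passes X a b (fun j => Y j + Y' j) := fun m j hj => by
  simp only [mul_add, add_mul, h m j hj, h' m j hj]

theorem Passes.smul_right (h : Passes X a b Y) (r : K) : Passes X a b (fun j => r • Y j) :=
  fun m j hj => by
    simp only [mul_smul_comm, smul_mul_assoc, h m j hj]

theorem Passes.one_right : Passes X a b (fun _ => (1 : R)) := fun m j hj => by simp

theorem Passes.mul_left (h : Passes X a b Y) (h' : Passes X' b c Y) :
    Passes (fun m => X m * X' m) a c Y := fun m j hj => by
  simp only
  rw [mul_assoc, h' m j hj, ← mul_assoc, h m j hj, mul_assoc]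

/-- Moving `X` to the right by `k` leaves `k` idle strands on its left, which are counted as both
entering and leaving. `Passes.pad` adds idle strands on the right instead. -/
theorem Passes.shift_left (h : Passes X a b Y) (k : ℕ) :
    Passes (fun m => X (m + k)) (a + k) (b + k) Y := fun m j hj => by
  have := h (m + k) (j + k) (by omega)
  simpa only [Nat.add_assoc, Nat.add_comm k] using this

theorem Passes.pad (h : Passes X a b Y) (k : ℕ) : Passes X (a + k) (b + k) Y := fun m j hj => by
  have := h m (j + k) (by omega)
  simpa only [Nat.add_assoc, Nat.add_comm k] using this

theorem Passes.add_left (h : Passes X a b Y) (h' : Passes X' a b Y) :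
    Passes (fun m => X m + X' m) a b Y := fun m j hj => by
  simp only [mul_add, add_mul, h m j hj, h' m j hj]

theorem Passes.smul_left (h : Passes X a b Y) (r : K) : Passes (fun m => r • X m) a b Y :=
  fun m j hj => by
    simp only [mul_smul_comm, smul_mul_assoc, h m j hj]

theorem Passes.one_left : Passes (fun _ => (1 : R)) a a Y := fun m j hj => by simp

end Passes

/-- Elements `Y j` commute with all cups and caps to the left of them. -/
structure Floats (Y : ℕ → R) : Prop where
  cup : Passes T.cup 0 2 Y
  cap : Passes T.cap 2 0 Y

section Floats

variable {T} {X X' Y Y' : ℕ → R} {a b c : ℕ}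

/-- The four exchange relations between generators are all that is needed: sums, products and
translates of elements inherit commutation at a distance, so it never has to be checked again for
crossings, bands or vertices. -/
theorem floats_cup : Floats T T.cup := ⟨fun _ _ h => T.cup_cup h, fun _ _ h => T.cap_cup h⟩

theorem floats_cap : Floats T T.cap := ⟨fun _ _ h => T.cup_cap h, fun _ _ h => T.cap_cap h⟩

theorem Floats.mul (h : Floats T Y) (h' : Floats T Y') : Floats T (fun j => Y j * Y' j) :=
  ⟨h.cup.mul_right h'.cup, h.cap.mul_right h'.cap⟩

theorem Floats.shift (h : Floats T Y) (k : ℕ) : Floats T (fun j => Y (j + k)) :=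
  ⟨h.cup.shift_right k, h.cap.shift_right k⟩

theorem Floats.add (h : Floats T Y) (h' : Floats T Y') : Floats T (fun j => Y j + Y' j) :=
  ⟨h.cup.add_right h'.cup, h.cap.add_right h'.cap⟩

theorem Floats.smul (h : Floats T Y) (r : K) : Floats T (fun j => r • Y j) :=
  ⟨h.cup.smul_right r, h.cap.smul_right r⟩

theorem floats_one : Floats T (fun _ => (1 : R)) := ⟨.one_right, .one_right⟩

theorem floats_hook : Floats T T.hook := floats_cap.mul floats_cup

theorem floats_cross (ov : Bool) : Floats T (T.cross ov) :=
  (floats_one.smul _).add (floats_hook.smul _)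

theorem Floats.hook (h : Floats T Y) : Passes T.hook 2 2 Y := h.cap.mul_left h.cup

theorem Floats.cross (h : Floats T Y) (ov : Bool) : Passes (T.cross ov) 2 2 Y :=
  (Passes.one_left.smul_left _).add_left (h.hook.smul_left _)

end Floats

variable {T}

theorem Passes.comm {X Y : ℕ → R} {a b : ℕ} (h : Passes X a b Y) {m j : ℕ} (hj : m + b ≤ j) :
    X m * Y j = Y (j - b + a) * X m := by
  have := h m (j - b) (by omega)
  rwa [Nat.sub_add_cancel (by omega)] at this

variable (T)

theorem hook_mul_hook (i : ℕ) : T.hook i * T.hook i = loopValue A • T.hook i := by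
  unfold hook
  rw [mul_assoc, ← mul_assoc (T.cup i), T.loop]
  simp

theorem cup_mul_hook (i : ℕ) : T.cup i * T.hook i = loopValue A • T.cup i := by
  unfold hook
  rw [← mul_assoc, T.loop]
  simp

theorem cup_mul_hook_succ (i : ℕ) : T.cup i * T.hook (i + 1) = T.cup (i + 1) := by
  unfold hook
  rw [← mul_assoc, T.zigzag_left, one_mul]

theorem cup_succ_mul_hook (i : ℕ) : T.cup (i + 1) * T.hook i = T.cup i := by
  unfold hook
  rw [← mul_assoc, T.zigzag_right, one_mul]

theorem hook_mul_cap_succ (i : ℕ) : T.hook i * T.cap (i + 1) = T.cap i := by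
  unfold hook
  rw [mul_assoc, T.zigzag_left, mul_one]

theorem hook_succ_mul_cap (i : ℕ) : T.hook (i + 1) * T.cap i = T.cap (i + 1) := by
  unfold hook
  rw [mul_assoc, T.zigzag_right, mul_one]

theorem hook_hook_succ_hook (i : ℕ) : T.hook i * (T.hook (i + 1) * T.hook i) = T.hook i := by
  have : T.hook i * (T.hook (i + 1) * T.hook i) =
      T.cap i * (T.cup i * T.hook (i + 1) * T.hook i) := by simp only [hook, mul_assoc]
  rw [this, cup_mul_hook_succ, cup_succ_mul_hook, hook]

theorem hook_succ_hook_hook_succ (i : ℕ) :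
    T.hook (i + 1) * (T.hook i * T.hook (i + 1)) = T.hook (i + 1) := by
  have : T.hook (i + 1) * (T.hook i * T.hook (i + 1)) =
      T.cap (i + 1) * (T.cup (i + 1) * T.hook i * T.hook (i + 1)) := by
    simp only [hook, mul_assoc]
  rw [this, cup_succ_mul_hook, cup_mul_hook_succ, hook]

theorem weight_ne_zero (hA : A ≠ 0) (ov : Bool) : weight A ov ≠ 0 := by
  cases ov <;> simp [weight, hA]

theorem weight_not (ov : Bool) : weight A (!ov) = (weight A ov)⁻¹ := by
  cases ov <;> simp [weight]

theorem loopValue_eq_weight (ov : Bool) :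
    loopValue A = -(weight A ov) ^ 2 - ((weight A ov)⁻¹) ^ 2 := by
  cases ov <;> simp [weight, loopValue, zpow_neg]
  ring

/-- With `w = weight A ov` and the hook `e`, the product `(w + w⁻¹ e)(w⁻¹ + w e)` has the
coefficient `w² + w⁻² + δ = 0` at `e`; this is what fixes the value of the loop. -/
theorem cross_mul_cross_not (ov : Bool) (i : ℕ) : T.cross ov i * T.cross (!ov) i = 1 := by
  have h := weight_ne_zero T.ne_zero ov
  simp only [cross, Bool.not_not, weight_not, mul_add, add_mul, mul_smul_comm, smul_mul_assoc,
    one_mul, mul_one, hook_mul_hook, loopValue_eq_weight ov]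
  match_scalars <;> field_simp
  ring

theorem cup_mul_cross_succ (ov : Bool) (i : ℕ) :
    T.cup i * T.cross ov (i + 1) = T.cup (i + 1) * T.cross (!ov) i := by
  simp only [cross, Bool.not_not, mul_add, mul_smul_comm, mul_one, cup_mul_hook_succ,
    cup_succ_mul_hook]
  rw [add_comm]

theorem cross_mul_cap_succ (ov : Bool) (i : ℕ) :
    T.cross ov i * T.cap (i + 1) = T.cross (!ov) (i + 1) * T.cap i := by
  simp only [cross, Bool.not_not, add_mul, smul_mul_assoc, one_mul, hook_mul_cap_succ,
    hook_succ_mul_cap]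
  rw [add_comm]

/-- The vertical smoothing closes a loop and the horizontal one leaves a zigzag, so the factor is `w
δ + w⁻¹ = -w³`. -/
theorem curl_right (ov : Bool) (i : ℕ) :
    T.cup (i + 1) * T.cross ov i * T.cap (i + 1) = (-weight A ov ^ 3) • (1 : R) := by
  have h := weight_ne_zero T.ne_zero ov
  simp only [cross, weight_not, mul_add, add_mul, mul_smul_comm, smul_mul_assoc, mul_one,
    cup_succ_mul_hook, T.loop, T.zigzag_left, loopValue_eq_weight ov]
  match_scalars
  field_simp
  ring

theorem curl_left (ov : Bool) (i : ℕ) :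
    T.cup i * T.cross ov (i + 1) * T.cap i = (-weight A ov ^ 3) • (1 : R) := by
  have h := weight_ne_zero T.ne_zero ov
  simp only [cross, weight_not, mul_add, add_mul, mul_smul_comm, smul_mul_assoc, mul_one,
    cup_mul_hook_succ, T.loop, T.zigzag_right, loopValue_eq_weight ov]
  match_scalars
  field_simp
  ring

/-- Both sides are expanded in `1, e_i, e_{i+1}, e_i e_{i+1}, e_{i+1} e_i` and compared
coefficientwise for the six patterns of over- and underpasses that are not cyclic. -/
theorem triangle (i : ℕ) (o₁₂ o₁₃ o₂₃ : Bool) (h : o₁₂ = o₂₃ → o₁₃ = o₁₂) :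
    T.cross o₁₂ i * T.cross o₁₃ (i + 1) * T.cross o₂₃ i =
      T.cross o₂₃ (i + 1) * T.cross o₁₃ i * T.cross o₁₂ (i + 1) := by
  have hA := T.ne_zero
  simp only [cross, mul_add, add_mul, mul_smul_comm, smul_mul_assoc, mul_one, one_mul, mul_assoc,
    hook_mul_hook, hook_hook_succ_hook, hook_succ_hook_hook_succ, loopValue, zpow_neg, zpow_ofNat]
  cases o₁₂ <;> cases o₁₃ <;> cases o₂₃ <;> simp only [weight] <;> simp at h ⊢ <;>
    match_scalars <;> field_simp <;> ring

end TemperleyLieb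
end ThetaCurve

/-! ### Bands, their two idempotents, and the moves of bands. -/

namespace ThetaCurve
namespace TemperleyLieb

variable {K : Type} [Field K] {A : K} {R : Type} [Ring R] [Algebra K R] (T : TemperleyLieb A R)

theorem mul_mul_of_eq {a b c : R} (h : a * b = c) (z : R) : a * (b * z) = c * z := by
  rw [← mul_assoc, h]

theorem mul_mul_of_eq_mul {a b c d : R} (h : a * b = c * d) (z : R) :
    a * (b * z) = c * (d * z) := by
  rw [← mul_assoc, h, mul_assoc]

theorem loopValue_ne_zero (T : TemperleyLieb A R) : loopValue A ≠ 0 := by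
  have h := T.loop_ne_zero
  intro h'
  apply h
  unfold loopValue at h'
  linear_combination -h'

/-- A local minimum of a band. -/
def bandCup (m : ℕ) : R := T.cup m * T.cup (m + 1)

/-- A local maximum of a band. -/
def bandCap (m : ℕ) : R := T.cap (m + 1) * T.cap m

/-- A crossing of bands. -/
def bandCross (ov : Bool) (m : ℕ) : R :=
  T.cross ov (m + 1) * T.cross ov m * T.cross ov (m + 2) * T.cross ov (m + 1)

/-- The vertex at which three bands begin. -/
def bandTail (m : ℕ) : R := T.cup m * T.cup (m + 1) * T.cup (m + 3)

/-- The vertex at which three bands end. -/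
def bandHead (m : ℕ) : R := T.cap (m + 3) * T.cap (m + 1) * T.cap m

/-- The two complementary idempotents of a band. -/
def proj (γ : Bool) (m : ℕ) : R :=
  -- `true` stands for the Jones-Wenzl idempotent, the value of a bar; `false` stands for cutting
  -- the band, divided by the value of a loop.
  if γ then 1 - (loopValue A)⁻¹ • T.hook m else (loopValue A)⁻¹ • T.hook m

section Floats

variable {T} {Y : ℕ → R}

theorem floats_proj (γ : Bool) : Floats T (T.proj γ) := by
  cases γ
  · exact floats_hook.smul _
  · have : T.proj true = fun m => 1 + (-(loopValue A)⁻¹) • T.hook m := by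
      funext m; simp [proj, sub_eq_add_neg]
    rw [this]
    exact floats_one.add (floats_hook.smul _)

theorem floats_bandCup : Floats T T.bandCup := floats_cup.mul (floats_cup.shift 1)

theorem floats_bandCap : Floats T T.bandCap := (floats_cap.shift 1).mul floats_cap

theorem floats_bandCross (ov : Bool) : Floats T (T.bandCross ov) :=
  ((((floats_cross ov).shift 1).mul (floats_cross ov)).mul ((floats_cross ov).shift 2)).mul
    ((floats_cross ov).shift 1)

theorem floats_bandTail : Floats T T.bandTail :=
  (floats_cup.mul (floats_cup.shift 1)).mul (floats_cup.shift 3)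

theorem floats_bandHead : Floats T T.bandHead :=
  ((floats_cap.shift 3).mul (floats_cap.shift 1)).mul floats_cap

theorem Floats.proj (h : Floats T Y) (γ : Bool) : Passes (T.proj γ) 2 2 Y := by
  cases γ
  · exact h.hook.smul_left _
  · have : T.proj true = fun m => 1 + (-(loopValue A)⁻¹) • T.hook m := by
      funext m; simp [TemperleyLieb.proj, sub_eq_add_neg]
    rw [this]
    exact Passes.one_left.add_left (h.hook.smul_left _)

theorem Floats.bandCup (h : Floats T Y) : Passes T.bandCup 0 4 Y :=
  h.cup.mul_left ((h.cup.shift_left 1).pad 1)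

theorem Floats.bandCap (h : Floats T Y) : Passes T.bandCap 4 0 Y :=
  ((h.cap.shift_left 1).pad 1).mul_left h.cap

theorem Floats.bandCross (h : Floats T Y) (ov : Bool) : Passes (T.bandCross ov) 4 4 Y :=
  (((((h.cross ov).shift_left 1).pad 1).mul_left ((h.cross ov).pad 2)).mul_left
    ((h.cross ov).shift_left 2)).mul_left (((h.cross ov).shift_left 1).pad 1)

theorem Floats.bandTail (h : Floats T Y) : Passes T.bandTail 0 6 Y :=
  (h.cup.mul_left ((h.cup.shift_left 1).pad 1)).mul_left ((h.cup.shift_left 3).pad 1)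

theorem Floats.bandHead (h : Floats T Y) : Passes T.bandHead 6 0 Y :=
  (((h.cap.shift_left 3).pad 1).mul_left ((h.cap.shift_left 1).pad 1)).mul_left h.cap

end Floats

theorem cross_comm (o o' : Bool) {i j : ℕ} (h : i + 2 ≤ j) :
    T.cross o i * T.cross o' j = T.cross o' j * T.cross o i := by
  have := ((floats_cross (T := T) o').cross o).comm h
  rwa [show j - 2 + 2 = j by omega] at this

theorem cross_not_mul_cross (ov : Bool) (i : ℕ) : T.cross (!ov) i * T.cross ov i = 1 := by
  simpa using T.cross_mul_cross_not (!ov) i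

theorem cup_succ_mul_cross (ov : Bool) (i : ℕ) :
    T.cup (i + 1) * T.cross ov i = T.cup i * T.cross (!ov) (i + 1) := by
  simpa using (T.cup_mul_cross_succ (!ov) i).symm

theorem cross_succ_mul_cap (ov : Bool) (i : ℕ) :
    T.cross ov (i + 1) * T.cap i = T.cross (!ov) i * T.cap (i + 1) := by
  simpa using (T.cross_mul_cap_succ (!ov) i).symm

/-- An arc that closes the end of a band can be pulled back through a crossing with another band: it
moves past the two strands of that band by second Reidemeister moves. Hence crossings with cut bands
disappear. The next three lemmas treat the other ends. -/
theorem cup_mul_bandCross (ov : Bool) (m : ℕ) : T.cup m * T.bandCross ov m = T.cup (m + 2) := by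
  simp only [bandCross, mul_assoc]
  rw [mul_mul_of_eq_mul (T.cup_mul_cross_succ ov m), mul_mul_of_eq (T.cross_not_mul_cross ov m),
    one_mul, mul_mul_of_eq_mul (T.cup_mul_cross_succ ov (m + 1)), T.cross_not_mul_cross, mul_one]

theorem cup_add_two_mul_bandCross (ov : Bool) (m : ℕ) :
    T.cup (m + 2) * T.bandCross ov m = T.cup m := by
  simp only [bandCross, mul_assoc]
  rw [mul_mul_of_eq_mul (T.cup_succ_mul_cross ov (m + 1)),
    mul_mul_of_eq_mul (T.cross_comm ov ov (le_refl (m + 2))),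
    mul_mul_of_eq (T.cross_not_mul_cross ov (m + 2)),
    one_mul, mul_mul_of_eq_mul (T.cup_succ_mul_cross ov m), T.cross_not_mul_cross, mul_one]

theorem bandCross_mul_cap (ov : Bool) (m : ℕ) : T.bandCross ov m * T.cap m = T.cap (m + 2) := by
  simp only [bandCross, mul_assoc]
  rw [T.cross_succ_mul_cap ov m, ← mul_mul_of_eq_mul (T.cross_comm (!ov) ov (le_refl (m + 2))),
    mul_mul_of_eq (T.cross_mul_cross_not ov m), one_mul,
    T.cross_succ_mul_cap ov (m + 1), mul_mul_of_eq (T.cross_mul_cross_not ov (m + 1)), one_mul]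

theorem bandCross_mul_cap_add_two (ov : Bool) (m : ℕ) :
    T.bandCross ov m * T.cap (m + 2) = T.cap m := by
  simp only [bandCross, mul_assoc]
  rw [T.cross_mul_cap_succ ov (m + 1), mul_mul_of_eq (T.cross_mul_cross_not ov (m + 2)), one_mul,
    T.cross_mul_cap_succ ov m, mul_mul_of_eq (T.cross_mul_cross_not ov (m + 1)), one_mul]

theorem bandCup_mul_cap (m : ℕ) : T.bandCup m * T.cap m = T.cup m := by
  rw [bandCup, mul_assoc, T.zigzag_right, mul_one]

theorem bandCup_mul_cap_add_two (m : ℕ) : T.bandCup m * T.cap (m + 2) = T.cup m := by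
  rw [bandCup, mul_assoc, T.zigzag_left, mul_one]

theorem cup_mul_bandCap (m : ℕ) : T.cup m * T.bandCap m = T.cap m := by
  rw [bandCap, ← mul_assoc, T.zigzag_left, one_mul]

theorem cup_add_two_mul_bandCap (m : ℕ) : T.cup (m + 2) * T.bandCap m = T.cap m := by
  rw [bandCap, ← mul_assoc, T.zigzag_right, one_mul]

theorem cup_mul_cup_add_two (m : ℕ) : T.cup m * T.cup (m + 2) = T.cup m * T.cup m :=
  T.cup_cup le_rfl

theorem cap_add_two_mul_cap (m : ℕ) : T.cap (m + 2) * T.cap m = T.cap m * T.cap m :=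
  (T.cap_cap le_rfl).symm

/-! ### Bars slide along bands -/

/-- Cutting a local minimum of a band on either side leaves the same picture, two ends of bands next
to each other. -/
theorem bandCup_mul_hook (m : ℕ) :
    T.bandCup m * T.hook m = T.bandCup m * T.hook (m + 2) := by
  simp only [hook, ← mul_assoc, bandCup_mul_cap, bandCup_mul_cap_add_two, cup_mul_cup_add_two]

theorem hook_mul_bandCap (m : ℕ) :
    T.hook m * T.bandCap m = T.hook (m + 2) * T.bandCap m := by
  simp only [hook, mul_assoc, cup_mul_bandCap, cup_add_two_mul_bandCap, cap_add_two_mul_cap]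

theorem hook_mul_bandCross (ov : Bool) (m : ℕ) :
    T.hook m * T.bandCross ov m = T.bandCross ov m * T.hook (m + 2) := by
  simp only [hook]
  rw [mul_assoc, cup_mul_bandCross, ← mul_assoc, bandCross_mul_cap_add_two]

theorem hook_add_two_mul_bandCross (ov : Bool) (m : ℕ) :
    T.hook (m + 2) * T.bandCross ov m = T.bandCross ov m * T.hook m := by
  simp only [hook]
  rw [mul_assoc, cup_add_two_mul_bandCross, ← mul_assoc, bandCross_mul_cap]

theorem bandCup_mul_proj (γ : Bool) (m : ℕ) :
    T.bandCup m * T.proj γ m = T.bandCup m * T.proj γ (m + 2) := by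
  cases γ <;> simp [proj, mul_sub, bandCup_mul_hook]

theorem proj_mul_bandCap (γ : Bool) (m : ℕ) :
    T.proj γ m * T.bandCap m = T.proj γ (m + 2) * T.bandCap m := by
  cases γ <;> simp [proj, sub_mul, hook_mul_bandCap]

theorem proj_mul_bandCross (γ ov : Bool) (m : ℕ) :
    T.proj γ m * T.bandCross ov m = T.bandCross ov m * T.proj γ (m + 2) := by
  cases γ <;> simp [proj, sub_mul, mul_sub, hook_mul_bandCross]

theorem proj_add_two_mul_bandCross (γ ov : Bool) (m : ℕ) :
    T.proj γ (m + 2) * T.bandCross ov m = T.bandCross ov m * T.proj γ m := by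
  cases γ <;> simp [proj, sub_mul, mul_sub, hook_add_two_mul_bandCross]

theorem proj_mul_self (γ : Bool) (m : ℕ) : T.proj γ m * T.proj γ m = T.proj γ m := by
  have h := T.loopValue_ne_zero
  cases γ
  · simp [proj, hook_mul_hook, smul_smul, h]
  · simp [proj, sub_mul, mul_sub, hook_mul_hook, smul_smul, h]

theorem proj_mul_proj_of_ne {γ γ' : Bool} (hγ : γ ≠ γ') (m : ℕ) :
    T.proj γ m * T.proj γ' m = 0 := by
  have h := T.loopValue_ne_zero
  cases γ <;> cases γ' <;> simp [proj, sub_mul, mul_sub, hook_mul_hook, smul_smul, h] at hγ ⊢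

theorem proj_true_add_proj_false (m : ℕ) : T.proj true m + T.proj false m = 1 := by
  simp [proj]

theorem proj_comm (γ γ' : Bool) {i j : ℕ} (h : i + 2 ≤ j) :
    T.proj γ i * T.proj γ' j = T.proj γ' j * T.proj γ i := by
  have := ((floats_proj (T := T) γ').proj γ).comm h
  rwa [show j - 2 + 2 = j by omega] at this

theorem cup_mul_proj_false (m : ℕ) : T.cup m * T.proj false m = T.cup m := by
  simp [proj, cup_mul_hook, smul_smul, T.loopValue_ne_zero]

theorem cup_mul_proj_true (m : ℕ) : T.cup m * T.proj true m = 0 := by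
  simp [proj, mul_sub, cup_mul_hook, smul_smul, T.loopValue_ne_zero]

/-- The hook annihilates this idempotent, so only the vertical smoothing survives. -/
theorem cross_mul_proj_true (ov : Bool) (m : ℕ) :
    T.cross ov m * T.proj true m = weight A ov • T.proj true m := by
  have h := T.loopValue_ne_zero
  have : T.hook m * T.proj true m = 0 := by rw [hook, mul_assoc, cup_mul_proj_true, mul_zero]
  simp [cross, add_mul, this]

/-- On this idempotent the hook acts as `δ`, and `w + w⁻¹ δ = -w⁻³`: the crossing becomes a curl in
the end of the cut band. -/
theorem cross_mul_proj_false (ov : Bool) (m : ℕ) :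
    T.cross ov m * T.proj false m = (-(weight A (!ov)) ^ 3) • T.proj false m := by
  have h := T.loopValue_ne_zero
  have hw := weight_ne_zero T.ne_zero ov
  have : T.hook m * T.proj false m = loopValue A • T.proj false m := by
    simp [proj, hook_mul_hook, smul_smul, mul_comm]
  simp only [cross, add_mul, this, smul_mul_assoc, one_mul, smul_smul, ← add_smul, weight_not,
    loopValue_eq_weight ov]
  congr 1
  field_simp
  ring

/-! ### Moves of bands -/

theorem band_zigzag_left (m : ℕ) : T.bandCup m * T.bandCap (m + 2) = 1 := by
  simp only [bandCup, bandCap, mul_assoc]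
  rw [mul_mul_of_eq_mul (T.cup_cap (le_refl (m + 1))), mul_mul_of_eq (T.zigzag_left m),
    one_mul, T.zigzag_left]

theorem band_zigzag_right (m : ℕ) : T.bandCup (m + 2) * T.bandCap m = 1 := by
  simp only [bandCup, bandCap, mul_assoc]
  rw [← mul_mul_of_eq_mul (T.cap_cup (le_refl (m + 1))),
    mul_mul_of_eq (T.zigzag_right (m + 1)), one_mul, T.zigzag_right]

theorem bandCross_mul_bandCross_not (ov : Bool) (m : ℕ) :
    T.bandCross ov m * T.bandCross (!ov) m = 1 := by
  simp only [bandCross, mul_assoc]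
  rw [mul_mul_of_eq (T.cross_mul_cross_not ov (m + 1)), one_mul,
    ← mul_mul_of_eq_mul (T.cross_comm (!ov) ov (le_refl (m + 2))),
    mul_mul_of_eq (T.cross_mul_cross_not ov m), one_mul,
    mul_mul_of_eq (T.cross_mul_cross_not ov (m + 2)), one_mul, T.cross_mul_cross_not]

theorem cup_mul_cross_of_le (ov : Bool) {i j : ℕ} (h : i ≤ j) :
    T.cup i * T.cross ov (j + 2) = T.cross ov j * T.cup i := (floats_cross ov).cup i j h

theorem cap_mul_cross_of_le (ov : Bool) {i j : ℕ} (h : i ≤ j) :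
    T.cap i * T.cross ov j = T.cross ov (j + 2) * T.cap i := (floats_cross ov).cap i j h

theorem cross_mul_cup_of_le (ov : Bool) {i j : ℕ} (h : i + 2 ≤ j) :
    T.cross ov i * T.cup j = T.cup j * T.cross ov i := by
  have := (floats_cup (T := T)).cross ov i (j - 2) (by omega)
  rwa [show j - 2 + 2 = j by omega] at this

theorem cross_mul_cap_of_le (ov : Bool) {i j : ℕ} (h : i + 2 ≤ j) :
    T.cross ov i * T.cap j = T.cap j * T.cross ov i := by
  have := (floats_cap (T := T)).cross ov i (j - 2) (by omega)
  rwa [show j - 2 + 2 = j by omega] at this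

theorem bandCup_mul_bandCross (ov : Bool) (m : ℕ) :
    T.bandCup m * T.bandCross ov (m + 2) = T.bandCup (m + 2) * T.bandCross (!ov) m := by
  simp only [bandCup, bandCross, mul_assoc, Nat.add_assoc, Nat.reduceAdd]
  have e₁ : T.cup (m + 1) * T.cross ov (m + 3) = T.cross ov (m + 1) * T.cup (m + 1) :=
    T.cup_mul_cross_of_le ov le_rfl
  have e₂ : T.cup m * T.cross ov (m + 1) = T.cup (m + 1) * T.cross (!ov) m :=
    T.cup_mul_cross_succ ov m
  have e₃ : T.cup (m + 1) * T.cross ov (m + 2) = T.cup (m + 2) * T.cross (!ov) (m + 1) :=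
    T.cup_mul_cross_succ ov (m + 1)
  have e₄ : T.cup (m + 2) * T.cross ov (m + 3) = T.cup (m + 3) * T.cross (!ov) (m + 2) :=
    T.cup_mul_cross_succ ov (m + 2)
  have e₅ : T.cup (m + 2) * T.cross ov (m + 4) = T.cross ov (m + 2) * T.cup (m + 2) :=
    T.cup_mul_cross_of_le ov le_rfl
  rw [mul_mul_of_eq_mul e₁, mul_mul_of_eq_mul e₂, mul_mul_of_eq_mul e₃,
    mul_mul_of_eq_mul (T.cross_comm (!ov) ov (show m + 1 + 2 ≤ m + 4 by omega)),
    mul_mul_of_eq_mul e₅,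
    mul_mul_of_eq_mul (T.cross_comm (!ov) ov (le_refl (m + 2))), mul_mul_of_eq_mul e₃,
    T.cross_comm (!ov) ov (show m + 1 + 2 ≤ m + 3 from le_rfl), mul_mul_of_eq_mul e₄,
    mul_mul_of_eq_mul (T.cross_mul_cup_of_le (!ov) (show m + 2 ≤ m + 3 by omega)),
    mul_mul_of_eq_mul (T.cross_mul_cup_of_le (!ov) (show m + 1 + 2 ≤ m + 3 from le_rfl))]

theorem bandCross_mul_bandCap (ov : Bool) (m : ℕ) :
    T.bandCross ov m * T.bandCap (m + 2) = T.bandCross (!ov) (m + 2) * T.bandCap m := by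
  simp only [bandCap, bandCross, mul_assoc, Nat.add_assoc, Nat.reduceAdd]
  have e₁ : T.cap (m + 1) * T.cross (!ov) (m + 1) = T.cross (!ov) (m + 3) * T.cap (m + 1) :=
    T.cap_mul_cross_of_le (!ov) le_rfl
  have e₂ : T.cross ov m * T.cap (m + 1) = T.cross (!ov) (m + 1) * T.cap m :=
    T.cross_mul_cap_succ ov m
  have e₃ : T.cross ov (m + 1) * T.cap (m + 2) = T.cross (!ov) (m + 2) * T.cap (m + 1) :=
    T.cross_mul_cap_succ ov (m + 1)
  have e₄ : T.cross ov (m + 2) * T.cap (m + 3) = T.cross (!ov) (m + 3) * T.cap (m + 2) :=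
    T.cross_mul_cap_succ ov (m + 2)
  have e₅ : T.cap (m + 2) * T.cross (!ov) (m + 2) = T.cross (!ov) (m + 4) * T.cap (m + 2) :=
    T.cap_mul_cross_of_le (!ov) le_rfl
  rw [mul_mul_of_eq_mul (T.cross_mul_cap_of_le ov (show m + 1 + 2 ≤ m + 3 from le_rfl)), e₃,
    mul_mul_of_eq_mul e₄,
    mul_mul_of_eq_mul (T.cross_comm ov (!ov) (show m + 2 ≤ m + 3 by omega)),
    mul_mul_of_eq_mul (T.cross_comm ov (!ov) (show m + 1 + 2 ≤ m + 3 from le_rfl)),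
    mul_mul_of_eq_mul e₅,
    mul_mul_of_eq_mul (T.cross_comm ov (!ov) (show m + 2 ≤ m + 4 by omega)),
    mul_mul_of_eq_mul (T.cross_comm ov (!ov) (show m + 1 + 2 ≤ m + 4 by omega)),
    mul_mul_of_eq_mul (T.cross_mul_cap_of_le ov (show m + 2 ≤ m + 2 from le_rfl)),
    mul_mul_of_eq_mul e₃, e₂, mul_mul_of_eq_mul e₁,
    ← mul_mul_of_eq_mul (T.cross_comm (!ov) (!ov) (show m + 2 + 2 ≤ m + 4 from le_rfl))]

/-- A curl of a band can be undone at the price of a curl in each boundary strand and a full twist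
of the band. The two curls contribute `(-w³)²`; the two crossings that remain are the full twist. -/
theorem band_curl_right (ov : Bool) (m : ℕ) :
    T.bandCup (m + 2) * T.bandCross ov m * T.bandCap (m + 2) =
      (weight A ov ^ 6) • (T.cross ov m * T.cross ov m) := by
  simp only [bandCup, bandCap, bandCross, mul_assoc, Nat.add_assoc, Nat.reduceAdd]
  have c₁ : T.cup (m + 3) * (T.cross ov (m + 2) * T.cap (m + 3)) =
      (-weight A ov ^ 3) • (1 : R) := by rw [← mul_assoc]; exact T.curl_right ov (m + 2)
  have c₂ : T.cup (m + 2) * (T.cross ov (m + 1) * T.cap (m + 2)) =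
      (-weight A ov ^ 3) • (1 : R) := by rw [← mul_assoc]; exact T.curl_right ov (m + 1)
  have t : T.cross ov (m + 1) * (T.cross ov m * (T.cross ov (m + 1) * T.cap (m + 2))) =
      T.cross ov m * (T.cross ov (m + 1) * (T.cross ov m * T.cap (m + 2))) := by
    simpa only [mul_assoc] using
      congrArg (· * T.cap (m + 2)) (T.triangle m ov ov ov (fun _ => rfl)).symm
  have e : T.cup (m + 2) * T.cross ov m = T.cross ov m * T.cup (m + 2) :=
    (T.cross_mul_cup_of_le ov le_rfl).symm
  calc _ = T.cup (m + 2) * (T.cross ov (m + 1) * (T.cross ov m * ((T.cup (m + 3) *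
        (T.cross ov (m + 2) * T.cap (m + 3))) * (T.cross ov (m + 1) * T.cap (m + 2))))) := by
        rw [mul_mul_of_eq_mul (T.cross_mul_cap_of_le ov (show m + 1 + 2 ≤ m + 3 from le_rfl)),
          ← mul_mul_of_eq_mul (T.cross_mul_cup_of_le ov (show m + 1 + 2 ≤ m + 3 from le_rfl)),
          ← mul_mul_of_eq_mul (T.cross_mul_cup_of_le ov (show m + 2 ≤ m + 3 by omega))]
        simp only [mul_assoc]
    _ = (-weight A ov ^ 3) • (T.cross ov m * ((T.cup (m + 2) *
        (T.cross ov (m + 1) * T.cap (m + 2))) * T.cross ov m)) := by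
        rw [c₁]
        simp only [smul_mul_assoc, mul_smul_comm, one_mul]
        rw [t, mul_mul_of_eq_mul e, T.cross_mul_cap_of_le ov (show m + 2 ≤ m + 2 from le_rfl)]
        simp only [mul_assoc]
    _ = _ := by
        rw [c₂]
        simp only [smul_mul_assoc, mul_smul_comm, one_mul, smul_smul]
        congr 1
        ring

theorem band_curl_left (ov : Bool) (m : ℕ) :
    T.bandCup m * T.bandCross ov (m + 2) * T.bandCap m =
      (weight A ov ^ 6) • (T.cross ov m * T.cross ov m) := by
  simp only [bandCup, bandCap, bandCross, mul_assoc, Nat.add_assoc, Nat.reduceAdd]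
  have c₁ : T.cup (m + 1) * (T.cross ov (m + 2) * T.cap (m + 1)) =
      (-weight A ov ^ 3) • (1 : R) := by rw [← mul_assoc]; exact T.curl_left ov (m + 1)
  have c₂ : T.cup m * (T.cross ov (m + 1) * T.cap m) =
      (-weight A ov ^ 3) • (1 : R) := by rw [← mul_assoc]; exact T.curl_left ov m
  have t : T.cross ov (m + 1) * (T.cross ov (m + 2) * (T.cross ov (m + 1) * T.cap m)) =
      T.cross ov (m + 2) * (T.cross ov (m + 1) * (T.cross ov (m + 2) * T.cap m)) := by
    simpa only [mul_assoc] using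
      congrArg (· * T.cap m) (T.triangle (m + 1) ov ov ov (fun _ => rfl))
  have e₁ : T.cup (m + 1) * T.cross ov (m + 3) = T.cross ov (m + 1) * T.cup (m + 1) :=
    T.cup_mul_cross_of_le ov le_rfl
  have e₂ : T.cap (m + 1) * T.cross ov (m + 1) = T.cross ov (m + 3) * T.cap (m + 1) :=
    T.cap_mul_cross_of_le ov le_rfl
  have e₃ : T.cap (m + 1) * T.cross ov (m + 2) = T.cross ov (m + 4) * T.cap (m + 1) :=
    T.cap_mul_cross_of_le ov (by omega)
  have e₄ : T.cup m * T.cross ov (m + 2) = T.cross ov m * T.cup m :=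
    T.cup_mul_cross_of_le ov le_rfl
  have e₅ : T.cap m * T.cross ov m = T.cross ov (m + 2) * T.cap m :=
    T.cap_mul_cross_of_le ov le_rfl
  calc _ = T.cup m * (T.cross ov (m + 1) * ((T.cup (m + 1) *
        (T.cross ov (m + 2) * T.cap (m + 1))) * (T.cross ov (m + 2) * (T.cross ov (m + 1) *
          T.cap m)))) := by
        rw [mul_mul_of_eq_mul e₁, ← mul_mul_of_eq_mul e₂, ← mul_mul_of_eq_mul e₃]
        simp only [mul_assoc]
    _ = (-weight A ov ^ 3) • (T.cross ov m * ((T.cup m *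
        (T.cross ov (m + 1) * T.cap m)) * T.cross ov m)) := by
        rw [c₁]
        simp only [smul_mul_assoc, mul_smul_comm, one_mul]
        rw [t, mul_mul_of_eq_mul e₄, ← e₅]
        simp only [mul_assoc]
    _ = _ := by
        rw [c₂]
        simp only [smul_mul_assoc, mul_smul_comm, one_mul, smul_smul]
        congr 1
        ring

/-- A third Reidemeister move of bands consists of eight moves of strands, one for each choice of
one strand from each of the three bands; the remaining rewrites exchange distant crossings. -/
theorem band_triangle (m : ℕ) (o₁₂ o₁₃ o₂₃ : Bool) (h : o₁₂ = o₂₃ → o₁₃ = o₁₂) :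
    T.bandCross o₁₂ m * T.bandCross o₁₃ (m + 2) * T.bandCross o₂₃ m =
      T.bandCross o₂₃ (m + 2) * T.bandCross o₁₃ m * T.bandCross o₁₂ (m + 2) := by
  set p := T.cross o₁₂ with hp
  set q := T.cross o₁₃ with hq
  set r := T.cross o₂₃ with hr
  have t (i : ℕ) (z : R) : p i * (q (i + 1) * (r i * z)) = r (i + 1) * (q i * (p (i + 1) * z)) := by
    simpa only [mul_assoc] using congrArg (· * z) (T.triangle i o₁₂ o₁₃ o₂₃ h)
  have pq {i j : ℕ} (hij : i + 2 ≤ j) (z : R) : p i * (q j * z) = q j * (p i * z) :=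
    mul_mul_of_eq_mul (T.cross_comm _ _ hij) z
  have qp {i j : ℕ} (hij : i + 2 ≤ j) (z : R) : q i * (p j * z) = p j * (q i * z) :=
    mul_mul_of_eq_mul (T.cross_comm _ _ hij) z
  have pr {i j : ℕ} (hij : i + 2 ≤ j) (z : R) : p i * (r j * z) = r j * (p i * z) :=
    mul_mul_of_eq_mul (T.cross_comm _ _ hij) z
  have rp {i j : ℕ} (hij : i + 2 ≤ j) (z : R) : r i * (p j * z) = p j * (r i * z) :=
    mul_mul_of_eq_mul (T.cross_comm _ _ hij) z
  have qr {i j : ℕ} (hij : i + 2 ≤ j) (z : R) : q i * (r j * z) = r j * (q i * z) :=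
    mul_mul_of_eq_mul (T.cross_comm _ _ hij) z
  have rq {i j : ℕ} (hij : i + 2 ≤ j) (z : R) : r i * (q j * z) = q j * (r i * z) :=
    mul_mul_of_eq_mul (T.cross_comm _ _ hij) z
  have t₀ (z : R) := t m z
  have t₁ (z : R) : p (m + 1) * (q (m + 2) * (r (m + 1) * z)) =
    r (m + 2) * (q (m + 1) * (p (m + 2) * z)) := t (m + 1) z
  have t₂ (z : R) : p (m + 2) * (q (m + 3) * (r (m + 2) * z)) =
    r (m + 3) * (q (m + 2) * (p (m + 3) * z)) := t (m + 2) z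
  have t₃ (z : R) : p (m + 3) * (q (m + 4) * (r (m + 3) * z)) =
    r (m + 4) * (q (m + 3) * (p (m + 4) * z)) := t (m + 3) z
  -- The spare right factor `z` lets each relation be applied inside a right-associated product
  -- without a special case at its end.
  suffices H : ∀ z : R, p (m + 1) * (p m * (p (m + 2) * (p (m + 1) * (q (m + 3) * (q (m + 2) *
      (q (m + 4) * (q (m + 3) * (r (m + 1) * (r m * (r (m + 2) * (r (m + 1) * z))))))))))) =
      r (m + 3) * (r (m + 2) * (r (m + 4) * (r (m + 3) * (q (m + 1) * (q m * (q (m + 2) *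
      (q (m + 1) * (p (m + 3) * (p (m + 2) * (p (m + 4) * (p (m + 3) * z))))))))))) by
    have := H 1
    simpa only [bandCross, mul_assoc, Nat.add_assoc, Nat.reduceAdd, mul_one, ← hp, ← hq, ← hr]
  intro z
  have l₀₂ : m + 2 ≤ m + 2 := by omega
  have l₀₃ : m + 2 ≤ m + 3 := by omega
  have l₀₄ : m + 2 ≤ m + 4 := by omega
  have l₁₃ : m + 1 + 2 ≤ m + 3 := by omega
  have l₁₄ : m + 1 + 2 ≤ m + 4 := by omega
  have l₂₄ : m + 2 + 2 ≤ m + 4 := by omega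
  rw [pq l₁₃, ← rq l₁₃, ← rq l₁₄, ← rq l₀₃, ← rq l₀₄, t₁, ← rp l₀₂, pq l₂₄, t₂, pr l₀₃, pr
    l₁₃, pq l₀₂, ← qp l₁₃, ← rp l₀₃, t₀, t₁, ← qp l₀₂, t₂, ← rp l₁₃, t₃, pr l₁₄, pr l₂₄,
    qr l₀₄, qr l₁₄, pq l₁₃, ← qp l₂₄, ← rp l₁₄, t₁, t₂, qr l₀₃, qr l₁₃, ← qp l₁₃]

end TemperleyLieb
end ThetaCurve

/-! ### The recursive state expansion computes the Temperley-Lieb element. -/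

namespace ThetaCurve

variable {α : Type}

/-- The slices of a bar diagram fit together if one starts with `n` strands. -/
def BarFits : List (BarSlice α) → ℕ → Prop
  | [], n => n = 0
  | .strand s :: w, n => s.pos + s.ins ≤ n ∧ BarFits w (n - s.ins + s.outs)
  | .bar i :: w, n => 2 * i + 2 ≤ n ∧ BarFits w n

/-! ### Planar matchings -/

/-- The position after deletion of positions `j` and `j + 1`. -/
def below (j p : ℕ) : ℕ := if p < j then p else p - 2

/-- The position before deletion of positions `i` and `i + 1`. -/
def above (i p : ℕ) : ℕ := if p < i then p else p + 2

/-- The connections after adding an arc in positions `j` and `j + 1`. -/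
def OpenRel (j : ℕ) (r : ℕ → ℕ → Prop) (p q : ℕ) : Prop :=
  ((p = j ∨ p = j + 1) ∧ (q = j ∨ q = j + 1)) ∨
    (¬(p = j ∨ p = j + 1) ∧ ¬(q = j ∨ q = j + 1) ∧ r (below j p) (below j q))

/-- The connections after joining the arcs in positions `i` and `i + 1`. -/
def JoinRel (i : ℕ) (r : ℕ → ℕ → Prop) (p q : ℕ) : Prop :=
  r (above i p) (above i q) ∨
    ((r (above i p) i ∨ r (above i p) (i + 1)) ∧ (r (above i q) i ∨ r (above i q) (i + 1)))

/-- The connections of a word of cups, the last of which is the head of the list. -/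
def cupRel : List ℕ → ℕ → ℕ → Prop
  | [] => Eq
  | j :: c => OpenRel j (cupRel c)

/-- The positions in a word of cups exist. -/
def CupsFit : List ℕ → Prop
  | [] => True
  | j :: c => j ≤ 2 * c.length ∧ CupsFit c

theorem openRel_equivalence {r : ℕ → ℕ → Prop} (h : Equivalence r) (j : ℕ) :
    Equivalence (OpenRel j r) where
  refl p := by
    unfold OpenRel
    have := h.refl (below j p)
    tauto
  symm {p q} hpq := by
    unfold OpenRel at *
    have := @h.symm (below j p) (below j q)
    tauto
  trans {p q s} h₁ h₂ := by
    unfold OpenRel at *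
    have := @h.trans (below j p) (below j q) (below j s)
    tauto

theorem cupRel_equivalence (c : List ℕ) : Equivalence (cupRel c) := by
  induction c with
  | nil => exact eq_equivalence
  | cons j c ih => exact openRel_equivalence ih j

theorem openRel_congr {r r' : ℕ → ℕ → Prop} {j n : ℕ} (hj : j ≤ n)
    (h : ∀ p q, p < n → q < n → (r p q ↔ r' p q)) {p q : ℕ} (hp : p < n + 2) (hq : q < n + 2) :
    OpenRel j r p q ↔ OpenRel j r' p q := by
  unfold OpenRel
  by_cases h₁ : p = j ∨ p = j + 1
  · simp [h₁]
  · by_cases h₂ : q = j ∨ q = j + 1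
    · simp [h₂]
    · rw [h (below j p) (below j q) (by unfold below; split_ifs <;> omega)
        (by unfold below; split_ifs <;> omega)]

/-- Connections obey the same rules as words of cups: this lemma and the next four mirror `cup_cap`,
`cap_cup`, `loop`, `zigzag_left` and `zigzag_right`. -/
theorem joinRel_openRel_right {i j : ℕ} (r : ℕ → ℕ → Prop) (h : j ≤ i) (p q : ℕ) :
    JoinRel (i + 2) (OpenRel j r) p q ↔ OpenRel j (JoinRel i r) p q := by
  have hi : ¬ (i + 2 = j ∨ i + 2 = j + 1) := by omega
  have hi' : ¬ (i + 2 + 1 = j ∨ i + 2 + 1 = j + 1) := by omega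
  have b : below j (i + 2) = i := by unfold below; split_ifs <;> omega
  have b' : below j (i + 2 + 1) = i + 1 := by unfold below; split_ifs <;> omega
  have e (p : ℕ) : (above (i + 2) p = j ∨ above (i + 2) p = j + 1) ↔ (p = j ∨ p = j + 1) := by
    unfold above; split_ifs <;> omega
  have e' (p : ℕ) (hp : ¬ (p = j ∨ p = j + 1)) :
      below j (above (i + 2) p) = above i (below j p) := by
    unfold above below; split_ifs <;> omega
  unfold JoinRel OpenRel
  simp only [hi, hi', b, b', e, and_false, false_or, not_false_eq_true, true_and]
  by_cases hp : p = j ∨ p = j + 1 <;> by_cases hq : q = j ∨ q = j + 1 <;>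
    simp only [hp, hq, e', not_false_eq_true, not_true_eq_false, true_and, false_and, and_false,
      and_self, or_false, false_or, or_self]

theorem joinRel_openRel_left {i j : ℕ} (r : ℕ → ℕ → Prop) (h : i ≤ j) (p q : ℕ) :
    JoinRel i (OpenRel (j + 2) r) p q ↔ OpenRel j (JoinRel i r) p q := by
  have hi : ¬ (i = j + 2 ∨ i = j + 2 + 1) := by omega
  have hi' : ¬ (i + 1 = j + 2 ∨ i + 1 = j + 2 + 1) := by omega
  have b : below (j + 2) i = i := by unfold below; split_ifs <;> omega
  have b' : below (j + 2) (i + 1) = i + 1 := by unfold below; split_ifs <;> omega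
  have e (p : ℕ) : (above i p = j + 2 ∨ above i p = j + 2 + 1) ↔ (p = j ∨ p = j + 1) := by
    unfold above; split_ifs <;> omega
  have e' (p : ℕ) (hp : ¬ (p = j ∨ p = j + 1)) :
      below (j + 2) (above i p) = above i (below j p) := by
    unfold above below; split_ifs <;> omega
  unfold JoinRel OpenRel
  simp only [hi, hi', b, b', e, and_false, false_or, not_false_eq_true, true_and]
  by_cases hp : p = j ∨ p = j + 1 <;> by_cases hq : q = j ∨ q = j + 1 <;>
    simp only [hp, hq, e', not_false_eq_true, not_true_eq_false, true_and, false_and, and_false,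
      and_self, or_false, false_or, or_self]

theorem joinRel_openRel_self {i : ℕ} (r : ℕ → ℕ → Prop) (p q : ℕ) :
    JoinRel i (OpenRel i r) p q ↔ r p q := by
  have e (p : ℕ) : ¬ (above i p = i ∨ above i p = i + 1) := by
    unfold above; split_ifs <;> omega
  have e' (p : ℕ) : below i (above i p) = p := by
    unfold above below; split_ifs <;> omega
  unfold JoinRel OpenRel
  simp [e, e']

theorem joinRel_succ_openRel {i : ℕ} {r : ℕ → ℕ → Prop} (hr : Equivalence r) (p q : ℕ) :
    JoinRel (i + 1) (OpenRel i r) p q ↔ r p q := by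
  have e (p : ℕ) : (above (i + 1) p = i ∨ above (i + 1) p = i + 1) ↔ p = i := by
    unfold above; split_ifs <;> omega
  have e' (p : ℕ) (hp : p ≠ i) : below i (above (i + 1) p) = p := by
    unfold above below; split_ifs <;> omega
  have ne₁ : ¬ i + 1 + 1 = i := by omega
  have b : below i (i + 2) = i := by unfold below; split_ifs <;> omega
  unfold JoinRel OpenRel
  have h₁ := @hr.symm p i
  have h₂ := @hr.symm i q
  have h₃ := @hr.symm q i
  have h₄ := @hr.trans p i q
  have h₅ := hr.refl i
  by_cases hp : p = i <;> by_cases hq : q = i <;> simp [e, hp, hq, e', b, h₅, hr.refl, ne₁] <;>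
    tauto

theorem joinRel_openRel_succ {i : ℕ} {r : ℕ → ℕ → Prop} (hr : Equivalence r) (p q : ℕ) :
    JoinRel i (OpenRel (i + 1) r) p q ↔ r p q := by
  have e (p : ℕ) : (above i p = i + 1 ∨ above i p = i + 1 + 1) ↔ p = i := by
    unfold above; split_ifs <;> omega
  have e' (p : ℕ) (hp : p ≠ i) : below (i + 1) (above i p) = p := by
    unfold above below; split_ifs <;> omega
  have ne₁ : ¬ i = i + 1 + 1 := by omega
  have b : below (i + 1) i = i := by unfold below; split_ifs <;> omega
  unfold JoinRel OpenRel
  have h₁ := @hr.symm p i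
  have h₂ := @hr.symm i q
  have h₃ := @hr.symm q i
  have h₄ := @hr.trans p i q
  have h₅ := hr.refl i
  by_cases hp : p = i <;> by_cases hq : q = i <;> simp [e, hp, hq, e', b, h₅, hr.refl, ne₁] <;>
    tauto

namespace TemperleyLieb

variable {K : Type} [Field K] {A : K} {R : Type} [Ring R] [Algebra K R] (T : TemperleyLieb A R)

/-- The product of a word of cups, the last of which is the head of the list. -/
def cups : List ℕ → R
  | [] => 1
  | j :: c => cups c * T.cup j

-- The cap is compared with the topmost cup. If they have no strand in common, the cap moves below
-- it and induction applies; if they share one strand, a zigzag is straightened; if they share both,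
-- a loop is removed. Thus a factor `δ` appears exactly when the capped points were already
-- connected.
open Classical in
theorem cups_mul_cap (c : List ℕ) (hc : CupsFit c) (i : ℕ) (hi : i + 2 ≤ 2 * c.length) :
    ∃ c' : List ℕ, CupsFit c' ∧ c'.length + 1 = c.length ∧
      (∀ p q, p < 2 * c'.length → q < 2 * c'.length →
        (cupRel c' p q ↔ JoinRel i (cupRel c) p q)) ∧
      T.cups c * T.cap i =
        (if cupRel c i (i + 1) then loopValue A else 1) • T.cups c' := by
  induction c generalizing i with
  | nil => simp at hi
  | cons j c ih =>
    obtain ⟨hj, hc⟩ := hc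
    simp only [List.length_cons] at hi
    have far (h : ¬ (i = j ∨ i = j + 1)) (h' : ¬ (i + 1 = j ∨ i + 1 = j + 1)) :
        cupRel (j :: c) i (i + 1) ↔ cupRel c (below j i) (below j (i + 1)) := by
      simp only [cupRel, OpenRel, h, h', false_and, not_false_eq_true, true_and, false_or]
    rcases lt_trichotomy i j with h | rfl | h
    · rcases Nat.lt_or_ge (i + 1) j with h' | h'
      · obtain ⟨k, rfl⟩ : ∃ k, j = k + 2 := ⟨j - 2, by omega⟩
        obtain ⟨c', h₁, h₂, h₃, h₄⟩ := ih hc i (by omega)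
        refine ⟨k :: c', ⟨by omega, h₁⟩, by simpa using h₂, fun p q hp hq => ?_, ?_⟩
        · simp only [List.length_cons] at hp hq
          rw [cupRel, cupRel, joinRel_openRel_left _ (by omega)]
          exact openRel_congr (n := 2 * c'.length) (by omega) h₃ (by omega) (by omega)
        · have e : below (k + 2) i = i := by unfold below; split_ifs <;> omega
          have e' : below (k + 2) (i + 1) = i + 1 := by unfold below; split_ifs <;> omega
          simp only [cups, far (by omega) (by omega), e, e']
          rw [mul_assoc, ← T.cap_cup (show i ≤ k by omega), ← mul_assoc, h₄, smul_mul_assoc]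
      · obtain rfl : j = i + 1 := by omega
        refine ⟨c, hc, rfl, fun p q _ _ => (joinRel_openRel_succ (cupRel_equivalence c) p q).symm,
          ?_⟩
        have : ¬ cupRel ((i + 1) :: c) i (i + 1) := by
          rintro (⟨a, b⟩ | ⟨a, b, -⟩) <;> omega
        rw [if_neg this, cups, mul_assoc, T.zigzag_right, mul_one, one_smul]
    · refine ⟨c, hc, rfl, fun p q _ _ => (joinRel_openRel_self _ p q).symm, ?_⟩
      have : cupRel (i :: c) i (i + 1) := by simp [cupRel, OpenRel]
      rw [if_pos this, cups, mul_assoc, T.loop, mul_smul_comm, mul_one]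
    · rcases Nat.lt_or_ge (j + 1) i with h' | h'
      · obtain ⟨k, rfl⟩ : ∃ k, i = k + 2 := ⟨i - 2, by omega⟩
        obtain ⟨c', h₁, h₂, h₃, h₄⟩ := ih hc k (by omega)
        refine ⟨j :: c', ⟨by omega, h₁⟩, by simpa using h₂, fun p q hp hq => ?_, ?_⟩
        · simp only [List.length_cons] at hp hq
          rw [cupRel, cupRel, joinRel_openRel_right _ (by omega)]
          exact openRel_congr (n := 2 * c'.length) (by omega) h₃ (by omega) (by omega)
        · have e : below j (k + 2) = k := by unfold below; split_ifs <;> omega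
          have e' : below j (k + 2 + 1) = k + 1 := by unfold below; split_ifs <;> omega
          simp only [cups, far (by omega) (by omega), e, e']
          rw [mul_assoc, T.cup_cap (show j ≤ k by omega), ← mul_assoc, h₄, smul_mul_assoc]
      · obtain rfl : i = j + 1 := by omega
        refine ⟨c, hc, rfl, fun p q _ _ => (joinRel_succ_openRel (cupRel_equivalence c) p q).symm,
          ?_⟩
        have : ¬ cupRel (j :: c) (j + 1) (j + 1 + 1) := by
          rintro (⟨a, b⟩ | ⟨a, b, -⟩) <;> omega
        rw [if_neg this, cups, mul_assoc, T.zigzag_left, mul_one, one_smul]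

end TemperleyLieb

/-! ### States -/

theorem le_foldr_max {s : List ℕ} {x : ℕ} (h : x ∈ s) : x ≤ s.foldr max 0 := by
  induction s with
  | nil => simp at h
  | cons y s ih =>
    rw [List.foldr_cons]
    rcases List.mem_cons.1 h with rfl | h
    · exact le_max_left _ _
    · exact (ih h).trans (le_max_right _ _)

/-- The state `s` records the connections of a word of cups. -/
structure Records (s c : List ℕ) : Prop where
  fit : CupsFit c
  length : s.length = 2 * c.length
  rel : ∀ p q, p < s.length → q < s.length → (s[p]? = s[q]? ↔ cupRel c p q)

theorem openArc_length {i : ℕ} {s : List ℕ} (hi : i ≤ s.length) :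
    (openArc i s).length = s.length + 2 := by
  simp [openArc]
  omega

theorem openArc_getElem? {i : ℕ} {s : List ℕ} (hi : i ≤ s.length) (p : ℕ) :
    (openArc i s)[p]? =
      if p = i ∨ p = i + 1 then some (s.foldr max 0 + 1) else s[below i p]? := by
  unfold openArc below
  rw [List.append_assoc]
  rcases lt_or_ge p i with h | h
  · rw [List.getElem?_append_left (by simp; omega), List.getElem?_take_of_lt h,
      if_neg (by omega), if_pos h]
  · rw [List.getElem?_append_right (by simp; omega), List.length_take, min_eq_left hi]
    obtain ⟨k, rfl⟩ : ∃ k, p = i + k := ⟨p - i, by omega⟩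
    rw [if_neg (by omega : ¬ i + k < i)]
    match k with
    | 0 => simp
    | 1 => simp
    | k + 2 =>
      rw [if_neg (by omega), show i + (k + 2) - i = k + 2 by omega,
        show i + (k + 2) - 2 = i + k by omega]
      simp

theorem joinArcs_length {i : ℕ} {s : List ℕ} (hi : i + 2 ≤ s.length) :
    (joinArcs i s).length + 2 = s.length := by
  simp [joinArcs]
  omega

theorem joinArcs_getElem? {i : ℕ} {s : List ℕ} (hi : i + 2 ≤ s.length) (p : ℕ) :
    (joinArcs i s)[p]? = (s[above i p]?).map
      fun x => if s[i + 1]? = some x then s.getD i 0 else x := by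
  unfold joinArcs above
  rw [List.getElem?_map]
  congr 1
  rcases lt_or_ge p i with h | h
  · rw [List.getElem?_append_left (by simp; omega), List.getElem?_take_of_lt h, if_pos h]
  · rw [List.getElem?_append_right (by simp; omega), List.length_take,
      min_eq_left (by omega), if_neg (by omega), List.getElem?_drop]
    congr 1
    omega

theorem Records.openArc {s c : List ℕ} (h : Records s c) {i : ℕ} (hi : i ≤ s.length) :
    Records (openArc i s) (i :: c) where
  fit := ⟨h.length ▸ hi, h.fit⟩
  length := by rw [openArc_length hi, h.length, List.length_cons]; ring
  rel p q hp hq := by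
    rw [openArc_length hi] at hp hq
    rw [openArc_getElem? hi, openArc_getElem? hi, cupRel, OpenRel]
    -- The label of a new arc exceeds all labels in use, so no old point is identified with the new
    -- ones.
    have ne (k : ℕ) : s[k]? ≠ some (s.foldr max 0 + 1) := fun e => by
      have := le_foldr_max (List.mem_of_getElem? e)
      omega
    by_cases h₁ : p = i ∨ p = i + 1
    · by_cases h₂ : q = i ∨ q = i + 1
      · simp [h₁, h₂]
      · simp only [h₁, h₂, if_true, if_false, and_false, not_true_eq_false, false_and, or_self,
          iff_false]
        exact (ne _).symm
    · by_cases h₂ : q = i ∨ q = i + 1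
      · simp only [h₁, h₂, if_true, if_false, and_false, not_true_eq_false, false_and, or_self,
          iff_false]
        exact ne _
      · simp only [h₁, h₂, if_false, false_and, not_false_eq_true, true_and, false_or]
        exact h.rel _ _ (by unfold below; split_ifs <;> omega)
          (by unfold below; split_ifs <;> omega)

theorem Records.joinArcs {s c c' : List ℕ} (h : Records s c) {i : ℕ} (hi : i + 2 ≤ s.length)
    (hc' : CupsFit c') (hl : c'.length + 1 = c.length)
    (hr : ∀ p q, p < 2 * c'.length → q < 2 * c'.length →
      (cupRel c' p q ↔ JoinRel i (cupRel c) p q)) :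
    Records (joinArcs i s) c' where
  fit := hc'
  length := by
    have := joinArcs_length hi
    have := h.length
    omega
  rel p q hp hq := by
    have hl' := joinArcs_length hi
    have hl'' := h.length
    rw [hr p q (by omega) (by omega), joinArcs_getElem? hi, joinArcs_getElem? hi, JoinRel]
    have hp' : above i p < s.length := by unfold above; split_ifs <;> omega
    have hq' : above i q < s.length := by unfold above; split_ifs <;> omega
    have hi' : i < s.length := by omega
    have hi'' : i + 1 < s.length := by omega
    rw [← h.rel _ _ hp' hq', ← h.rel _ _ hp' hi', ← h.rel _ _ hp' hi'', ← h.rel _ _ hq' hi',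
      ← h.rel _ _ hq' hi'']
    simp only [List.getElem?_eq_getElem, hp', hq', hi', hi'', Option.map_some,
      List.getD_eq_getElem?_getD, Option.getD_some, Option.some.injEq]
    grind

namespace TemperleyLieb

variable {K : Type} [Field K] {A : K} {R : Type} [Ring R] [Algebra K R] (T : TemperleyLieb A R)

/-- The element of a slice of a link diagram. -/
def slice : Slice α → R
  | .cup i _ _ => T.cup i
  | .cap i => T.cap i
  | .cross i ov => T.cross ov i

/-- The element of a slice of a bar diagram. -/
def barSlice : BarSlice α → R
  | .strand s => T.slice s
  | .bar i => T.proj true (2 * i)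

/-- The element of a link diagram. -/
def word (w : List (Slice α)) : R := (w.map T.slice).prod

/-- The element of a bar diagram. -/
def barWord (w : List (BarSlice α)) : R := (w.map T.barSlice).prod

theorem barWord_cons (s : BarSlice α) (w : List (BarSlice α)) :
    T.barWord (s :: w) = T.barSlice s * T.barWord w := by simp [barWord]

theorem barWord_append (w w' : List (BarSlice α)) :
    T.barWord (w ++ w') = T.barWord w * T.barWord w' := by simp [barWord]

theorem barWord_map_strand (w : List (Slice α)) : T.barWord (w.map .strand) = T.word w := by
  simp only [barWord, word, List.map_map]
  rfl

theorem word_append (w w' : List (Slice α)) : T.word (w ++ w') = T.word w * T.word w' := by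
  simp [word]

theorem exists_records_joinArcs {s c : List ℕ} (h : Records s c) {i : ℕ}
    (hi : i + 2 ≤ s.length) :
    ∃ c', Records (joinArcs i s) c' ∧ T.cups c * T.cap i = capFactor A i s • T.cups c' := by
  classical
  obtain ⟨c', h₁, h₂, h₃, h₄⟩ := T.cups_mul_cap c h.fit i (h.length ▸ hi)
  refine ⟨c', h.joinArcs hi h₁ h₂ h₃, ?_⟩
  rw [h₄, capFactor]
  have : SameArc i s ↔ cupRel c i (i + 1) := h.rel _ _ (by omega) (by omega)
  simp only [this]

/-- In the bar relation the half-twist and the term without bar contribute `A + A⁻¹` to the vertical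
smoothing, which the prefactor normalizes to `1`. The present expression is the total coefficient of
the horizontal smoothing; with `1 - a t = 1 + A⁴` it makes a bar equal to `proj true`. -/
theorem bar_coefficient (T : TemperleyLieb A R) :
    (A + A⁻¹)⁻¹ * (A⁻¹ + (A - A⁻¹) / (1 - (-A ^ 3) * A)) = -(loopValue A)⁻¹ := by
  have h₀ := T.ne_zero
  have h₁ := T.loop_ne_zero
  have h₂ := T.add_inv_ne_zero
  have h₃ : A ^ 4 + 1 ≠ 0 := by
    intro h
    apply h₁
    rw [zpow_neg, zpow_ofNat]
    field_simp
    simpa using h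
  have h₄ : A ^ 2 + 1 ≠ 0 := by
    intro h
    apply h₂
    field_simp
    simpa using h
  have h₅ : 1 - (-A ^ 3) * A ≠ 0 := by
    intro h
    apply h₃
    linear_combination h
  have h₆ : A + A⁻¹ = (A ^ 2 + 1) / A := by field_simp
  have h₇ : loopValue A = -(A ^ 4 + 1) / A ^ 2 := by
    rw [loopValue, zpow_neg, zpow_ofNat]
    field_simp
    ring
  rw [h₆, h₇, show 1 - (-A ^ 3) * A = A ^ 4 + 1 by ring]
  field_simp
  ring

/-- The part of the diagram already read is a crossingless matching, represented by a word of cups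
`c` of which `s` remembers only the connections. Every clause of `expand` is then one relation
applied at the top of that word. -/
theorem expand_smul_one (w : List (BarSlice α)) (s c : List ℕ) (h : Records s c)
    (hw : BarFits w s.length) : expand A w s • (1 : R) = T.cups c * T.barWord w := by
  induction w generalizing s c with
  | nil =>
    have : s.length = 0 := hw
    have hl := h.length
    obtain rfl : c = [] := List.eq_nil_of_length_eq_zero (by omega)
    simp [expand, cups, barWord]
  | cons x w ih =>
    rw [barWord_cons]
    -- The horizontal smoothing, a cap followed by a cup, is shared by crossings and bars.
    have key (i : ℕ) (hi : i + 2 ≤ s.length) (hw : BarFits w s.length) :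
        (capFactor A i s * expand A w (openArc i (joinArcs i s))) • (1 : R) =
          T.cups c * (T.hook i * T.barWord w) := by
      obtain ⟨c', h₁, h₂⟩ := T.exists_records_joinArcs h hi
      have hl := joinArcs_length hi
      rw [mul_smul, ih _ _ (h₁.openArc (show i ≤ (joinArcs i s).length by omega))
        (by rw [openArc_length (by omega)]; convert hw using 1)]
      simp only [hook, cups, ← mul_assoc, h₂, smul_mul_assoc]
    match x, hw with
    | .strand (.cup i a up), hw =>
      have hi : i ≤ s.length := hw.1
      rw [expand, ih _ _ (h.openArc hi) (by rw [openArc_length hi]; exact hw.2)]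
      simp [cups, barSlice, slice, mul_assoc]
    | .strand (.cap i), hw =>
      have hi : i + 2 ≤ s.length := hw.1
      obtain ⟨c', h₁, h₂⟩ := T.exists_records_joinArcs h hi
      have hl := joinArcs_length hi
      rw [expand, mul_smul, ih _ _ h₁ (by
        have := hw.2
        simp only [Slice.ins, Slice.outs] at this
        convert this using 1; omega)]
      rw [barSlice, slice, ← mul_assoc, h₂, smul_mul_assoc]
    | .strand (.cross i ov), hw =>
      have hi : i + 2 ≤ s.length := hw.1
      have hw' : BarFits w s.length := by
        have := hw.2
        simp only [Slice.ins, Slice.outs] at this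
        convert this using 1; omega
      rw [expand, barSlice, slice, cross]
      cases ov
      · simp only [Bool.false_eq_true, if_false, weight, Bool.not_false, if_true, add_smul,
          mul_smul A⁻¹, mul_smul A, add_mul, mul_add, smul_mul_assoc, mul_smul_comm, one_mul]
        rw [key i hi hw', ih s c h hw']
      · simp only [Bool.false_eq_true, if_false, weight, Bool.not_true, if_true, add_smul,
          mul_smul A⁻¹, mul_smul A, add_mul, mul_add, smul_mul_assoc, mul_smul_comm, one_mul]
        rw [key i hi hw', ih s c h hw']
    | .bar i, hw =>
      have e : expand A (.bar i :: w) s = expand A w s + -(loopValue A)⁻¹ *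
          (capFactor A (2 * i) s * expand A w (openArc (2 * i) (joinArcs (2 * i) s))) := by
        rw [← T.bar_coefficient, expand]
        have h₂ := T.add_inv_ne_zero
        generalize (A - A⁻¹) / (1 - (-A ^ 3) * A) = z
        have h₃ := inv_mul_cancel₀ h₂
        linear_combination (expand A w s) * h₃
      rw [e, add_smul, mul_smul (-(loopValue A)⁻¹), key (2 * i) hw.1 hw.2, ih s c h hw.2]
      simp [barSlice, proj, add_mul, mul_add, sub_eq_add_neg]

theorem barPolynomial_smul_one (w : List (BarSlice α)) (hw : BarFits w 0) :
    (loopValue A * barPolynomial A w) • (1 : R) = T.barWord w := by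
  rw [barPolynomial, mul_div_cancel₀ _ T.loopValue_ne_zero,
    T.expand_smul_one w [] [] ⟨trivial, rfl, fun p q hp => by simp at hp⟩ hw]
  simp [cups]

end TemperleyLieb
end ThetaCurve

/-! ### Levels and crossing signs under local moves; invariance of the Jones polynomial. -/

namespace ThetaCurve

variable {α : Type}

/-! ### Levels of words -/

namespace Slice

/-- The strands leaving a slice, given the strands entering it. -/
def top : Slice α → Level α → Level α
  | cup _ a up, _ => [(a, up), (a, !up)]
  | cap _, _ => []
  | cross _ _, m => m.reverse

/-- Locality: cutting a level into the strands to the left of a slice, those entering it, and those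
to the right reduces all bookkeeping to the middle part. -/
theorem step_append (s : Slice α) {l₁ m : Level α} (l₂ : Level α) (h₁ : l₁.length = s.pos)
    (hm : m.length = s.ins) : s.step (l₁ ++ m ++ l₂) = l₁ ++ s.top m ++ l₂ := by
  cases s with
  | cup i a up =>
    obtain rfl : m = [] := List.eq_nil_of_length_eq_zero hm
    simp only [pos] at h₁
    simp [step, top, ← h₁]
  | cap i =>
    simp only [pos, ins] at h₁ hm
    simp [step, top, ← h₁, ← hm, List.drop_append]
  | cross i ov =>
    simp only [pos, ins] at h₁ hm
    simp [step, top, swapAt, ← h₁, ← hm, List.drop_append]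

theorem sign_append (f : α → α → Bool) (s : Slice α) {l₁ m : Level α} (l₂ : Level α)
    (h₁ : l₁.length = s.pos) (hm : m.length = s.ins) :
    s.sign f (l₁ ++ m ++ l₂) = (s.setPos 0).sign f m := by
  cases s with
  | cup i a up => rfl
  | cap i => rfl
  | cross i ov =>
    simp only [pos, ins] at h₁ hm
    have e : (List.drop i (l₁ ++ m ++ l₂)).take 2 = m := by
      rw [← h₁, ← hm, List.append_assoc, List.drop_left, List.take_left]
    have e' : (List.drop 0 m).take 2 = m := by rw [← hm]; simp
    simp only [sign, setPos, e, e']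

theorem Valid.le {s : Slice α} {l : Level α} (h : s.Valid l) : s.pos + s.ins ≤ l.length := by
  cases s with
  | cup i a up => exact h
  | cap i =>
    obtain ⟨a, up, h⟩ := h
    have := congrArg List.length h
    simp at this
    simp only [pos, ins]
    omega
  | cross i ov => exact h

theorem exists_append {l : Level α} {i k : ℕ} (h : i + k ≤ l.length) :
    ∃ l₁ m l₂ : Level α, l = l₁ ++ m ++ l₂ ∧ l₁.length = i ∧ m.length = k :=
  ⟨l.take i, (l.drop i).take k, (l.drop i).drop k, by simp, by simp; omega, by simp; omega⟩

theorem top_length (s : Slice α) {m : Level α} (hm : m.length = s.ins) :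
    (s.top m).length = s.outs := by
  cases s <;> simp_all [top, ins, outs]

theorem step_length (s : Slice α) {l : Level α} (h : s.pos + s.ins ≤ l.length) :
    (s.step l).length = l.length - s.ins + s.outs := by
  obtain ⟨l₁, m, l₂, rfl, h₁, hm⟩ := exists_append h
  rw [s.step_append l₂ h₁ hm]
  simp only [List.length_append, s.top_length hm] at h ⊢
  omega

theorem setPos_pos (s : Slice α) : s.setPos s.pos = s := by cases s <;> rfl

theorem pos_setPos (s : Slice α) (j : ℕ) : (s.setPos j).pos = j := by cases s <;> rfl

theorem ins_setPos (s : Slice α) (j : ℕ) : (s.setPos j).ins = s.ins := by cases s <;> rfl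

theorem outs_setPos (s : Slice α) (j : ℕ) : (s.setPos j).outs = s.outs := by cases s <;> rfl

theorem top_setPos (s : Slice α) (j : ℕ) : (s.setPos j).top = s.top := by cases s <;> rfl

theorem setPos_setPos (s : Slice α) (j k : ℕ) : (s.setPos j).setPos k = s.setPos k := by
  cases s <;> rfl

/-- Translation of a slice to the right. -/
def shift (n : ℕ) (s : Slice α) : Slice α := s.setPos (n + s.pos)

theorem step_shift (s : Slice α) (l₁ l : Level α) (h : s.pos + s.ins ≤ l.length) :
    (s.shift l₁.length).step (l₁ ++ l) = l₁ ++ s.step l := by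
  obtain ⟨k, m, r, rfl, hk, hm⟩ := exists_append h
  have := (s.shift l₁.length).step_append (l₁ := l₁ ++ k) (m := m) r
    (by simp [shift, pos_setPos, hk]) (by simp [shift, ins_setPos, hm])
  rw [s.step_append r hk hm]
  simpa [shift, top_setPos] using this

theorem sign_shift (f : α → α → Bool) (s : Slice α) (l₁ l : Level α)
    (h : s.pos + s.ins ≤ l.length) : (s.shift l₁.length).sign f (l₁ ++ l) = s.sign f l := by
  obtain ⟨k, m, r, rfl, hk, hm⟩ := exists_append h
  have := (s.shift l₁.length).sign_append f (l₁ := l₁ ++ k) (m := m) r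
    (by simp [shift, pos_setPos, hk]) (by simp [shift, ins_setPos, hm])
  rw [s.sign_append f r hk hm]
  simpa [shift, setPos_setPos] using this

theorem valid_shift (s : Slice α) (l₁ l : Level α) :
    (s.shift l₁.length).Valid (l₁ ++ l) ↔ s.Valid l := by
  cases s with
  | cup i a up => simp [shift, setPos, pos, Valid]
  | cap i =>
    have : List.drop (l₁.length + i) (l₁ ++ l) = List.drop i l := by
      rw [← List.drop_drop, List.drop_left]
    simp only [shift, setPos, pos, Valid, this]
  | cross i ov =>
    simp only [shift, setPos, pos, Valid, List.length_append]
    omega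

end Slice

/-- The slices of a word fit together if one starts with the level `l`. -/
def Runs : List (Slice α) → Level α → Prop
  | [], _ => True
  | s :: w, l => s.Valid l ∧ Runs w (s.step l)

/-- The level above a word. -/
def levelAfter (w : List (Slice α)) (l : Level α) : Level α := w.foldl (fun l s => s.step l) l

theorem closesFrom_append (u w : List (Slice α)) (l : Level α) :
    ClosesFrom (u ++ w) l ↔ Runs u l ∧ ClosesFrom w (levelAfter u l) := by
  induction u generalizing l with
  | nil => simp [Runs, levelAfter]
  | cons s u ih => simp [ClosesFrom, Runs, levelAfter, ih, and_assoc]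

theorem signSumFrom_append (f : α → α → Bool) (u w : List (Slice α)) (l : Level α) :
    signSumFrom f (u ++ w) l = signSumFrom f u l + signSumFrom f w (levelAfter u l) := by
  induction u generalizing l with
  | nil => simp [signSumFrom, levelAfter]
  | cons s u ih => simp [signSumFrom, levelAfter, ih, add_assoc]

theorem runs_shift (w : List (Slice α)) (l₁ l : Level α) :
    Runs (w.map (Slice.shift l₁.length)) (l₁ ++ l) ↔ Runs w l := by
  induction w generalizing l with
  | nil => simp [Runs]
  | cons s w ih =>
    simp only [List.map_cons, Runs, Slice.valid_shift]
    constructor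
    · rintro ⟨h, h'⟩
      rw [s.step_shift l₁ l h.le, ih] at h'
      exact ⟨h, h'⟩
    · rintro ⟨h, h'⟩
      rw [s.step_shift l₁ l h.le, ih]
      exact ⟨h, h'⟩

theorem levelAfter_shift (w : List (Slice α)) (l₁ l : Level α) (h : Runs w l) :
    levelAfter (w.map (Slice.shift l₁.length)) (l₁ ++ l) = l₁ ++ levelAfter w l := by
  induction w generalizing l with
  | nil => rfl
  | cons s w ih =>
    rw [List.map_cons, levelAfter, List.foldl_cons, s.step_shift l₁ l h.1.le]
    exact ih _ h.2

theorem signSumFrom_shift (f : α → α → Bool) (w : List (Slice α)) (l₁ l : Level α)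
    (h : Runs w l) :
    signSumFrom f (w.map (Slice.shift l₁.length)) (l₁ ++ l) = signSumFrom f w l := by
  induction w generalizing l with
  | nil => rfl
  | cons s w ih =>
    rw [List.map_cons, signSumFrom, s.step_shift l₁ l h.1.le, ih _ h.2, s.sign_shift f l₁ l h.1.le,
      signSumFrom]

/-- The sign of the crossing of a curl. -/
def curlSign : List (Slice α) → ℤ
  | [.cup _ _ _, .cross _ ov, .cap _] => if ov then 1 else -1
  | _ => 0

/-- The words end at the same level, and the sum of the crossing signs differs by `k`. -/
def SignsDiffer (k : ℤ) (x y : List (Slice α)) : Prop :=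
  ∀ l, Runs x l → Runs y l → levelAfter x l = levelAfter y l ∧
    signSumFrom (fun _ _ => true) x l = signSumFrom (fun _ _ => true) y l + k

/-- Strands to the left of a move play no role, so each move need only be checked at position `0`.
The validity of the first slice provides these `n` strands. -/
theorem SignsDiffer.shift {k : ℤ} {s : Slice α} {x y : List (Slice α)}
    (h : SignsDiffer k (s :: x) y) (n : ℕ) :
    SignsDiffer k ((s :: x).map (Slice.shift n)) (y.map (Slice.shift n)) := by
  intro l hx hy
  have hn : n ≤ l.length := by
    have := hx.1.le
    simp only [Slice.shift, Slice.pos_setPos] at this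
    omega
  obtain ⟨l₁, l₂, rfl, rfl⟩ : ∃ l₁ l₂ : Level α, l = l₁ ++ l₂ ∧ l₁.length = n :=
    ⟨l.take n, l.drop n, by simp, by simp [hn]⟩
  rw [runs_shift] at hx hy
  rw [levelAfter_shift _ _ _ hx, levelAfter_shift _ _ _ hy, signSumFrom_shift _ _ _ _ hx,
    signSumFrom_shift _ _ _ _ hy, (h _ hx hy).1]
  exact ⟨rfl, (h _ hx hy).2⟩

theorem signsDiffer_exchange (s t : Slice α) (h : s.pos + s.outs ≤ t.pos) :
    SignsDiffer 0 [s, t] [t.setPos (t.pos - s.outs + s.ins), s] := by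
  intro l hx _
  obtain ⟨hs, ht, -⟩ := hx
  obtain ⟨l₁, m, r, rfl, h₁, hm⟩ := Slice.exists_append hs.le
  have ht' := ht.le
  rw [s.step_append r h₁ hm] at ht'
  have hm' := s.top_length hm
  simp only [List.length_append, h₁, hm'] at ht'
  obtain ⟨r₁, m₂, r₂, rfl, hr₁, hm₂⟩ :=
    Slice.exists_append (l := r) (i := t.pos - s.pos - s.outs) (k := t.ins) (by omega)
  have e₁ := s.step_append (r₁ ++ m₂ ++ r₂) h₁ hm
  have e₂ := t.step_append (l₁ := l₁ ++ s.top m ++ r₁) (m := m₂) r₂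
    (by simp [h₁, hm', hr₁]; omega) hm₂
  set t' := t.setPos (t.pos - s.outs + s.ins) with ht''
  have hp : (l₁ ++ m ++ r₁).length = t'.pos := by
    simp [ht'', Slice.pos_setPos, h₁, hm, hr₁]; omega
  have hi : m₂.length = t'.ins := by simp [ht'', Slice.ins_setPos, hm₂]
  have e₃ := t'.step_append (l₁ := l₁ ++ m ++ r₁) (m := m₂) r₂ hp hi
  have e₄ := s.step_append (l₁ := l₁) (m := m) (r₁ ++ t.top m₂ ++ r₂) h₁ hm
  have g₁ := s.sign_append (fun _ _ => true) (r₁ ++ m₂ ++ r₂) h₁ hm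
  have g₂ := t.sign_append (fun _ _ => true) (l₁ := l₁ ++ s.top m ++ r₁) (m := m₂) r₂
    (by simp [h₁, hm', hr₁]; omega) hm₂
  have g₃ := t'.sign_append (fun _ _ => true) (l₁ := l₁ ++ m ++ r₁) (m := m₂) r₂ hp hi
  have g₄ := s.sign_append (fun _ _ => true) (l₁ := l₁) (m := m) (r₁ ++ t.top m₂ ++ r₂) h₁ hm
  simp only [ht'', Slice.top_setPos, Slice.setPos_setPos, List.append_assoc] at *
  simp only [levelAfter, List.foldl_cons, List.foldl_nil, signSumFrom, e₁, e₂, e₃, e₄, g₁, g₂,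
    g₃, g₄]
  exact ⟨trivial, by ring⟩

/-- Only a curl changes the writhe. Its crossing is passed twice by one arc, and the final cap
forces equal vertical directions of the two strands there; so the sign depends on `ov` alone. -/
theorem signsDiffer_of_localMove {x y : List (Slice α)} (h : LocalMove x y) :
    SignsDiffer (curlSign x) x y := by
  cases h with
  | exchange s t h =>
    have := signsDiffer_exchange s t h
    simpa [curlSign] using this
  | zigzag_left i a up =>
    refine SignsDiffer.shift (s := .cup 0 a up) (x := [.cap 1]) (y := []) (k := 0) ?_ i
    intro l hx hy
    rcases l with _ | ⟨⟨a, u⟩, l⟩ <;>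
      simp [Runs, Slice.Valid, Slice.step, levelAfter, signSumFrom, Slice.sign] at hx ⊢
    grind
  | zigzag_right i a up =>
    refine SignsDiffer.shift (s := .cup 1 a up) (x := [.cap 0]) (y := []) (k := 0) ?_ i
    intro l hx hy
    rcases l with _ | ⟨⟨a, u⟩, l⟩ <;>
      simp [Runs, Slice.Valid, Slice.step, levelAfter, signSumFrom, Slice.sign] at hx ⊢
    grind
  | cup_slide i a up ov =>
    refine SignsDiffer.shift (s := .cup 0 a up) (x := [.cross 1 ov])
      (y := [.cup 1 a up, .cross 0 (!ov)]) (k := 0) ?_ i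
    intro l hx hy
    rcases l with _ | ⟨⟨a, u⟩, l⟩ <;>
      simp [Runs, Slice.Valid, Slice.step, levelAfter, signSumFrom, Slice.sign, swapAt] at hx ⊢
    cases up <;> cases u <;> cases ov <;> rfl
  | cap_slide i ov =>
    refine SignsDiffer.shift (s := .cross 0 ov) (x := [.cap 1])
      (y := [.cross 1 (!ov), .cap 0]) (k := 0) ?_ i
    intro l hx hy
    rcases l with _ | ⟨⟨a, u⟩, _ | ⟨⟨b, v⟩, _ | ⟨⟨c, w⟩, l⟩⟩⟩ <;>
      simp [Runs, Slice.Valid, Slice.step, levelAfter, signSumFrom, Slice.sign, swapAt] at hx ⊢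
    cases u <;> cases v <;> cases w <;> cases ov <;> simp_all [Slice.crossingSign]
  | curl_right i a up ov =>
    refine SignsDiffer.shift (s := .cup 1 a up) (x := [.cross 0 ov, .cap 1])
      (y := []) (k := if ov then 1 else -1) ?_ i
    intro l hx hy
    rcases l with _ | ⟨⟨a, u⟩, l⟩ <;>
      simp [Runs, Slice.Valid, Slice.step, levelAfter, signSumFrom, Slice.sign, swapAt] at hx ⊢
    cases up <;> cases u <;> cases ov <;> simp_all [Slice.crossingSign]
  | curl_left i a up ov =>
    refine SignsDiffer.shift (s := .cup 0 a up) (x := [.cross 1 ov, .cap 0])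
      (y := []) (k := if ov then 1 else -1) ?_ i
    intro l hx hy
    rcases l with _ | ⟨⟨a, u⟩, l⟩ <;>
      simp [Runs, Slice.Valid, Slice.step, levelAfter, signSumFrom, Slice.sign, swapAt] at hx ⊢
    cases up <;> cases u <;> cases ov <;> simp_all [Slice.crossingSign]
  | cancel i ov =>
    refine SignsDiffer.shift (s := .cross 0 ov) (x := [.cross 0 (!ov)]) (y := []) (k := 0) ?_ i
    intro l hx hy
    rcases l with _ | ⟨⟨a, u⟩, _ | ⟨⟨b, v⟩, l⟩⟩ <;>
      simp [Runs, Slice.Valid, Slice.step, levelAfter, signSumFrom, Slice.sign, swapAt] at hx ⊢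
    cases u <;> cases v <;> cases ov <;> rfl
  | triangle i o₁₂ o₁₃ o₂₃ h =>
    refine SignsDiffer.shift (s := .cross 0 o₁₂) (x := [.cross 1 o₁₃, .cross 0 o₂₃])
      (y := [.cross 1 o₂₃, .cross 0 o₁₃, .cross 1 o₁₂]) (k := 0) ?_ i
    intro l hx hy
    rcases l with _ | ⟨⟨a, u⟩, _ | ⟨⟨b, v⟩, _ | ⟨⟨c, w⟩, l⟩⟩⟩ <;>
      simp [Runs, Slice.Valid, Slice.step, levelAfter, signSumFrom, Slice.sign, swapAt] at hx ⊢
    ring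

/-- A move takes place at some level, and the signs of the crossings away from it do not change. -/
theorem exists_of_move {w w' : List (Slice α)} (h : Move w w') :
    ∃ u v x y, LocalMove x y ∧ w = u ++ x ++ v ∧ w' = u ++ y ++ v ∧
      Runs x (levelAfter u []) ∧ Runs y (levelAfter u []) ∧
      ClosesFrom v (levelAfter x (levelAfter u [])) ∧
      ClosesFrom v (levelAfter y (levelAfter u [])) ∧ Runs u [] ∧
      writhe w = writhe w' + curlSign x := by
  obtain ⟨hw, hw', u, v, x, y, hxy, rfl, rfl⟩ := h
  unfold IsLinkDiagram at hw hw'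
  rw [List.append_assoc, closesFrom_append, closesFrom_append] at hw hw'
  obtain ⟨h₁, h₂⟩ := signsDiffer_of_localMove hxy _ hw.2.1 hw'.2.1
  refine ⟨u, v, x, y, hxy, rfl, rfl, hw.2.1, hw'.2.1, hw.2.2, hw'.2.2, hw.1, ?_⟩
  simp only [writhe, List.append_assoc, signSumFrom_append, h₂, h₁]
  ring

theorem ClosesFrom.barFits {w : List (Slice α)} {l : Level α} (h : ClosesFrom w l) :
    BarFits (w.map .strand) l.length := by
  induction w generalizing l with
  | nil => simpa [BarFits, ClosesFrom] using h
  | cons s w ih =>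
    have h' := ih h.2
    rw [s.step_length h.1.le] at h'
    exact ⟨h.1.le, h'⟩

namespace TemperleyLieb

variable {K : Type} [Field K] {A : K} {R : Type} [Ring R] [Algebra K R] (T : TemperleyLieb A R)

variable {T} in
theorem floats_slice (s : Slice α) : Floats T (fun m => T.slice (s.setPos m)) := by
  cases s with
  | cup i a up => exact floats_cup
  | cap i => exact floats_cap
  | cross i ov => exact floats_cross ov

variable {T} in
theorem Floats.slice {Y : ℕ → R} (h : Floats T Y) (s : Slice α) :
    Passes (fun m => T.slice (s.setPos m)) s.ins s.outs Y := by
  cases s with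
  | cup i a up => exact h.cup
  | cap i => exact h.cap
  | cross i ov => exact h.cross ov

theorem bracket_smul_one {w : List (Slice α)} (h : IsLinkDiagram w) :
    (loopValue A * bracket A w) • (1 : R) = T.word w := by
  rw [bracket, T.barPolynomial_smul_one _ (ClosesFrom.barFits h), barWord_map_strand]

theorem neg_weight_cube (ov : Bool) :
    -weight A ov ^ 3 = (-A ^ 3) ^ (if ov then 1 else -1 : ℤ) := by
  cases ov
  · simp [weight, ← inv_neg]
  · simp [weight]

theorem word_localMove {x y : List (Slice α)} (h : LocalMove x y) :
    T.word x = ((-A ^ 3) ^ curlSign x) • T.word y := by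
  cases h with
  | exchange s t h =>
    have := ((floats_slice (T := T) t).slice s).comm h
    simp only [Slice.setPos_pos] at this
    simp [word, curlSign, this]
  | zigzag_left i a up => simp [word, slice, curlSign, T.zigzag_left]
  | zigzag_right i a up => simp [word, slice, curlSign, T.zigzag_right]
  | cup_slide i a up ov => simp [word, slice, curlSign, T.cup_mul_cross_succ]
  | cap_slide i ov => simp [word, slice, curlSign, T.cross_mul_cap_succ]
  | curl_right i a up ov =>
    have := T.curl_right ov i
    rw [neg_weight_cube, mul_assoc] at this
    simp [word, slice, curlSign, this]
  | curl_left i a up ov =>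
    have := T.curl_left ov i
    rw [neg_weight_cube, mul_assoc] at this
    simp [word, slice, curlSign, this]
  | cancel i ov => simp [word, slice, curlSign, T.cross_mul_cross_not]
  | triangle i o₁₂ o₁₃ o₂₃ h =>
    have := T.triangle i o₁₂ o₁₃ o₂₃ h
    simp only [mul_assoc] at this
    simp [word, slice, curlSign, this]

theorem jones_smul_one {w : List (Slice α)} (h : IsLinkDiagram w) :
    (loopValue A * jones A w) • (1 : R) = ((-A ^ 3) ^ (-writhe w)) • T.word w := by
  rw [← T.bracket_smul_one h, smul_smul, jones]
  congr 1
  ring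

/-- A curl multiplies the element of the diagram by `(-A³)^(±1)` and changes the writhe by the same
`±1`; the normalizing factor compensates for this. All other moves change neither. -/
theorem jones_eq_of_isotopic [Nontrivial R] (T : TemperleyLieb A R) {w w' : List (Slice α)}
    (h : Isotopic w w') : jones A w = jones A w' := by
  induction h with
  | refl w => rfl
  | symm w w' _ h => exact h.symm
  | trans w₁ w₂ w₃ _ _ h h' => exact h.trans h'
  | rel w w' h =>
    -- Scalars are compared as multiples of `1` in the algebra; this is injective since the algebra
    -- is nontrivial.
    apply mul_left_cancel₀ T.loopValue_ne_zero
    apply smul_left_injective K (one_ne_zero (α := R))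
    simp only
    rw [T.jones_smul_one h.1, T.jones_smul_one h.2.1]
    obtain ⟨u, v, x, y, hxy, rfl, rfl, -, -, -, -, -, hk⟩ := exists_of_move h
    have hA : -A ^ 3 ≠ 0 := by simpa using T.ne_zero
    simp only [word_append, T.word_localMove hxy, hk, smul_mul_assoc, mul_smul_comm, smul_smul]
    congr 1
    rw [← zpow_add₀ hA]
    congr 1
    ring

end TemperleyLieb
end ThetaCurve

/-! ### Band diagrams of knots with bars everywhere. -/

namespace ThetaCurve
namespace TemperleyLieb

variable {K : Type} [Field K] {A : K} {R : Type} [Ring R] [Algebra K R] (T : TemperleyLieb A R)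
  {α : Type}

/-- Elements `X (2 * i)` with `a` bands entering and `b` bands leaving, the first of which is the
`i`-th one. -/
structure Block (X : ℕ → R) (a b : ℕ) : Prop where
  floats : Floats T X
  passes : ∀ {Y : ℕ → R}, Floats T Y → Passes X (2 * a) (2 * b) Y

/-- The product of the idempotents `proj` in the bands `o, o + 1, …` given by a list. -/
def projs : List Bool → ℕ → R
  | [], _ => 1
  | γ :: κ, o => T.proj γ (2 * o) * projs κ (o + 1)

/-- The product of the first `n` bars. -/
def fullProj (n : ℕ) : R := T.projs (List.replicate n true) 0

section Projs

variable {T}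

theorem block_proj (γ : Bool) : Block T (T.proj γ) 1 1 :=
  ⟨floats_proj γ, fun h => h.proj γ⟩

theorem Block.comm_right {X Y : ℕ → R} {a b : ℕ} (hX : Block T X a b) (hY : Floats T Y) {i j : ℕ}
    (h : i ≤ j) : X (2 * i) * Y (2 * (j + b)) = Y (2 * (j + a)) * X (2 * i) := by
  rw [mul_add, mul_add]
  exact hX.passes hY _ _ (by omega)

theorem Block.comm_projs_right {X : ℕ → R} {a b : ℕ} (hX : Block T X a b) (κ : List Bool)
    {i j : ℕ} (h : i ≤ j) :
    X (2 * i) * T.projs κ (j + b) = T.projs κ (j + a) * X (2 * i) := by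
  induction κ generalizing j with
  | nil => simp [projs]
  | cons γ κ ih =>
    have := ih (j := j + 1) (by omega)
    rw [Nat.add_right_comm, Nat.add_right_comm j 1 a] at this
    rw [projs, projs, ← mul_assoc, hX.comm_right (floats_proj γ) h, mul_assoc, this, mul_assoc]

theorem Floats.comm_projs_left {X : ℕ → R} (hX : Floats T X) (κ : List Bool)
    {i o : ℕ} (h : o + κ.length ≤ i) :
    T.projs κ o * X (2 * i) = X (2 * i) * T.projs κ o := by
  induction κ generalizing o with
  | nil => simp [projs]
  | cons γ κ ih =>
    simp only [List.length_cons] at h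
    obtain ⟨j, rfl⟩ : ∃ j, i = j + 1 := ⟨i - 1, by omega⟩
    rw [projs, mul_assoc, ih (by omega), ← mul_assoc,
      (block_proj γ).comm_right hX (show o ≤ j by omega), mul_assoc]

theorem projs_append (κ κ' : List Bool) (o : ℕ) :
    T.projs (κ ++ κ') o = T.projs κ o * T.projs κ' (o + κ.length) := by
  induction κ generalizing o with
  | nil => simp [projs]
  | cons γ κ ih =>
    rw [List.cons_append, projs, projs, ih, mul_assoc, List.length_cons, Nat.add_right_comm,
      Nat.add_assoc]

theorem projs_comm (κ κ' : List Bool) {o o' : ℕ} (h : o + κ.length ≤ o') :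
    T.projs κ o * T.projs κ' o' = T.projs κ' o' * T.projs κ o := by
  induction κ' generalizing o' with
  | nil => simp [projs]
  | cons γ κ' ih =>
    rw [projs, ← mul_assoc, (floats_proj γ).comm_projs_left κ h, mul_assoc, ih (by omega),
      mul_assoc]

theorem projs_mul_self (κ : List Bool) (o : ℕ) : T.projs κ o * T.projs κ o = T.projs κ o := by
  induction κ generalizing o with
  | nil => simp [projs]
  | cons γ κ ih =>
    have := projs_comm (T := T) [γ] κ (le_refl (o + 1))
    simp only [projs, mul_one] at this
    rw [projs, mul_assoc, ← mul_assoc (T.projs κ (o + 1)), ← this, mul_assoc, ih, ← mul_assoc,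
      proj_mul_self]

theorem projs_singleton (γ : Bool) (o : ℕ) : T.projs [γ] o = T.proj γ (2 * o) := by simp [projs]

theorem projs_pair (γ γ' : Bool) (o : ℕ) :
    T.projs [γ, γ'] o = T.proj γ (2 * o) * T.proj γ' (2 * o + 2) := by
  simp [projs, mul_add]

variable {X : ℕ → R} {a b : ℕ}

theorem Block.projs_mul (hX : Block T X a b) (κ₁ μ κ₂ : List Bool) (hμ : μ.length = a) :
    T.projs (κ₁ ++ μ ++ κ₂) 0 * X (2 * κ₁.length) =
      T.projs κ₁ 0 * (T.projs μ κ₁.length * X (2 * κ₁.length)) *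
        T.projs κ₂ (κ₁.length + b) := by
  rw [projs_append, projs_append, mul_assoc, List.length_append, hμ, zero_add, zero_add,
    ← hX.comm_projs_right κ₂ (le_refl _)]
  simp only [mul_assoc]

theorem Block.mul_projs (hX : Block T X a b) (κ₁ μ κ₂ : List Bool) (hμ : μ.length = b) :
    X (2 * κ₁.length) * T.projs (κ₁ ++ μ ++ κ₂) 0 =
      T.projs κ₁ 0 * (X (2 * κ₁.length) * T.projs μ κ₁.length) *
        T.projs κ₂ (κ₁.length + b) := by
  rw [projs_append, projs_append, List.length_append, hμ, zero_add, zero_add, ← mul_assoc,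
    ← mul_assoc, ← hX.floats.comm_projs_left κ₁ (by simp)]
  simp only [mul_assoc]

/-- Slices commute with idempotents which they carry along. -/
theorem Block.projs_comm (hX : Block T X a b) (κ₁ μ μ' κ₂ : List Bool) (hμ : μ.length = a)
    (hμ' : μ'.length = b) (h : T.projs μ κ₁.length * X (2 * κ₁.length) =
      X (2 * κ₁.length) * T.projs μ' κ₁.length) :
    T.projs (κ₁ ++ μ ++ κ₂) 0 * X (2 * κ₁.length) =
      X (2 * κ₁.length) * T.projs (κ₁ ++ μ' ++ κ₂) 0 := by
  rw [hX.projs_mul κ₁ μ κ₂ hμ, hX.mul_projs κ₁ μ' κ₂ hμ', h]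

/-- Only the idempotents in the outgoing bands matter above a slice with all idempotents below
it. -/
theorem Block.projs_mul_projs (hX : Block T X a b) (κ₁ μ μ' κ₂ : List Bool) (hμ : μ.length = a)
    (hμ' : μ'.length = b) :
    T.projs (κ₁ ++ μ ++ κ₂) 0 * (X (2 * κ₁.length) * T.projs (κ₁ ++ μ' ++ κ₂) 0) =
      T.projs (κ₁ ++ μ ++ κ₂) 0 * (X (2 * κ₁.length) * T.projs μ' κ₁.length) := by
  rw [hX.mul_projs κ₁ μ' κ₂ hμ']
  have e₁ : T.projs (κ₁ ++ μ ++ κ₂) 0 * T.projs κ₁ 0 = T.projs (κ₁ ++ μ ++ κ₂) 0 := by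
    rw [List.append_assoc, projs_append, zero_add, mul_assoc,
      ← TemperleyLieb.projs_comm κ₁ (μ ++ κ₂) (by simp), ← mul_assoc, projs_mul_self]
  have e₂ : T.projs (κ₁ ++ μ ++ κ₂) 0 * T.projs κ₂ (κ₁.length + a) =
      T.projs (κ₁ ++ μ ++ κ₂) 0 := by
    rw [projs_append, List.length_append, hμ, zero_add, mul_assoc, projs_mul_self]
  rw [mul_assoc (T.projs κ₁ 0), ← mul_assoc _ (T.projs κ₁ 0), e₁, mul_assoc (X _),
    TemperleyLieb.projs_comm μ' κ₂ (by omega), ← mul_assoc (X _),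
    hX.comm_projs_right κ₂ (le_refl _), mul_assoc, ← mul_assoc _ (T.projs κ₂ _), e₂]

end Projs

/-- The element of the band diagram over a slice, in position `m`. -/
def bandAt (s : Slice α) (m : ℕ) : R :=
  match s with
  | .cup _ _ _ => T.bandCup m
  | .cap _ => T.bandCap m
  | .cross _ ov => T.bandCross ov m

variable {T} in
theorem block_bandAt (s : Slice α) : Block T (T.bandAt s) s.ins s.outs := by
  cases s with
  | cup i a up => exact ⟨floats_bandCup, fun h => h.bandCup⟩
  | cap i => exact ⟨floats_bandCap, fun h => h.bandCap⟩
  | cross i ov => exact ⟨floats_bandCross ov, fun h => h.bandCross ov⟩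

theorem word_double {β : Type} (x y : α → β) (s : Slice α) :
    T.word (s.double x y) = T.bandAt s (2 * s.pos) := by
  cases s <;>
    simp [word, Slice.double, slice, bandAt, bandCup, bandCap, bandCross, Slice.pos, mul_assoc]

theorem barWord_bars (s : Slice α) :
    T.barWord (s.bars.map (.bar : ℕ → BarSlice α)) =
      T.projs (List.replicate s.outs true) s.pos := by
  cases s <;> simp [barWord, Slice.bars, barSlice, Slice.outs, Slice.pos, projs, mul_add]

section FullProj

variable {T} {n i : ℕ}

theorem replicate_split {a : ℕ} (h : i + a ≤ n) : List.replicate n true =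
    List.replicate i true ++ List.replicate a true ++ List.replicate (n - i - a) true := by
  rw [List.replicate_append_replicate, List.replicate_append_replicate]
  congr 1
  omega

/-- Bars in the bands that do not enter the block commute with it and are absorbed by the bars
below, so above the block only the bars in its outgoing bands are new. -/
theorem fullProj_mul_block {X : ℕ → R} {a b : ℕ} (hX : Block T X a b) (h : i + a ≤ n) :
    T.fullProj n * (X (2 * i) * T.fullProj (n - a + b)) =
      T.fullProj n * (X (2 * i) * T.projs (List.replicate b true) i) := by
  have := hX.projs_mul_projs (List.replicate i true) (List.replicate a true)
    (List.replicate b true) (List.replicate (n - i - a) true) (by simp) (by simp)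
  rw [← replicate_split h, List.length_replicate] at this
  rw [fullProj, fullProj, replicate_split (show i + b ≤ n - a + b by omega),
    show n - a + b - i - b = n - i - a by omega]
  exact this

theorem fullProj_mul_projs {k : ℕ} (h : i + k ≤ n) :
    T.fullProj n * T.projs (List.replicate k true) i = T.fullProj n := by
  rw [fullProj, replicate_split h, projs_append, projs_append]
  simp only [List.length_append, List.length_replicate, zero_add, mul_assoc]
  rw [← projs_comm _ _ (by simp), ← mul_assoc (T.projs (List.replicate k true) i),
    projs_mul_self]

theorem projs_mul_fullProj {k : ℕ} (h : i + k ≤ n) :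
    T.projs (List.replicate k true) i * T.fullProj n = T.fullProj n := by
  rw [fullProj, replicate_split h, projs_append, projs_append]
  simp only [List.length_append, List.length_replicate, zero_add]
  rw [← mul_assoc, ← mul_assoc, ← projs_comm _ _ (by simp), mul_assoc (T.projs _ 0),
    projs_mul_self]

theorem fullProj_mul_proj (h : i < n) : T.fullProj n * T.proj true (2 * i) = T.fullProj n := by
  have := fullProj_mul_projs (T := T) (k := 1) (show i + 1 ≤ n from h)
  simpa [projs] using this

theorem proj_mul_fullProj (h : i < n) : T.proj true (2 * i) * T.fullProj n = T.fullProj n := by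
  have := projs_mul_fullProj (T := T) (k := 1) (show i + 1 ≤ n from h)
  simpa [projs] using this

theorem fullProj_mul_self : T.fullProj n * T.fullProj n = T.fullProj n := projs_mul_self _ _

theorem fullProj_zero : T.fullProj 0 = 1 := rfl

end FullProj

/-- The element of a bar diagram, with bars in all bands between any two slices. -/
def barred : List (Slice α) → ℕ → R
  | [], n => T.fullProj n
  | s :: w, n => T.fullProj n * (T.bandAt s (2 * s.pos) * barred w (n - s.ins + s.outs))

theorem fullProj_mul_barred (w : List (Slice α)) (n : ℕ) :
    T.fullProj n * T.barred w n = T.barred w n := by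
  cases w with
  | nil => exact fullProj_mul_self
  | cons s w => rw [barred, ← mul_assoc, fullProj_mul_self]

theorem projs_mul_barred (w : List (Slice α)) {n i k : ℕ} (h : i + k ≤ n) :
    T.projs (List.replicate k true) i * T.barred w n = T.barred w n := by
  rw [← fullProj_mul_barred, ← mul_assoc, projs_mul_fullProj h]

theorem proj_mul_barred (w : List (Slice α)) {n i : ℕ} (h : i < n) :
    T.proj true (2 * i) * T.barred w n = T.barred w n := by
  rw [← fullProj_mul_barred, ← mul_assoc, proj_mul_fullProj h]

theorem barWord_barDiagram_cons (s : Slice α) (w : List (Slice α)) :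
    T.barWord (barDiagram (s :: w)) = T.bandAt s (2 * s.pos) *
      (T.projs (List.replicate s.outs true) s.pos * T.barWord (barDiagram w)) := by
  rw [barDiagram, List.flatMap_cons, barWord_append, barWord_append, barWord_map_strand,
    word_double, barWord_bars, mul_assoc]
  rfl

/-- The bar diagram has bars only above the strands leaving each slice. The bars in all other bands,
which `barred` adds at each level, are duplicates of bars further down and cost nothing by
idempotency. -/
theorem fullProj_mul_barWord {w : List (Slice α)} {l : Level α} (h : ClosesFrom w l) :
    T.fullProj l.length * T.barWord (barDiagram w) = T.barred w l.length := by
  induction w generalizing l with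
  | nil => simp [barDiagram, barWord, barred]
  | cons s w ih =>
    have := ih h.2
    rw [s.step_length h.1.le] at this
    rw [barWord_barDiagram_cons, barred, ← this, ← mul_assoc (T.bandAt s _), ← mul_assoc,
      ← fullProj_mul_block (block_bandAt s) h.1.le]
    simp only [mul_assoc]

theorem barWord_barDiagram {w : List (Slice α)} (h : IsLinkDiagram w) :
    T.barWord (barDiagram w) = T.barred w 0 := by
  have := T.fullProj_mul_barWord h
  rwa [List.length_nil, fullProj_zero, one_mul] at this

/-- A slice without local minimum needs no bars above it. -/
theorem barred_cons_of_ne_cup (s : Slice α) (hs : s.ins = 2) {n : ℕ}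
    (h : s.pos + 2 ≤ n) {F : R} :
    T.fullProj n * (T.bandAt s (2 * s.pos) * (T.fullProj (n - s.ins + s.outs) * F)) =
      T.fullProj n * (T.bandAt s (2 * s.pos) * F) := by
  rw [← mul_assoc (T.bandAt s _), ← mul_assoc, fullProj_mul_block (block_bandAt s) (by omega)]
  cases s with
  | cup i a up => simp [Slice.ins] at hs
  | cap i => simp [Slice.outs, projs, mul_assoc]
  | cross i ov =>
    have e : T.bandCross ov (2 * i) * T.projs [true, true] i =
        T.projs [true, true] i * T.bandCross ov (2 * i) := by
      rw [projs_pair, mul_assoc (T.proj true (2 * i)), T.proj_add_two_mul_bandCross,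
        ← mul_assoc (T.proj true (2 * i)), T.proj_mul_bandCross, mul_assoc,
        T.proj_comm true true (le_refl (2 * i + 2))]
    have e' : T.fullProj n * T.projs [true, true] i = T.fullProj n :=
      fullProj_mul_projs (k := 2) h
    simp only [Slice.outs, bandAt, Slice.pos, List.replicate]
    rw [e, ← mul_assoc, e', mul_assoc]

end TemperleyLieb
end ThetaCurve

/-! ### Invariance of the normalized Jaeger polynomial of knots. -/

namespace ThetaCurve
namespace TemperleyLieb

variable {K : Type} [Field K] {A : K} {R : Type} [Ring R] [Algebra K R] (T : TemperleyLieb A R)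
  {α : Type}

theorem bandCup_mul_proj_right (γ : Bool) {m j : ℕ} (h : m ≤ j) :
    T.bandCup m * T.proj γ (j + 4) = T.proj γ j * T.bandCup m :=
  (floats_proj (T := T) γ).bandCup m j h

theorem bandCup_mul_proj_left (γ : Bool) {m j : ℕ} (h : j + 2 ≤ m) :
    T.bandCup m * T.proj γ j = T.proj γ j * T.bandCup m := by
  have := ((floats_bandCup (T := T)).proj γ).comm h
  rw [this]
  congr 2
  omega

theorem bandCross_mul_proj_left (γ ov : Bool) {m j : ℕ} (h : j + 2 ≤ m) :
    T.bandCross ov m * T.proj γ j = T.proj γ j * T.bandCross ov m := by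
  have := ((floats_bandCross (T := T) ov).proj γ).comm h
  rw [this]
  congr 2
  omega

theorem bandCross_mul_proj_right (γ ov : Bool) {m j : ℕ} (h : m + 4 ≤ j) :
    T.bandCross ov m * T.proj γ j = T.proj γ j * T.bandCross ov m := by
  have := ((floats_proj (T := T) γ).bandCross ov).comm h
  rw [this]
  congr 2
  omega

theorem proj_true_mul_cross (ov : Bool) (m : ℕ) :
    T.proj true m * T.cross ov m = weight A ov • T.proj true m := by
  have h := T.loopValue_ne_zero
  have : T.proj true m * T.hook m = 0 := by
    simp [proj, sub_mul, hook_mul_hook, smul_smul, h]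
  simp [cross, mul_add, this]

/-- A local minimum needs a bar above only one of its ends. -/
theorem fullProj_mul_bandCup {n i : ℕ} (h : i ≤ n) (F : R) :
    T.fullProj n * (T.bandCup (2 * i) * (T.fullProj (n + 2) * F)) =
      T.fullProj n * (T.bandCup (2 * i) * (T.proj true (2 * i) * F)) := by
  have := fullProj_mul_block (T := T) (block_bandAt (.cup i () true)) (n := n) (i := i) (by simpa)
  simp only [Slice.ins, Slice.outs, bandAt, Nat.sub_zero, List.replicate] at this
  rw [← mul_assoc (T.bandCup _), ← mul_assoc, this, projs_pair, T.proj_comm _ _ le_rfl,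
    ← mul_assoc (T.bandCup _) (T.proj _ _), ← T.bandCup_mul_proj, mul_assoc,
    mul_assoc (T.bandCup _), T.proj_mul_self, mul_assoc (T.bandCup _)]

theorem barred_exchange (s t : Slice α) (h : s.pos + s.outs ≤ t.pos) (v : List (Slice α)) {n : ℕ}
    (hs : s.pos + s.ins ≤ n) (ht : t.pos + t.ins ≤ n - s.ins + s.outs) :
    T.barred ([s, t] ++ v) n = T.barred ([t.setPos (t.pos - s.outs + s.ins), s] ++ v) n := by
  obtain ⟨j, hj⟩ : ∃ j, t.pos = j + s.outs := ⟨t.pos - s.outs, by omega⟩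
  have hb (i : ℕ) : T.bandAt (t.setPos i) = T.bandAt t := by cases t <;> rfl
  have e : n - t.ins + t.outs - s.ins + s.outs = n - s.ins + s.outs - t.ins + t.outs := by omega
  simp only [List.cons_append, List.nil_append, barred, Slice.ins_setPos, Slice.outs_setPos,
    Slice.pos_setPos, hb, e]
  simp only [hj, Nat.add_sub_cancel]
  rw [← mul_assoc (T.bandAt s _) (T.fullProj _), ← mul_assoc (T.fullProj n),
    fullProj_mul_block (block_bandAt s) hs, ← mul_assoc (T.bandAt t _) (T.fullProj _),
    ← mul_assoc (T.fullProj n) (T.bandAt t _ * _),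
    fullProj_mul_block (block_bandAt t) (by omega)]
  simp only [mul_assoc]
  congr 1
  have e₁ := (block_bandAt (T := T) t).floats.comm_projs_left (List.replicate s.outs true)
    (o := s.pos) (i := j + s.outs) (by simp; omega)
  have e₂ := (block_bandAt (T := T) s).comm_projs_right (List.replicate t.outs true)
    (show s.pos ≤ j by omega)
  have e₃ := (block_bandAt (T := T) s).comm_right (block_bandAt (T := T) t).floats
    (show s.pos ≤ j by omega)
  rw [← mul_assoc (T.projs _ _) (T.bandAt t _), e₁, mul_assoc, T.projs_mul_barred _ (by omega),
    ← mul_assoc (T.projs _ _) (T.bandAt s _), ← e₂, mul_assoc, T.projs_mul_barred _ (by omega),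
    ← mul_assoc, e₃, mul_assoc]

theorem weight_pow_eight (ov : Bool) :
    weight A ov ^ 8 = (A ^ 8) ^ (if ov then 1 else -1 : ℤ) := by
  cases ov <;> simp [weight]

/-- Bars inside the region of a move are slid along their bands until bars below or above the region
absorb them; then the corresponding move of bare bands applies. Only the first Reidemeister move is
not exact: the curl of a band gives `w⁶` and a full twist, and the full twist acts on a bar as `w²`.
The total `w⁸ = A^(±8)` is the reason for the normalization by `A^(-8 ω)`. -/
theorem barred_localMove {x y : List (Slice α)} (h : LocalMove x y) (v : List (Slice α))
    {l : Level α} (hx : Runs x l) (hy : Runs y l) :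
    T.barred (x ++ v) l.length = ((A ^ 8) ^ curlSign x) • T.barred (y ++ v) l.length := by
  cases h with
  | exchange s t h =>
    have ht := hx.2.1.le
    rw [s.step_length hx.1.le] at ht
    rw [T.barred_exchange s t h v hx.1.le ht]
    simp [curlSign]
  | zigzag_left i a up =>
    have hi : i + 1 ≤ l.length := by
      have := hx.2.1.le
      rw [Slice.step_length _ hx.1.le] at this
      simp only [Slice.ins, Slice.outs, Slice.pos] at this
      omega
    have e : T.bandCup (2 * i) * T.proj true (2 * i + 2 + 2) = _ :=
      T.bandCup_mul_proj_right true le_rfl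
    simp only [List.cons_append, List.nil_append, barred, Slice.ins, Slice.outs, Slice.pos, bandAt,
      Nat.sub_zero, Nat.add_sub_cancel, Nat.add_zero, curlSign, zpow_zero, one_smul]
    -- The one bar needed at the minimum is carried around the minimum and then around the maximum
    -- to the third strand, and from there below the minimum, where it is absorbed.
    rw [T.fullProj_mul_bandCup (by omega), ← mul_assoc (T.bandCup _), T.bandCup_mul_proj,
      mul_assoc, ← mul_assoc (T.proj _ _), mul_add, mul_one, T.proj_mul_bandCap,
      mul_assoc, mul_mul_of_eq_mul e, ← mul_assoc, fullProj_mul_proj (by omega),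
      mul_mul_of_eq (T.band_zigzag_left _), one_mul, fullProj_mul_barred]
  | zigzag_right i a up =>
    have hi : i + 1 ≤ l.length := hx.1.le
    simp only [List.cons_append, List.nil_append, barred, Slice.ins, Slice.outs, Slice.pos, bandAt,
      Nat.sub_zero, Nat.add_sub_cancel, Nat.add_zero, curlSign, zpow_zero, one_smul]
    rw [T.fullProj_mul_bandCup (by omega), ← mul_assoc (T.proj _ _), mul_add, mul_one,
      ← T.proj_mul_bandCap, mul_assoc, mul_mul_of_eq_mul (T.bandCup_mul_proj_left true le_rfl),
      ← mul_assoc, fullProj_mul_proj (by omega),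
      mul_mul_of_eq (T.band_zigzag_right _), one_mul, fullProj_mul_barred]
  | cup_slide i a up ov =>
    have hi : i + 1 ≤ l.length := hy.1.le
    simp only [List.cons_append, List.nil_append, barred, Slice.ins, Slice.outs, Slice.pos, bandAt,
      Nat.sub_zero, Nat.add_sub_cancel, curlSign, zpow_zero, one_smul]
    rw [T.fullProj_mul_bandCup (by omega), T.fullProj_mul_bandCup hi,
      ← mul_assoc (T.bandCup (2 * (i + 1))), T.bandCup_mul_proj, mul_assoc]
    simp only [mul_add, mul_one]
    rw [← mul_mul_of_eq_mul (T.bandCross_mul_proj_left true ov le_rfl),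
      T.proj_mul_barred v (by omega),
      ← mul_mul_of_eq_mul (T.bandCross_mul_proj_right true (!ov) (le_refl (2 * i + 4))),
      show 2 * i + 4 = 2 * (i + 2) by ring, T.proj_mul_barred v (by omega),
      mul_mul_of_eq_mul (T.bandCup_mul_bandCross ov (2 * i))]
  | cap_slide i ov =>
    have hi : i + 1 + 2 ≤ l.length := hy.1.le
    have e₁ (F : R) := T.barred_cons_of_ne_cup (.cross i ov : Slice α) rfl (n := l.length)
      (show i + 2 ≤ l.length by omega) (F := F)
    have e₂ (F : R) := T.barred_cons_of_ne_cup (.cross (i + 1) (!ov) : Slice α) rfl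
      (n := l.length) hi (F := F)
    simp only [List.cons_append, List.nil_append, barred, Slice.ins, Slice.outs, Slice.pos, bandAt,
      curlSign, zpow_zero, one_smul] at e₁ e₂ ⊢
    rw [e₁, e₂, mul_add, mul_one, mul_mul_of_eq_mul (T.bandCross_mul_bandCap ov (2 * i))]
  | curl_right i a up ov =>
    have hi : i + 1 ≤ l.length := hx.1.le
    have e₁ (F : R) := T.barred_cons_of_ne_cup (.cross i ov : Slice α) rfl (n := l.length + 2)
      (show i + 2 ≤ l.length + 2 by omega) (F := F)
    simp only [List.cons_append, List.nil_append, barred, Slice.ins, Slice.outs, Slice.pos, bandAt,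
      Nat.sub_zero, Nat.add_sub_cancel, Nat.add_zero, curlSign] at e₁ ⊢
    rw [e₁, T.fullProj_mul_bandCup hi, ← mul_assoc (T.bandCup (2 * (i + 1))),
      T.bandCup_mul_proj, mul_assoc]
    simp only [mul_add, mul_one]
    have c := T.band_curl_right ov (2 * i)
    rw [← mul_mul_of_eq_mul (T.bandCross_mul_proj_right true ov (le_refl (2 * i + 4))),
      ← mul_assoc (T.proj _ _) (T.bandCap _), ← T.proj_mul_bandCap, mul_assoc,
      ← mul_mul_of_eq_mul (T.proj_mul_bandCross true ov _),
      mul_mul_of_eq_mul (T.bandCup_mul_proj_left true le_rfl)]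
    rw [mul_assoc] at c
    rw [← mul_assoc (T.bandCross _ _), ← mul_assoc (T.bandCup _), c]
    simp only [smul_mul_assoc, mul_smul_comm]
    rw [← mul_assoc, fullProj_mul_proj (by omega),
      ← fullProj_mul_proj (T := T) (show i < l.length by omega)]
    -- A bar borrowed from below meets the full twist left by the curl; each of its two crossings
    -- becomes the scalar `weight A ov`.
    simp only [mul_assoc, mul_mul_of_eq (T.proj_true_mul_cross ov (2 * i)), smul_mul_assoc,
      mul_smul_comm, smul_smul]
    congr 1
    · rw [← weight_pow_eight]
      ring
    · rw [← mul_assoc, fullProj_mul_proj (by omega), fullProj_mul_barred]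
  | curl_left i a up ov =>
    have hi : i + 1 ≤ l.length := by
      have := hx.2.1.le
      rw [Slice.step_length _ hx.1.le] at this
      simp only [Slice.ins, Slice.outs, Slice.pos] at this
      omega
    have e₁ (F : R) := T.barred_cons_of_ne_cup (.cross (i + 1) ov : Slice α) rfl
      (n := l.length + 2) (show i + 1 + 2 ≤ l.length + 2 by omega) (F := F)
    simp only [List.cons_append, List.nil_append, barred, Slice.ins, Slice.outs, Slice.pos, bandAt,
      Nat.sub_zero, Nat.add_sub_cancel, Nat.add_zero, curlSign] at e₁ ⊢
    rw [e₁, T.fullProj_mul_bandCup (by omega)]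
    simp only [mul_add, mul_one]
    have c := T.band_curl_left ov (2 * i)
    have e : T.bandCup (2 * i) * T.proj true (2 * i + 2 + 2) = _ :=
      T.bandCup_mul_proj_right true le_rfl
    rw [← mul_mul_of_eq_mul (T.bandCross_mul_proj_left true ov le_rfl),
      ← mul_assoc (T.proj _ _) (T.bandCap _), T.proj_mul_bandCap, mul_assoc,
      ← mul_mul_of_eq_mul (T.proj_add_two_mul_bandCross true ov _), mul_mul_of_eq_mul e]
    rw [mul_assoc] at c
    rw [← mul_assoc (T.bandCross _ _), ← mul_assoc (T.bandCup _), c]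
    simp only [smul_mul_assoc, mul_smul_comm]
    rw [← mul_assoc, fullProj_mul_proj (by omega),
      ← fullProj_mul_proj (T := T) (show i < l.length by omega)]
    simp only [mul_assoc, mul_mul_of_eq (T.proj_true_mul_cross ov (2 * i)), smul_mul_assoc,
      mul_smul_comm, smul_smul]
    congr 1
    · rw [← weight_pow_eight]
      ring
    · rw [← mul_assoc, fullProj_mul_proj (by omega), fullProj_mul_barred]
  | cancel i ov =>
    have hi : i + 2 ≤ l.length := hx.1.le
    have e₁ (F : R) := T.barred_cons_of_ne_cup (.cross i ov : Slice α) rfl (n := l.length)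
      hi (F := F)
    simp only [List.cons_append, List.nil_append, barred, Slice.ins, Slice.outs, Slice.pos, bandAt,
      curlSign, zpow_zero, one_smul] at e₁ ⊢
    rw [e₁, mul_mul_of_eq (T.bandCross_mul_bandCross_not ov (2 * i)), one_mul,
      Nat.sub_add_cancel (by omega), Nat.sub_add_cancel (by omega), fullProj_mul_barred]
  | triangle i o₁₂ o₁₃ o₂₃ h =>
    have hi : i + 1 + 2 ≤ l.length := hy.1.le
    have e₀ (o : Bool) (F : R) := T.barred_cons_of_ne_cup (.cross i o : Slice α) rfl
      (n := l.length) (show i + 2 ≤ l.length by omega) (F := F)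
    have e₁ (o : Bool) (F : R) := T.barred_cons_of_ne_cup (.cross (i + 1) o : Slice α) rfl
      (n := l.length) hi (F := F)
    have t := T.band_triangle (2 * i) o₁₂ o₁₃ o₂₃ h
    simp only [mul_assoc] at t
    simp only [List.cons_append, List.nil_append, barred, Slice.ins, Slice.outs, Slice.pos, bandAt,
      curlSign, zpow_zero, one_smul, Nat.sub_add_cancel (show 2 ≤ l.length by omega)] at e₀ e₁ ⊢
    rw [e₁ o₁₃, e₀ o₁₂, e₀ o₁₃, e₁ o₂₃, mul_add, mul_one]
    have t' := congrArg (· * T.barred v l.length) t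
    simp only [mul_assoc] at t'
    rw [t']

/-- The part below a move is a left factor that does not depend on what is put on top, so a local
identity extends to whole diagrams. -/
theorem barred_append (u : List (Slice α)) (l : Level α) (h : Runs u l) :
    ∃ z : R, ∀ w, T.barred (u ++ w) l.length = z * T.barred w (levelAfter u l).length := by
  induction u generalizing l with
  | nil => exact ⟨1, fun w => by simp [levelAfter]⟩
  | cons s u ih =>
    obtain ⟨z, hz⟩ := ih _ h.2
    rw [s.step_length h.1.le] at hz
    refine ⟨T.fullProj l.length * (T.bandAt s (2 * s.pos) * z), fun w => ?_⟩
    rw [List.cons_append, barred, hz]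
    simp only [mul_assoc]
    rfl

theorem bandBarFits_cons {s : Slice α} {n : ℕ} {w : List (BarSlice α)} (h : s.pos + s.ins ≤ n)
    (hw : BarFits w (2 * (n - s.ins + s.outs))) :
    BarFits ((s.double id id).map .strand ++ s.bars.map .bar ++ w) (2 * n) := by
  cases s <;>
    simp only [Slice.double, Slice.bars, Slice.pos, Slice.ins, Slice.outs, List.map_cons,
      List.map_nil, List.cons_append, List.nil_append, BarFits, Nat.sub_zero] at h hw ⊢
  · refine ⟨by omega, by omega, by omega, by omega, ?_⟩
    convert hw using 1
    omega
  · refine ⟨by omega, by omega, ?_⟩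
    convert hw using 1
    omega
  · refine ⟨by omega, by omega, by omega, by omega, by omega, by omega, ?_⟩
    convert hw using 1
    omega

theorem barDiagram_barFits {w : List (Slice α)} {l : Level α} (h : ClosesFrom w l) :
    BarFits (barDiagram w) (2 * l.length) := by
  induction w generalizing l with
  | nil =>
    have : l = [] := h
    simp [barDiagram, BarFits, this]
  | cons s w ih =>
    have := ih h.2
    rw [s.step_length h.1.le] at this
    exact bandBarFits_cons h.1.le this

theorem jaegerKnot_smul_one {w : List (Slice α)} (h : IsLinkDiagram w) :
    (loopValue A * jaegerKnot A w) • (1 : R) = T.barred w 0 := by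
  rw [jaegerKnot, T.barPolynomial_smul_one _ (barDiagram_barFits h), T.barWord_barDiagram h]

theorem jaegerKnotNormalized_smul_one {w : List (Slice α)} (h : IsLinkDiagram w) :
    (loopValue A * jaegerKnotNormalized A w) • (1 : R) =
      ((A ^ 8) ^ (-writhe w)) • T.barred w 0 := by
  rw [← T.jaegerKnot_smul_one h, smul_smul, jaegerKnotNormalized]
  congr 1
  ring

theorem jaegerKnotNormalized_eq_of_isotopic [Nontrivial R] (T : TemperleyLieb A R)
    {w w' : List (Slice α)} (h : Isotopic w w') :
    jaegerKnotNormalized A w = jaegerKnotNormalized A w' := by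
  induction h with
  | refl w => rfl
  | symm w w' _ h => exact h.symm
  | trans w₁ w₂ w₃ _ _ h h' => exact h.trans h'
  | rel w w' h =>
    apply mul_left_cancel₀ T.loopValue_ne_zero
    apply smul_left_injective K (one_ne_zero (α := R))
    simp only
    rw [T.jaegerKnotNormalized_smul_one h.1, T.jaegerKnotNormalized_smul_one h.2.1]
    obtain ⟨u, v, x, y, hxy, rfl, rfl, hx, hy, -, -, hu, hk⟩ := exists_of_move h
    obtain ⟨z, hz⟩ := T.barred_append u [] hu
    rw [List.length_nil] at hz
    have hA : A ^ 8 ≠ 0 := by simpa using T.ne_zero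
    rw [List.append_assoc, List.append_assoc, hz, hz, T.barred_localMove hxy v hx hy,
      mul_smul_comm, smul_smul]
    congr 1
    rw [← List.append_assoc, ← List.append_assoc, hk, ← zpow_add₀ hA]
    congr 1
    ring

end TemperleyLieb
end ThetaCurve

/-! ### Theta-curves: idempotents on the bands and their propagation from the vertex `v₁`. -/

namespace ThetaCurve

/-! ### Slices of theta-curves -/

namespace ThetaSlice

/-- The leftmost position involved in a slice. -/
def pos : ThetaSlice → ℕ
  | strand s => s.pos
  | tail i => i
  | head i => i

/-- The number of strands entering from below. -/
def ins : ThetaSlice → ℕ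
  | strand s => s.ins
  | tail _ => 0
  | head _ => 3

/-- The number of strands leaving at the top. -/
def outs : ThetaSlice → ℕ
  | strand s => s.outs
  | tail _ => 3
  | head _ => 0

/-- The strands leaving a slice, given the strands entering it. -/
def top : ThetaSlice → Level (Fin 3) → Level (Fin 3)
  | strand s, m => s.top m
  | tail _, _ => [(0, true), (1, true), (2, true)]
  | head _, _ => []

theorem Valid.le {s : ThetaSlice} {l : Level (Fin 3)} (h : s.Valid l) :
    s.pos + s.ins ≤ l.length := by
  cases s with
  | strand s => exact Slice.Valid.le h
  | tail i => exact h
  | head i =>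
    have := congrArg List.length (show (l.drop i).take 3 = _ from h)
    simp at this
    simp only [pos, ins]
    omega

theorem step_append (s : ThetaSlice) {l₁ m : Level (Fin 3)} (l₂ : Level (Fin 3))
    (h₁ : l₁.length = s.pos) (hm : m.length = s.ins) :
    s.step (l₁ ++ m ++ l₂) = l₁ ++ s.top m ++ l₂ := by
  cases s with
  | strand s => exact s.step_append l₂ h₁ hm
  | tail i =>
    obtain rfl : m = [] := List.eq_nil_of_length_eq_zero hm
    simp only [pos] at h₁
    simp [step, top, ← h₁]
  | head i =>
    simp only [pos, ins] at h₁ hm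
    simp [step, top, ← h₁, ← hm, List.drop_append]

theorem top_length (s : ThetaSlice) {m : Level (Fin 3)} (hm : m.length = s.ins) :
    (s.top m).length = s.outs := by
  cases s with
  | strand s => exact s.top_length hm
  | tail i => rfl
  | head i => rfl

theorem step_length (s : ThetaSlice) {l : Level (Fin 3)} (h : s.pos + s.ins ≤ l.length) :
    (s.step l).length = l.length - s.ins + s.outs := by
  obtain ⟨l₁, m, l₂, rfl, h₁, hm⟩ := Slice.exists_append h
  rw [s.step_append l₂ h₁ hm]
  simp only [List.length_append, s.top_length hm] at h ⊢
  omega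

end ThetaSlice

namespace TemperleyLieb

variable {K : Type} [Field K] {A : K} {R : Type} [Ring R] [Algebra K R] (T : TemperleyLieb A R)

/-- The element of the band diagram over a slice, in position `m`. -/
def thetaAt (s : ThetaSlice) (m : ℕ) : R :=
  match s with
  | .strand s => T.bandAt s m
  | .tail _ => T.bandTail m
  | .head _ => T.bandHead m

/-- The idempotents in the bands beginning at the vertex `v₁`. -/
def tailProj (c : Fin 3 → Bool) : ThetaSlice → R
  | .tail i => T.projs [c 0, c 1, c 2] i
  | _ => 1

/-- The element of a slice with idempotents `proj` in the bands beginning at the vertex `v₁`. -/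
def coloredSlice (c : Fin 3 → Bool) (s : ThetaSlice) : R :=
  T.thetaAt s (2 * s.pos) * T.tailProj c s

/-- The element of a band diagram with idempotents `proj` in the bands beginning at the
vertex `v₁`. -/
def colored (c : Fin 3 → Bool) (w : List ThetaSlice) : R := (w.map (T.coloredSlice c)).prod

theorem colored_cons (c : Fin 3 → Bool) (s : ThetaSlice) (w : List ThetaSlice) :
    T.colored c (s :: w) = T.coloredSlice c s * T.colored c w := by simp [colored]

/-- The idempotents in all bands at a level. -/
def levelProj (c : Fin 3 → Bool) (l : Level (Fin 3)) : R := T.projs (l.map fun p => c p.1) 0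

/-- The element of a band diagram with idempotents `proj` in all bands between any two slices. -/
def allColored (c : Fin 3 → Bool) : List ThetaSlice → Level (Fin 3) → R
  | [], l => T.levelProj c l
  | s :: w, l => T.levelProj c l * (T.thetaAt s (2 * s.pos) * allColored c w (s.step l))

variable {T}

theorem block_thetaAt (s : ThetaSlice) : Block T (T.thetaAt s) s.ins s.outs := by
  cases s with
  | strand s => exact block_bandAt s
  | tail i => exact ⟨floats_bandTail, fun h => h.bandTail⟩
  | head i => exact ⟨floats_bandHead, fun h => h.bandHead⟩

theorem Block.projs_mul_of_ins_eq_zero {X : ℕ → R} {b : ℕ} (hX : Block T X 0 b)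
    (κ₁ μ κ₂ : List Bool) (hμ : μ.length = b) :
    T.projs (κ₁ ++ κ₂) 0 * (X (2 * κ₁.length) * T.projs μ κ₁.length) =
      X (2 * κ₁.length) * T.projs (κ₁ ++ μ ++ κ₂) 0 := by
  have h := hX.projs_mul κ₁ [] κ₂ rfl
  rw [List.append_nil, projs, one_mul] at h
  rw [hX.mul_projs κ₁ μ κ₂ hμ, ← mul_assoc, h, mul_assoc,
    ← TemperleyLieb.projs_comm μ κ₂ (by omega)]
  simp only [mul_assoc]

theorem Block.projs_mul_of_outs_eq_zero {X : ℕ → R} {a : ℕ} (hX : Block T X a 0)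
    (κ₁ μ κ₂ : List Bool) (hμ : μ.length = a) :
    T.projs (κ₁ ++ μ ++ κ₂) 0 * X (2 * κ₁.length) =
      T.projs μ κ₁.length * X (2 * κ₁.length) * T.projs (κ₁ ++ κ₂) 0 := by
  rw [hX.projs_mul κ₁ μ κ₂ hμ, projs_append, ← mul_assoc,
    TemperleyLieb.projs_comm κ₁ μ (by simp), mul_assoc (T.projs μ _),
    hX.floats.comm_projs_left κ₁ (by simp), Nat.add_zero, Nat.zero_add]
  simp only [mul_assoc]

variable (T)

theorem bandCup_mul_projs (γ : Bool) (i : ℕ) :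
    T.bandCup (2 * i) * T.projs [γ, γ] i = T.bandCup (2 * i) * T.proj γ (2 * i) := by
  rw [projs_pair, T.proj_comm _ _ le_rfl, ← mul_assoc, ← T.bandCup_mul_proj, mul_assoc,
    proj_mul_self]

theorem projs_mul_bandCross (γ γ' ov : Bool) (i : ℕ) :
    T.projs [γ, γ'] i * T.bandCross ov (2 * i) = T.bandCross ov (2 * i) * T.projs [γ', γ] i := by
  rw [projs_pair, projs_pair, mul_assoc, T.proj_add_two_mul_bandCross, ← mul_assoc,
    T.proj_mul_bandCross, mul_assoc, T.proj_comm _ _ le_rfl]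

theorem projs_mul_bandCap_of_ne {γ γ' : Bool} (h : γ ≠ γ') (i : ℕ) :
    T.projs [γ, γ'] i * T.bandCap (2 * i) = 0 := by
  rw [projs_pair, mul_assoc, ← T.proj_mul_bandCap, ← mul_assoc, T.proj_mul_proj_of_ne h, zero_mul]

end TemperleyLieb

/-! ### Bad strands -/

/-- A strand of a level, together with the arc to which it belongs and a flag saying that its
idempotent is the wrong one. -/
structure Entry where
  strand : Fin 3 × Bool
  arc : ℕ
  bad : Bool

namespace Entry

/-- The kind of idempotent in the band of a strand. -/
def color (c : Fin 3 → Bool) (e : Entry) : Bool := xor (c e.strand.1) e.bad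

/-- Replace the arc `y` by the arc `x`. -/
def relabel (x y : ℕ) (e : Entry) : Entry := ⟨e.strand, if y = e.arc then x else e.arc, e.bad⟩

/-- The signed number of bad strands of the edge `k` contributed by an entry. -/
def charge (k : Fin 3) (e : Entry) : ℤ :=
  if e.bad = true ∧ e.strand.1 = k then (if e.strand.2 then 1 else -1) else 0

/-- A label for a new arc. -/
def fresh (z : List Entry) : ℕ := (z.map arc).foldr max 0

/-- The effect of a slice on a list of entries; at a local minimum there is a choice. -/
inductive Next : ThetaSlice → List Entry → List Entry → Prop
  | cup (z₁ z₂ : List Entry) (a : Fin 3) (up b : Bool) :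
    Next (.strand (.cup z₁.length a up)) (z₁ ++ z₂)
      (z₁ ++ [⟨(a, up), fresh (z₁ ++ z₂) + 1, b⟩, ⟨(a, !up), fresh (z₁ ++ z₂) + 1, b⟩] ++ z₂)
  | cap (z₁ z₂ : List Entry) (a : Fin 3) (up b : Bool) (x y : ℕ) :
    Next (.strand (.cap z₁.length)) (z₁ ++ [⟨(a, up), x, b⟩, ⟨(a, !up), y, b⟩] ++ z₂)
      ((z₁ ++ z₂).map (relabel x y))
  | cross (z₁ z₂ : List Entry) (p q : Entry) (ov : Bool) :
    Next (.strand (.cross z₁.length ov)) (z₁ ++ [p, q] ++ z₂) (z₁ ++ [q, p] ++ z₂)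
  | tail (z₁ z₂ : List Entry) :
    Next (.tail z₁.length) (z₁ ++ z₂)
      (z₁ ++ [⟨(0, true), fresh (z₁ ++ z₂) + 1, false⟩, ⟨(1, true), fresh (z₁ ++ z₂) + 2, false⟩,
        ⟨(2, true), fresh (z₁ ++ z₂) + 3, false⟩] ++ z₂)
  | head (z₁ z₂ : List Entry) (x₀ x₁ x₂ : ℕ) (b₀ b₁ b₂ : Bool) :
    Next (.head z₁.length)
      (z₁ ++ [⟨(0, true), x₀, b₀⟩, ⟨(1, true), x₁, b₁⟩, ⟨(2, true), x₂, b₂⟩] ++ z₂) (z₁ ++ z₂)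

theorem exists_append {z : List Entry} {i k : ℕ} (h : i + k ≤ z.length) :
    ∃ z₁ m z₂ : List Entry, z = z₁ ++ m ++ z₂ ∧ z₁.length = i ∧ m.length = k :=
  ⟨z.take i, (z.drop i).take k, (z.drop i).drop k, by simp, by simp; omega, by simp; omega⟩

theorem Next.level {s : ThetaSlice} {z z' : List Entry} (h : Next s z z') :
    z'.map strand = s.step (z.map strand) := by
  cases h with
  | cup z₁ z₂ a up b =>
    have := (ThetaSlice.strand (.cup z₁.length a up)).step_append (l₁ := z₁.map strand) (m := [])
      (z₂.map strand) (by simp [ThetaSlice.pos, Slice.pos]) rfl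
    simp only [List.map_append, List.append_nil] at this ⊢
    rw [this]
    rfl
  | cap z₁ z₂ a up b x y =>
    have := (ThetaSlice.strand (.cap z₁.length)).step_append (l₁ := z₁.map strand)
      (m := [(a, up), (a, !up)]) (z₂.map strand) (by simp [ThetaSlice.pos, Slice.pos]) rfl
    simp only [List.map_append, List.map_cons, List.map_nil, this]
    have e : strand ∘ relabel x y = strand := rfl
    simp [ThetaSlice.top, Slice.top, e]
  | cross z₁ z₂ p q ov =>
    have := (ThetaSlice.strand (.cross z₁.length ov)).step_append (l₁ := z₁.map strand)
      (m := [p.strand, q.strand]) (z₂.map strand) (by simp [ThetaSlice.pos, Slice.pos]) rfl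
    simp only [List.map_append, List.map_cons, List.map_nil, this]
    simp [ThetaSlice.top, Slice.top]
  | tail z₁ z₂ =>
    have := (ThetaSlice.tail z₁.length).step_append (l₁ := z₁.map strand) (m := [])
      (z₂.map strand) (by simp [ThetaSlice.pos]) rfl
    simp only [List.map_append, List.append_nil] at this ⊢
    rw [this]
    rfl
  | head z₁ z₂ x₀ x₁ x₂ b₀ b₁ b₂ =>
    have := (ThetaSlice.head z₁.length).step_append (l₁ := z₁.map strand)
      (m := [(0, true), (1, true), (2, true)]) (z₂.map strand) (by simp [ThetaSlice.pos]) rfl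
    simp only [List.map_append, List.map_cons, List.map_nil, this]
    simp [ThetaSlice.top]

theorem openArc_append (s₁ s₂ : List ℕ) : openArc s₁.length (s₁ ++ s₂) =
    s₁ ++ [(s₁ ++ s₂).foldr max 0 + 1, (s₁ ++ s₂).foldr max 0 + 1] ++ s₂ := by
  simp [openArc]

theorem joinArcs_append (s₁ s₂ : List ℕ) (x y : ℕ) :
    joinArcs s₁.length (s₁ ++ [x, y] ++ s₂) =
      (s₁ ++ s₂).map fun v => if y = v then x else v := by
  simp [joinArcs, List.drop_append]

theorem swapAt_append (s₁ s₂ : List ℕ) (x y : ℕ) :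
    swapAt s₁.length (s₁ ++ [x, y] ++ s₂) = s₁ ++ [y, x] ++ s₂ := by
  simp [swapAt, List.drop_append]

theorem Next.noClosedLoop {s : ThetaSlice} {z z' : List Entry} (h : Next s z z')
    {w : List ThetaSlice} (hw : NoClosedLoop (s :: w) (z.map arc)) :
    NoClosedLoop w (z'.map arc) := by
  cases h with
  | cup z₁ z₂ a up b =>
    have := openArc_append (z₁.map arc) (z₂.map arc)
    rw [List.length_map] at this
    rw [NoClosedLoop, List.map_append, this] at hw
    simpa [fresh] using hw
  | cap z₁ z₂ a up b x y =>
    have := joinArcs_append (z₁.map arc) (z₂.map arc) x y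
    rw [List.length_map] at this
    rw [NoClosedLoop, List.map_append, List.map_append, List.map_cons, List.map_cons,
      List.map_nil, this] at hw
    simpa [relabel, Function.comp_def] using hw.2
  | cross z₁ z₂ p q ov =>
    have := swapAt_append (z₁.map arc) (z₂.map arc) p.arc q.arc
    rw [List.length_map] at this
    rw [NoClosedLoop, List.map_append, List.map_append, List.map_cons, List.map_cons,
      List.map_nil, this] at hw
    simpa using hw
  | tail z₁ z₂ => simpa [NoClosedLoop, fresh] using hw
  | head z₁ z₂ x₀ x₁ x₂ b₀ b₁ b₂ =>
    have e : List.drop (z₁.length + 3) (z₁.map arc) = [] := List.drop_eq_nil_of_le (by simp)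
    simpa [NoClosedLoop, List.drop_append, e] using hw

end Entry

namespace TemperleyLieb

variable {K : Type} [Field K] {A : K} {R : Type} [Ring R] [Algebra K R] (T : TemperleyLieb A R)

open Entry

/-- The idempotents belonging to a list of entries. -/
def entryProj (c : Fin 3 → Bool) (z : List Entry) : R := T.projs (z.map (color c)) 0

/-- The decomposition `1 = P + Q` is inserted on one side of the minimum; sliding the idempotent
around the minimum puts the same one on the other side. One of the two terms is good, the other one
bad. -/
theorem entryProj_mul_bandCup (c : Fin 3 → Bool) (z₁ z₂ : List Entry) (a : Fin 3) (up : Bool)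
    (x : ℕ) :
    T.entryProj c (z₁ ++ z₂) * T.bandCup (2 * z₁.length) =
      T.bandCup (2 * z₁.length) * T.entryProj c (z₁ ++ [⟨(a, up), x, false⟩,
        ⟨(a, !up), x, false⟩] ++ z₂) +
      T.bandCup (2 * z₁.length) * T.entryProj c (z₁ ++ [⟨(a, up), x, true⟩,
        ⟨(a, !up), x, true⟩] ++ z₂) := by
  have key (γ : Bool) := (block_bandAt (T := T) (.cup 0 () true)).projs_mul_of_ins_eq_zero
    (z₁.map (color c)) [γ, γ] (z₂.map (color c)) rfl
  simp only [bandAt, List.length_map] at key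
  have h : T.bandCup (2 * z₁.length) = T.bandCup (2 * z₁.length) * T.projs [c a, c a] z₁.length +
      T.bandCup (2 * z₁.length) * T.projs [!(c a), !(c a)] z₁.length := by
    rw [bandCup_mul_projs, bandCup_mul_projs, ← mul_add]
    have := T.proj_true_add_proj_false (2 * z₁.length)
    cases c a
    · rw [Bool.not_false, add_comm (T.proj false _), this, mul_one]
    · rw [Bool.not_true, this, mul_one]
  conv_lhs => rw [h, mul_add]
  simp only [entryProj, List.map_append, List.map_cons, List.map_nil, color, Bool.xor_false,
    Bool.xor_true] at key ⊢
  rw [key, key]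

/-- An element vanishes if it vanishes after each possible effect of the first slice. -/
theorem entryProj_mul_colored_cons (c : Fin 3 → Bool) (s : ThetaSlice) (w : List ThetaSlice)
    (z : List Entry) (hs : s.Valid (z.map strand))
    (h : ∀ z', Next s z z' → T.entryProj c z' * T.colored c w = 0) :
    T.entryProj c z * T.colored c (s :: w) = 0 := by
  have hl := hs.le
  rw [List.length_map] at hl
  obtain ⟨z₁, m, z₂, rfl, h₁, hm⟩ := exists_append hl
  rw [colored_cons, coloredSlice]
  match s, hs, h₁, hm, h with
  | .strand (.cup i a up), hs, h₁, hm, h =>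
    obtain rfl : m = [] := List.eq_nil_of_length_eq_zero hm
    obtain rfl : z₁.length = i := h₁
    rw [List.append_nil] at h ⊢
    simp only [thetaAt, bandAt, tailProj, ThetaSlice.pos, Slice.pos, mul_one]
    rw [← mul_assoc, T.entryProj_mul_bandCup c z₁ z₂ a up (fresh (z₁ ++ z₂) + 1), add_mul,
      mul_assoc, mul_assoc, h _ (.cup z₁ z₂ a up false), h _ (.cup z₁ z₂ a up true)]
    simp
  | .strand (.cap i), hs, h₁, hm, h =>
    obtain rfl : z₁.length = i := h₁
    match m, hm with
    | [⟨(a, up), x, b⟩, ⟨(a', up'), y, b'⟩], _ =>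
      obtain ⟨a₀, up₀, hs⟩ := hs
      simp at hs
      obtain ⟨⟨rfl, rfl⟩, rfl, rfl⟩ := hs
      have key := (block_bandAt (T := T) (.cap 0 : Slice Unit)).projs_mul_of_outs_eq_zero
        (z₁.map (color c)) [xor (c a') b, xor (c a') b'] (z₂.map (color c)) rfl
      simp only [bandAt, List.length_map] at key
      simp only [thetaAt, bandAt, tailProj, ThetaSlice.pos, Slice.pos, mul_one]
      rw [← mul_assoc, entryProj, List.map_append, List.map_append, List.map_cons, List.map_cons,
        List.map_nil]
      simp only [color] at key ⊢
      rw [key]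
      -- If just one of the two joined strands is bad, complementary idempotents of one band meet at
      -- the maximum and the product is zero.
      by_cases hb : b = b'
      · subst hb
        have := h _ (.cap z₁ z₂ a' up b x y)
        rw [entryProj, List.map_map] at this
        have e : color c ∘ relabel x y = color c := rfl
        rw [e, List.map_append] at this
        rw [mul_assoc, this, mul_zero]
      · rw [T.projs_mul_bandCap_of_ne (by simpa using hb), zero_mul, zero_mul]
  | .strand (.cross i ov), hs, h₁, hm, h =>
    obtain rfl : z₁.length = i := h₁
    match m, hm with
    | [p, q], _ =>
      have key := (block_bandAt (T := T) (.cross 0 ov : Slice Unit)).projs_comm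
        (z₁.map (color c)) [p.color c, q.color c] [q.color c, p.color c] (z₂.map (color c)) rfl
        rfl (T.projs_mul_bandCross _ _ _ _)
      simp only [bandAt, List.length_map] at key
      have := h _ (.cross z₁ z₂ p q ov)
      simp only [thetaAt, bandAt, tailProj, ThetaSlice.pos, Slice.pos, mul_one]
      simp only [entryProj, List.map_append, List.map_cons, List.map_nil] at this ⊢
      rw [← mul_assoc, key, mul_assoc, this, mul_zero]
  | .tail i, hs, h₁, hm, h =>
    obtain rfl : m = [] := List.eq_nil_of_length_eq_zero hm
    obtain rfl : z₁.length = i := h₁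
    rw [List.append_nil] at h ⊢
    have key := (block_thetaAt (T := T) (.tail 0)).projs_mul_of_ins_eq_zero
      (z₁.map (color c)) [c 0, c 1, c 2] (z₂.map (color c)) rfl
    have := h _ (.tail z₁ z₂)
    simp only [List.length_map, thetaAt] at key
    simp only [thetaAt, tailProj, ThetaSlice.pos]
    simp only [entryProj, List.map_append, List.map_cons, List.map_nil, color, Bool.xor_false]
      at this key ⊢
    rw [← mul_assoc, key, mul_assoc, this, mul_zero]
  | .head i, hs, h₁, hm, h =>
    obtain rfl : z₁.length = i := h₁
    match m, hm with
    | [⟨p₀, x₀, b₀⟩, ⟨p₁, x₁, b₁⟩, ⟨p₂, x₂, b₂⟩], _ =>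
      simp [ThetaSlice.Valid] at hs
      obtain ⟨rfl, rfl, rfl⟩ := hs
      have key := (block_thetaAt (T := T) (.head 0)).projs_mul_of_outs_eq_zero
        (z₁.map (color c)) [xor (c 0) b₀, xor (c 1) b₁, xor (c 2) b₂] (z₂.map (color c)) rfl
      simp only [thetaAt, List.length_map] at key
      simp only [thetaAt, tailProj, ThetaSlice.pos, mul_one]
      have := h _ (.head z₁ z₂ x₀ x₁ x₂ b₀ b₁ b₂)
      simp only [entryProj, List.map_append, List.map_cons, List.map_nil, color] at this key ⊢
      rw [← mul_assoc, key, mul_assoc, this, mul_zero]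

end TemperleyLieb
end ThetaCurve

namespace ThetaCurve
namespace Entry

/-- The signed number of bad strands of the edge `k`. -/
def excess (k : Fin 3) (z : List Entry) : ℤ := (z.map (charge k)).sum

/-- The bad strands belong to arcs with two ends and without good ends. -/
def Paired (z : List Entry) : Prop :=
  ∀ e ∈ z, e.bad = true →
    (z.map arc).count e.arc = 2 ∧ ∀ e' ∈ z, e'.arc = e.arc → e'.bad = true

theorem excess_append (k : Fin 3) (z z' : List Entry) :
    excess k (z ++ z') = excess k z + excess k z' := by simp [excess]

theorem charge_add_charge (k a : Fin 3) (up b : Bool) (x y : ℕ) :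
    charge k ⟨(a, up), x, b⟩ + charge k ⟨(a, !up), y, b⟩ = 0 := by
  unfold charge
  cases up <;> split_ifs <;> simp_all

/-- Local extrema create or destroy two strands of equal badness and opposite directions, and
strands born at `v₁` are good. So `v₂` is the only place where the count can change. -/
theorem Next.excess_eq {s : ThetaSlice} {z z' : List Entry} (h : Next s z z')
    (hs : s.isHead = false) (k : Fin 3) : excess k z' = excess k z := by
  cases h with
  | cup z₁ z₂ a up b =>
    have := charge_add_charge k a up b (fresh (z₁ ++ z₂) + 1) (fresh (z₁ ++ z₂) + 1)
    simp only [excess, List.map_append, List.map_cons, List.map_nil, List.sum_append, List.sum_cons,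
      List.sum_nil]
    omega
  | cap z₁ z₂ a up b x y =>
    have := charge_add_charge k a up b x y
    have e : charge k ∘ relabel x y = charge k := rfl
    simp only [excess, List.map_append, List.map_cons, List.map_nil, List.sum_append, List.sum_cons,
      List.sum_nil, List.map_map, e]
    omega
  | cross z₁ z₂ p q ov =>
    simp only [excess, List.map_append, List.map_cons, List.map_nil, List.sum_append, List.sum_cons,
      List.sum_nil]
    omega
  | tail z₁ z₂ =>
    simp [excess, charge]
  | head z₁ z₂ x₀ x₁ x₂ b₀ b₁ b₂ => simp [ThetaSlice.isHead] at hs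

theorem le_fresh {z : List Entry} {e : Entry} (h : e ∈ z) : e.arc ≤ fresh z :=
  le_foldr_max (List.mem_map_of_mem h)

theorem Paired.perm {z z' : List Entry} (h : Paired z) (hz : z.Perm z') : Paired z' := by
  intro e he hb
  obtain ⟨h₁, h₂⟩ := h e (hz.mem_iff.2 he) hb
  refine ⟨?_, fun e' he' => h₂ e' (hz.mem_iff.2 he')⟩
  rw [← h₁]
  exact ((hz.map arc).count_eq _).symm

theorem Paired.insert {z₁ m z₂ : List Entry} (h : Paired (z₁ ++ z₂))
    (hm : ∀ e ∈ m, fresh (z₁ ++ z₂) < e.arc) (hm' : Paired m) : Paired (z₁ ++ m ++ z₂) := by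
  have hp : (z₁ ++ m ++ z₂).Perm (m ++ (z₁ ++ z₂)) := by
    rw [← List.append_assoc]
    exact (List.perm_append_comm).append_right z₂
  refine Paired.perm ?_ hp.symm
  generalize z₁ ++ z₂ = z at *
  intro e he hb
  rcases List.mem_append.1 he with he | he
  · obtain ⟨h₁, h₂⟩ := hm' e he hb
    have h₀ : (z.map arc).count e.arc = 0 := by
      rw [List.count_eq_zero]
      intro hmem
      obtain ⟨e', he', h'⟩ := List.mem_map.1 hmem
      have := le_fresh he'
      have := hm e he
      omega
    refine ⟨by rw [List.map_append, List.count_append, h₁, h₀], fun e' he' h' => ?_⟩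
    rcases List.mem_append.1 he' with he' | he'
    · exact h₂ e' he' h'
    · have := le_fresh he'
      have := hm e he
      omega
  · obtain ⟨h₁, h₂⟩ := h e he hb
    have h₀ : (m.map arc).count e.arc = 0 := by
      rw [List.count_eq_zero]
      intro hmem
      obtain ⟨e', he', h'⟩ := List.mem_map.1 hmem
      have := le_fresh he
      have := hm e' he'
      omega
    refine ⟨by rw [List.map_append, List.count_append, h₁, h₀], fun e' he' h' => ?_⟩
    rcases List.mem_append.1 he' with he' | he'
    · have := le_fresh he
      have := hm e' he'
      omega
    · exact h₂ e' he' h'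

theorem Paired.delete {m z : List Entry} (h : Paired (m ++ z)) (hm : ∀ e ∈ m, e.bad = false) :
    Paired z := by
  intro e he hb
  obtain ⟨h₁, h₂⟩ := h e (List.mem_append_right m he) hb
  have h₀ : (m.map arc).count e.arc = 0 := by
    rw [List.count_eq_zero]
    intro hmem
    obtain ⟨e', he', h'⟩ := List.mem_map.1 hmem
    have := h₂ e' (List.mem_append_left z he') h'
    rw [hm e' he'] at this
    simp at this
  rw [List.map_append, List.count_append, h₀, zero_add] at h₁
  exact ⟨h₁, fun e' he' => h₂ e' (List.mem_append_right m he')⟩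

theorem count_relabel {x y : ℕ} (hxy : x ≠ y) (s : List ℕ) (v : ℕ) :
    (s.map fun u => if y = u then x else u).count v =
      if v = x then s.count x + s.count y else if v = y then 0 else s.count v := by
  induction s with
  | nil => simp
  | cons u s ih =>
    rw [List.map_cons, List.count_cons, ih]
    simp only [List.count_cons, beq_iff_eq]
    split_ifs <;> omega

/-- A maximum joining two different bad arcs produces one bad arc, which keeps the other end of
each; joining good arcs does not touch bad ones. If the arcs coincided, a closed loop would be
completed and the bad arc could disappear. -/
theorem Paired.join {p q : Entry} {z : List Entry} (h : Paired (p :: q :: z))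
    (hpq : p.arc ≠ q.arc) (hb : p.bad = q.bad) : Paired (z.map (relabel p.arc q.arc)) := by
  have ha : (z.map (relabel p.arc q.arc)).map arc =
      (z.map arc).map fun u => if q.arc = u then p.arc else u := by
    simp [Function.comp_def, relabel]
  by_cases hp : p.bad = true
  · have hq : q.bad = true := hb ▸ hp
    obtain ⟨p₁, p₂⟩ := h p (by simp) hp
    obtain ⟨q₁, q₂⟩ := h q (by simp) hq
    simp only [List.map_cons, List.count_cons, beq_iff_eq, if_true, hpq, hpq.symm, if_false] at p₁ q₁
    intro e he hbe
    obtain ⟨e₀, he₀, rfl⟩ := List.mem_map.1 he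
    obtain ⟨h₁, h₂⟩ := h e₀ (by simp [he₀]) hbe
    by_cases hx : (relabel p.arc q.arc e₀).arc = p.arc
    · refine ⟨by rw [ha, count_relabel hpq, if_pos hx]; omega, fun e' he' h' => ?_⟩
      obtain ⟨e₁, he₁, rfl⟩ := List.mem_map.1 he'
      rw [hx] at h'
      simp only [relabel] at h'
      split_ifs at h' with hh
      · exact q₂ e₁ (by simp [he₁]) hh.symm
      · exact p₂ e₁ (by simp [he₁]) h'
    · have hx' : q.arc ≠ e₀.arc := fun h => hx (by simp [relabel, h])
      have hr : (relabel p.arc q.arc e₀).arc = e₀.arc := by simp [relabel, hx']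
      rw [hr] at hx ⊢
      refine ⟨?_, fun e' he' h' => ?_⟩
      · rw [ha, count_relabel hpq, if_neg hx, if_neg hx'.symm]
        simpa [List.count_cons, hx', Ne.symm hx] using h₁
      · obtain ⟨e₁, he₁, rfl⟩ := List.mem_map.1 he'
        simp only [relabel] at h'
        split_ifs at h' with hh
        · exact absurd h'.symm hx
        · exact h₂ e₁ (by simp [he₁]) h'
  · have hp : p.bad = false := by simpa using hp
    have hq : q.bad = false := hb ▸ hp
    intro e he hbe
    obtain ⟨e₀, he₀, rfl⟩ := List.mem_map.1 he
    obtain ⟨h₁, h₂⟩ := h e₀ (by simp [he₀]) hbe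
    have hp' : p.arc ≠ e₀.arc := fun h' => by simpa [hp] using h₂ p (by simp) h'
    have hq' : q.arc ≠ e₀.arc := fun h' => by simpa [hq] using h₂ q (by simp) h'
    have hr : (relabel p.arc q.arc e₀).arc = e₀.arc := by simp [relabel, hq']
    rw [hr]
    refine ⟨?_, fun e' he' h' => ?_⟩
    · rw [ha, count_relabel hpq, if_neg hp'.symm, if_neg hq'.symm]
      simpa [List.count_cons, hp', hq'] using h₁
    · obtain ⟨e₁, he₁, rfl⟩ := List.mem_map.1 he'
      simp only [relabel] at h'
      split_ifs at h' with hh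
      · exact absurd h' hp'
      · exact h₂ e₁ (by simp [he₁]) h'

theorem perm_middle (z₁ m z₂ : List Entry) : (z₁ ++ m ++ z₂).Perm (m ++ (z₁ ++ z₂)) := by
  rw [← List.append_assoc]
  exact (List.perm_append_comm).append_right z₂

theorem paired_of_good {m : List Entry} (h : ∀ e ∈ m, e.bad = false) : Paired m := by
  intro e he hb
  rw [h e he] at hb
  simp at hb

theorem paired_pair (p q : Fin 3 × Bool) (x : ℕ) (b : Bool) : Paired [⟨p, x, b⟩, ⟨q, x, b⟩] := by
  intro e he hb
  simp only [List.mem_cons, List.not_mem_nil, or_false] at he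
  rcases he with rfl | rfl <;> simp_all

/-- Arcs of bad strands stay alive. -/
theorem Next.paired {s : ThetaSlice} {z z' : List Entry} (h : Next s z z')
    {w : List ThetaSlice} (hw : NoClosedLoop (s :: w) (z.map arc)) (hz : Paired z)
    (hb : ∃ e ∈ z, e.bad = true) (hd : s.isHead = true → ∀ k, excess k z' = excess k z) :
    Paired z' ∧ ∃ e ∈ z', e.bad = true := by
  cases h with
  | cup z₁ z₂ a up b =>
    refine ⟨hz.insert (by simp) (paired_pair _ _ _ _), ?_⟩
    obtain ⟨e, he, hb⟩ := hb
    exact ⟨e, by simp only [List.mem_append] at he ⊢; tauto, hb⟩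
  | cap z₁ z₂ a up b x y =>
    have hz' := hz.perm (perm_middle _ _ _)
    have hxy : x ≠ y := by
      have := hw.1
      simpa [SameArc] using this
    refine ⟨hz'.join hxy rfl, ?_⟩
    obtain ⟨e, he, he'⟩ := hb
    rw [(perm_middle _ _ _).mem_iff] at he
    have key : ∃ e ∈ z₁ ++ z₂, e.bad = true := by
      rcases List.mem_append.1 he with he | he
      · have hb : b = true := by
          simp only [List.mem_cons, List.not_mem_nil, or_false] at he
          rcases he with rfl | rfl <;> exact he'
        obtain ⟨h₁, h₂⟩ := hz' ⟨(a, up), x, b⟩ (by simp) hb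
        have hc : ((z₁ ++ z₂).map arc).count x ≠ 0 := by
          simp only [List.cons_append, List.nil_append, List.map_cons, List.count_cons, beq_iff_eq,
            if_true, hxy.symm, if_false] at h₁
          omega
        rw [Ne, List.count_eq_zero, not_not] at hc
        obtain ⟨e₁, he₁, h'⟩ := List.mem_map.1 hc
        exact ⟨e₁, he₁, h₂ e₁ (List.mem_append_right _ he₁) h'⟩
      · exact ⟨e, he, he'⟩
    obtain ⟨e, he, he'⟩ := key
    exact ⟨relabel x y e, List.mem_map_of_mem he, he'⟩
  | cross z₁ z₂ p q ov =>
    have hp : (z₁ ++ [p, q] ++ z₂).Perm (z₁ ++ [q, p] ++ z₂) :=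
      ((List.Perm.swap q p []).append_left z₁).append_right z₂
    obtain ⟨e, he, hb⟩ := hb
    exact ⟨hz.perm hp, e, hp.mem_iff.1 he, hb⟩
  | tail z₁ z₂ =>
    refine ⟨hz.insert ?_ (paired_of_good (by simp)), ?_⟩
    · intro e he
      simp only [List.mem_cons, List.not_mem_nil, or_false] at he
      rcases he with rfl | rfl | rfl <;> simp only <;> omega
    · obtain ⟨e, he, hb⟩ := hb
      exact ⟨e, by simp only [List.mem_append] at he ⊢; tauto, hb⟩
  | head z₁ z₂ x₀ x₁ x₂ b₀ b₁ b₂ =>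
    have hd := hd rfl
    -- The three strands at `v₂` are directed upwards and lie on different edges, so nothing can
    -- cancel: if no excess changes, all three are good.
    have hgood : ∀ e ∈ [(⟨(0, true), x₀, b₀⟩ : Entry), ⟨(1, true), x₁, b₁⟩, ⟨(2, true), x₂, b₂⟩],
        e.bad = false := by
      have h₀ := hd 0
      have h₁ := hd 1
      have h₂ := hd 2
      simp only [excess_append] at h₀ h₁ h₂
      simp [excess, charge] at h₀ h₁ h₂
      simp [h₀, h₁, h₂]
    obtain ⟨e, he, hb⟩ := hb
    rw [(perm_middle _ _ _).mem_iff] at he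
    refine ⟨(hz.perm (perm_middle _ _ _)).delete hgood, ?_⟩
    rcases List.mem_append.1 he with he | he
    · rw [hgood e he] at hb
      simp at hb
    · exact ⟨e, he, hb⟩

end Entry

namespace TemperleyLieb

variable {K : Type} [Field K] {A : K} {R : Type} [Ring R] [Algebra K R] (T : TemperleyLieb A R)

open Entry

/-- Without a vertex `v₂`, bad strands cannot end. -/
theorem entryProj_mul_colored_of_excess_ne_zero (c : Fin 3 → Bool) (k : Fin 3)
    (w : List ThetaSlice) (z : List Entry) (hw : ThetaClosesFrom w (z.map strand))
    (hh : w.countP ThetaSlice.isHead = 0) (hz : excess k z ≠ 0) :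
    T.entryProj c z * T.colored c w = 0 := by
  induction w generalizing z with
  | nil =>
    have : z = [] := by simpa [ThetaClosesFrom] using hw
    simp [this, excess] at hz
  | cons s w ih =>
    rw [List.countP_cons] at hh
    have hs : s.isHead = false := by
      by_contra h
      simp [h] at hh
    refine T.entryProj_mul_colored_cons c s w z hw.1 fun z' h => ih z' ?_ (by omega) ?_
    · rw [h.level]
      exact hw.2
    · rwa [h.excess_eq hs]

/-- A strand with the wrong idempotent makes a diagram without closed loops vanish. -/
theorem entryProj_mul_colored_of_bad (c : Fin 3 → Bool)
    (w : List ThetaSlice) (z : List Entry) (hw : ThetaClosesFrom w (z.map strand))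
    (hl : NoClosedLoop w (z.map arc)) (hh : w.countP ThetaSlice.isHead ≤ 1)
    (hp : Paired z) (hz : ∀ k, excess k z = 0) (hb : ∃ e ∈ z, e.bad = true) :
    T.entryProj c z * T.colored c w = 0 := by
  induction w generalizing z with
  | nil =>
    have : z = [] := by simpa [ThetaClosesFrom] using hw
    simp [this] at hb
  | cons s w ih =>
    rw [List.countP_cons] at hh
    refine T.entryProj_mul_colored_cons c s w z hw.1 fun z' h => ?_
    have hw' : ThetaClosesFrom w (z'.map strand) := by
      rw [h.level]
      exact hw.2
    -- As long as the excess vanishes, bad arcs stay alive, which is impossible at the empty final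
    -- level. If it becomes nonzero, the slice is `v₂`; no vertex `v₂` follows, and the excess can
    -- never return to zero.
    by_cases hz' : ∀ k, excess k z' = 0
    · obtain ⟨h₁, h₂⟩ := h.paired hl hp hb fun _ k => by rw [hz', hz]
      exact ih z' hw' (h.noClosedLoop hl) (by split_ifs at hh <;> omega) h₁ hz' h₂
    · push Not at hz'
      obtain ⟨k, hk⟩ := hz'
      refine T.entryProj_mul_colored_of_excess_ne_zero c k w z' hw' ?_ hk
      by_cases hs : s.isHead = true
      · simp only [hs, if_true] at hh
        omega
      · rw [h.excess_eq (by simpa using hs), hz] at hk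
        exact absurd rfl hk

theorem entryProj_of_good (c : Fin 3 → Bool) {z : List Entry} (hz : ∀ e ∈ z, e.bad = false) :
    T.entryProj c z = T.levelProj c (z.map strand) := by
  rw [entryProj, levelProj, List.map_map]
  congr 1
  refine List.map_congr_left fun e he => ?_
  simp [color, hz e he]

theorem excess_of_good {z : List Entry} (hz : ∀ e ∈ z, e.bad = false) (k : Fin 3) :
    excess k z = 0 := by
  rw [excess, List.sum_eq_zero]
  intro x hx
  obtain ⟨e, he, rfl⟩ := List.mem_map.1 hx
  simp [charge, hz e he]

theorem levelProj_mul_colored_cons (c : Fin 3 → Bool) (s : ThetaSlice) (w : List ThetaSlice)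
    {z z' : List Entry} (hz' : T.levelProj c (z'.map strand) * T.colored c w =
      T.allColored c w (z'.map strand)) (hn : Next s z z')
    (h : T.levelProj c (z.map strand) * (T.thetaAt s (2 * s.pos) *
      T.levelProj c (z'.map strand) * T.colored c w) =
        T.levelProj c (z.map strand) * T.colored c (s :: w)) :
    T.levelProj c (z.map strand) * T.colored c (s :: w) = T.allColored c (s :: w) (z.map strand) := by
  rw [← h, allColored, ← hn.level, ← hz', mul_assoc (T.thetaAt s _)]

/-- In a diagram without closed loops, idempotents next to the vertex `v₁` propagate along the
edges. -/
theorem levelProj_mul_colored (c : Fin 3 → Bool) (w : List ThetaSlice) (z : List Entry)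
    (hw : ThetaClosesFrom w (z.map strand)) (hl : NoClosedLoop w (z.map arc))
    (hh : w.countP ThetaSlice.isHead ≤ 1) (hz : ∀ e ∈ z, e.bad = false) :
    T.levelProj c (z.map strand) * T.colored c w = T.allColored c w (z.map strand) := by
  induction w generalizing z with
  | nil => simp [colored, allColored]
  | cons s w ih =>
    have hh' : w.countP ThetaSlice.isHead ≤ 1 := by
      rw [List.countP_cons] at hh
      omega
    have hs := hw.1
    have ih' : ∀ z', Next s z z' → (∀ e ∈ z', e.bad = false) →
        T.levelProj c (z'.map strand) * T.colored c w = T.allColored c w (z'.map strand) :=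
      fun z' hn hg => ih z' (hn.level ▸ hw.2) (hn.noClosedLoop hl) hh' hg
    have hi := hs.le
    rw [List.length_map] at hi
    obtain ⟨z₁, m, z₂, rfl, h₁, hm⟩ := exists_append hi
    have hg : ∀ e ∈ z₁ ++ z₂, e.bad = false := fun e he => hz e (by
      simp only [List.mem_append] at he ⊢
      tauto)
    match s, hs, h₁, hm, ih' with
    | .strand (.cup i a up), hs, h₁, hm, ih' =>
      obtain rfl : m = [] := List.eq_nil_of_length_eq_zero hm
      obtain rfl : z₁.length = i := h₁
      rw [List.append_nil] at ih' hw hl ⊢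
      have hn := Next.cup z₁ z₂ a up false
      have hb := Next.cup z₁ z₂ a up true
      have hg' : ∀ e ∈ z₁ ++ [⟨(a, up), fresh (z₁ ++ z₂) + 1, false⟩,
          ⟨(a, !up), fresh (z₁ ++ z₂) + 1, false⟩] ++ z₂, e.bad = false := by
        intro e he
        simp only [List.mem_append, List.mem_cons, List.not_mem_nil, or_false] at he hg
        rcases he with (he | rfl | rfl) | he
        · exact hg e (.inl he)
        · rfl
        · rfl
        · exact hg e (.inr he)
      -- The complementary colour of the new arc contributes nothing, so the minimum carries the
      -- prescribed colour of its edge without being told so. This is where the absence of closed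
      -- components enters.
      have hbad := T.entryProj_mul_colored_of_bad c w _ (hb.level ▸ hw.2) (hb.noClosedLoop hl) hh'
        ((paired_of_good hg).insert (by simp) (paired_pair _ _ _ _))
        (fun k => by rw [hb.excess_eq rfl, excess_of_good hg])
        ⟨⟨(a, up), fresh (z₁ ++ z₂) + 1, true⟩, by simp, rfl⟩
      refine T.levelProj_mul_colored_cons c _ w (ih' _ hn hg') hn ?_
      have key := (block_bandAt (T := T) (.cup 0 () true)).projs_mul_projs
        (z₁.map (color c)) [] [c a, c a] (z₂.map (color c)) rfl rfl
      rw [List.append_nil, (block_bandAt (T := T) (.cup 0 () true)).projs_mul_of_ins_eq_zero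
        (z₁.map (color c)) [c a, c a] (z₂.map (color c)) rfl] at key
      rw [← T.entryProj_of_good c hg, ← T.entryProj_of_good c hg', colored_cons, coloredSlice]
      simp only [thetaAt, bandAt, tailProj, ThetaSlice.pos, Slice.pos, mul_one]
      rw [← mul_assoc _ _ (T.colored c w), ← mul_assoc _ _ (T.colored c w),
        T.entryProj_mul_bandCup c z₁ z₂ a up (fresh (z₁ ++ z₂) + 1), add_mul,
        mul_assoc (T.bandCup _) _ (T.colored c w), mul_assoc (T.bandCup _) _ (T.colored c w), hbad,
        mul_zero, add_zero]
      simp only [bandAt, List.length_map] at key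
      simp only [entryProj, List.map_append, List.map_cons, List.map_nil, color,
        Bool.xor_false] at key ⊢
      rw [key, mul_assoc]
    | .strand (.cap i), hs, h₁, hm, ih' =>
      obtain rfl : z₁.length = i := h₁
      match m, hm with
      | [⟨(a, up), x, b⟩, ⟨(a', up'), y, b'⟩], _ =>
        obtain ⟨a₀, up₀, hs⟩ := hs
        simp at hs
        obtain ⟨⟨rfl, rfl⟩, rfl, rfl⟩ := hs
        obtain rfl : b = false := hz ⟨(a', up), x, b⟩ (by simp)
        obtain rfl : b' = false := hz ⟨(a', !up), y, b'⟩ (by simp)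
        have hn := Next.cap z₁ z₂ a' up false x y
        have hg' : ∀ e ∈ (z₁ ++ z₂).map (relabel x y), e.bad = false := by
          intro e he
          obtain ⟨e', he', rfl⟩ := List.mem_map.1 he
          exact hg e' he'
        refine T.levelProj_mul_colored_cons c _ w (ih' _ hn hg') hn ?_
        rw [colored_cons, ← mul_assoc _ _ (T.colored c w), ← mul_assoc _ _ (T.colored c w),
          coloredSlice]
        congr 1
        have key := (block_bandAt (T := T) (.cap 0 : Slice Unit)).projs_mul_projs
          (z₁.map (color c)) [c a', c a'] [] (z₂.map (color c)) rfl rfl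
        have e : color c ∘ relabel x y = color c := rfl
        rw [← T.entryProj_of_good c hz, ← T.entryProj_of_good c hg']
        simp only [bandAt, List.length_map, List.append_nil] at key
        simp only [thetaAt, bandAt, tailProj, ThetaSlice.pos, Slice.pos, mul_one]
        simp only [entryProj, List.map_append, List.map_cons, List.map_nil, List.map_map, e, color,
          Bool.xor_false, projs, mul_one] at key ⊢
        exact key
    | .strand (.cross i ov), hs, h₁, hm, ih' =>
      obtain rfl : z₁.length = i := h₁
      match m, hm with
      | [p, q], _ =>
        have hn := Next.cross z₁ z₂ p q ov
        have hg' : ∀ e ∈ z₁ ++ [q, p] ++ z₂, e.bad = false := by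
          intro e he
          refine hz e ?_
          simp only [List.mem_append, List.mem_cons, List.not_mem_nil, or_false] at he ⊢
          tauto
        refine T.levelProj_mul_colored_cons c _ w (ih' _ hn hg') hn ?_
        rw [colored_cons, ← mul_assoc _ _ (T.colored c w), ← mul_assoc _ _ (T.colored c w),
          coloredSlice]
        congr 1
        have key := (block_bandAt (T := T) (.cross 0 ov : Slice Unit)).projs_comm
          (z₁.map (color c)) [p.color c, q.color c] [q.color c, p.color c] (z₂.map (color c)) rfl
          rfl (T.projs_mul_bandCross _ _ _ _)
        rw [← T.entryProj_of_good c hz, ← T.entryProj_of_good c hg']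
        simp only [bandAt, List.length_map] at key
        simp only [thetaAt, bandAt, tailProj, ThetaSlice.pos, Slice.pos, mul_one]
        simp only [entryProj, List.map_append, List.map_cons, List.map_nil] at key ⊢
        rw [← key, ← mul_assoc, projs_mul_self]
    | .tail i, hs, h₁, hm, ih' =>
      obtain rfl : m = [] := List.eq_nil_of_length_eq_zero hm
      obtain rfl : z₁.length = i := h₁
      rw [List.append_nil] at ih' hw hl ⊢
      have hn := Next.tail z₁ z₂
      have hg' : ∀ e ∈ z₁ ++ [⟨(0, true), fresh (z₁ ++ z₂) + 1, false⟩,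
          ⟨(1, true), fresh (z₁ ++ z₂) + 2, false⟩,
          ⟨(2, true), fresh (z₁ ++ z₂) + 3, false⟩] ++ z₂, e.bad = false := by
        intro e he
        simp only [List.mem_append, List.mem_cons, List.not_mem_nil, or_false] at he hg
        rcases he with (he | rfl | rfl | rfl) | he
        · exact hg e (.inl he)
        · rfl
        · rfl
        · rfl
        · exact hg e (.inr he)
      refine T.levelProj_mul_colored_cons c _ w (ih' _ hn hg') hn ?_
      rw [colored_cons, ← mul_assoc _ _ (T.colored c w), ← mul_assoc _ _ (T.colored c w),
        coloredSlice]
      congr 1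
      have key := (block_thetaAt (T := T) (.tail 0)).projs_mul_projs
        (z₁.map (color c)) [] [c 0, c 1, c 2] (z₂.map (color c)) rfl rfl
      rw [← T.entryProj_of_good c hg, ← T.entryProj_of_good c hg']
      simp only [thetaAt, List.length_map, List.append_nil] at key
      simp only [thetaAt, tailProj, ThetaSlice.pos]
      simp only [entryProj, List.map_append, List.map_cons, List.map_nil, color,
        Bool.xor_false] at key ⊢
      exact key
    | .head i, hs, h₁, hm, ih' =>
      obtain rfl : z₁.length = i := h₁
      match m, hm with
      | [⟨p₀, x₀, b₀⟩, ⟨p₁, x₁, b₁⟩, ⟨p₂, x₂, b₂⟩], _ =>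
        simp [ThetaSlice.Valid] at hs
        obtain ⟨rfl, rfl, rfl⟩ := hs
        have hn := Next.head z₁ z₂ x₀ x₁ x₂ b₀ b₁ b₂
        refine T.levelProj_mul_colored_cons c _ w (ih' _ hn hg) hn ?_
        rw [colored_cons, ← mul_assoc _ _ (T.colored c w), ← mul_assoc _ _ (T.colored c w),
          coloredSlice]
        congr 1
        have key := (block_thetaAt (T := T) (.head 0)).projs_mul_projs
          (z₁.map (color c)) [xor (c 0) b₀, xor (c 1) b₁, xor (c 2) b₂] [] (z₂.map (color c)) rfl rfl
        rw [← T.entryProj_of_good c hz, ← T.entryProj_of_good c hg]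
        simp only [thetaAt, List.length_map, List.append_nil] at key
        simp only [thetaAt, tailProj, ThetaSlice.pos, mul_one]
        simp only [entryProj, List.map_append, List.map_cons, List.map_nil, color, projs,
          mul_one] at key ⊢
        exact key

end TemperleyLieb
end ThetaCurve

/-! ### The Jaeger polynomial of a theta-curve, and idempotents at the vertex `v₁`. -/

namespace ThetaCurve
namespace TemperleyLieb

variable {K : Type} [Field K] {A : K} {R : Type} [Ring R] [Algebra K R] (T : TemperleyLieb A R)

open ThetaSlice

theorem fullTwists_zero (i : ℕ) : fullTwists i 0 = [] := rfl

theorem word_bands_zero (s : ThetaSlice) : T.word (s.bands 0) = T.thetaAt s (2 * s.pos) := by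
  cases s with
  | strand s => exact T.word_double _ _ s
  | tail i =>
    simp [bands, fullTwists_zero, word, slice, thetaAt, ThetaSlice.pos, bandTail, mul_assoc]
  | head i => simp [bands, word, slice, thetaAt, ThetaSlice.pos, bandHead, mul_assoc]

theorem barWord_thetaBars (s : ThetaSlice) :
    T.barWord (s.bars.map (.bar : ℕ → BarSlice (Fin 3))) =
      T.projs (List.replicate s.outs true) s.pos := by
  cases s with
  | strand s => exact T.barWord_bars s
  | tail i => simp [barWord, ThetaSlice.bars, barSlice, ThetaSlice.outs, ThetaSlice.pos, projs,
      mul_add]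
  | head i => simp [barWord, ThetaSlice.bars, ThetaSlice.outs, projs]

theorem levelProj_true (l : Level (Fin 3)) :
    T.levelProj (fun _ => true) l = T.fullProj l.length := by
  rw [levelProj, fullProj, List.map_const']

theorem levelProj_mul_barWord {w : List ThetaSlice} {l : Level (Fin 3)}
    (h : ThetaClosesFrom w l) :
    T.levelProj (fun _ => true) l *
      T.barWord (w.flatMap fun s => (s.bands 0).map .strand ++ s.bars.map .bar) =
        T.allColored (fun _ => true) w l := by
  induction w generalizing l with
  | nil => simp [barWord, allColored]
  | cons s w ih =>
    have := ih h.2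
    rw [allColored, ← this, levelProj_true, levelProj_true, s.step_length h.1.le,
      ← mul_assoc (T.thetaAt s _), ← mul_assoc, fullProj_mul_block (block_thetaAt s) h.1.le,
      List.flatMap_cons, barWord_append, barWord_append, barWord_map_strand, word_bands_zero,
      barWord_thetaBars]
    simp only [mul_assoc]

theorem bands_barFits {s : ThetaSlice} {n : ℕ} {w : List (BarSlice (Fin 3))}
    (h : s.pos + s.ins ≤ n) (hw : BarFits w (2 * (n - s.ins + s.outs))) :
    BarFits ((s.bands 0).map .strand ++ s.bars.map .bar ++ w) (2 * n) := by
  rcases s with (_ | _ | _) | _ | _ <;>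
    simp only [bands, Slice.double, ThetaSlice.bars, Slice.bars, ThetaSlice.pos, Slice.pos,
      ThetaSlice.ins, Slice.ins, ThetaSlice.outs, Slice.outs, List.map_cons, Pi.zero_apply,
      fullTwists_zero, List.append_nil, List.map_nil, List.cons_append, List.nil_append, BarFits, Nat.sub_zero] at h hw ⊢
  · refine ⟨by omega, by omega, by omega, by omega, ?_⟩
    convert hw using 1
    omega
  · refine ⟨by omega, by omega, ?_⟩
    convert hw using 1
    omega
  · refine ⟨by omega, by omega, by omega, by omega, by omega, by omega, ?_⟩
    convert hw using 1
    omega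
  · refine ⟨by omega, by omega, by omega, by omega, by omega, by omega, ?_⟩
    convert hw using 1
    omega
  · refine ⟨by omega, by omega, by omega, ?_⟩
    convert hw using 1
    omega

theorem thetaBarDiagram_barFits {w : List ThetaSlice} {l : Level (Fin 3)}
    (h : ThetaClosesFrom w l) :
    BarFits (w.flatMap fun s => (s.bands 0).map .strand ++ s.bars.map .bar) (2 * l.length) := by
  induction w generalizing l with
  | nil =>
    have : l = [] := h
    simp [BarFits, this]
  | cons s w ih =>
    have := ih h.2
    rw [s.step_length h.1.le] at this
    exact bands_barFits h.1.le this

theorem levelProj_nil (c : Fin 3 → Bool) : T.levelProj c [] = 1 := rfl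

/-- In a theta-curve, idempotents next to the vertex `v₁` propagate along the edges. -/
theorem colored_word (c : Fin 3 → Bool) (D : ThetaDiagram) :
    T.colored c D.word = T.allColored c D.word [] := by
  have := T.levelProj_mul_colored c D.word [] D.closes D.no_loop D.one_head.le (by simp)
  simpa [levelProj_nil] using this

/-- The bars on all parts of the diagram are exactly what three bars next to `v₁` propagate to;
hence those three suffice. This puts the bars where the twists of the band link are. -/
theorem jaeger_smul_one (D : ThetaDiagram) :
    (loopValue A * D.jaeger A) • (1 : R) = T.colored (fun _ => true) D.word := by
  rw [ThetaDiagram.jaeger, ThetaDiagram.barDiagram, T.barPolynomial_smul_one _ (thetaBarDiagram_barFits D.closes),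
    colored_word, ← T.levelProj_mul_barWord D.closes, levelProj_nil, one_mul]

/-- When one of the three bands is closed off right at the vertex, the vertex disk becomes part of a
single band, a local minimum joining the other two. -/
theorem bandTail_mul_cap (m : ℕ) {k : ℕ} (hk : k < 3) :
    T.bandTail m * T.cap (m + 2 * k) = T.bandCup m := by
  rw [bandTail, mul_assoc]
  interval_cases k
  · rw [mul_zero, add_zero, show m + 3 = m + 1 + 2 from rfl,
      ← T.cap_cup (show m ≤ m + 1 by omega), mul_assoc, mul_mul_of_eq (T.zigzag_right m), one_mul,
      bandCup]
  · rw [T.zigzag_right (m + 2), mul_one, bandCup]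
  · rw [T.zigzag_left (m + 3), mul_one, bandCup]

theorem cup_mul_bandHead (m : ℕ) {k : ℕ} (hk : k < 3) :
    T.cup (m + 2 * k) * T.bandHead m = T.bandCap m := by
  rw [bandHead]
  simp only [mul_assoc]
  interval_cases k
  · rw [mul_zero, add_zero, show m + 3 = m + 1 + 2 from rfl,
      mul_mul_of_eq_mul (T.cup_cap (show m ≤ m + 1 by omega)),
      mul_mul_of_eq (T.zigzag_left m), one_mul, bandCap]
  · rw [mul_mul_of_eq (T.zigzag_left (m + 2)), one_mul, bandCap]
  · rw [mul_mul_of_eq (T.zigzag_right (m + 3)), one_mul, bandCap]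

theorem bandTail_mul_proj_false (i : ℕ) {k : ℕ} (hk : k < 3) :
    T.bandTail (2 * i) * T.proj false (2 * (i + k)) =
      (loopValue A)⁻¹ • (T.bandCup (2 * i) * T.cup (2 * (i + k))) := by
  rw [proj, if_neg (by simp), mul_smul_comm, hook, ← mul_assoc, mul_add, T.bandTail_mul_cap _ hk]

theorem projs_mul_projs_of_getElem {κ : List Bool} {k : ℕ} {γ : Bool} (h : κ[k]? = some γ) (o : ℕ) :
    T.proj γ (2 * (o + k)) * T.projs κ o = T.projs κ o := by
  induction κ generalizing k o with
  | nil => simp at h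
  | cons γ' κ ih =>
    cases k with
    | zero =>
      obtain rfl : γ' = γ := by simpa using h
      rw [projs, ← mul_assoc, Nat.add_zero, proj_mul_self]
    | succ k =>
      have := ih (k := k) (by simpa using h) (o + 1)
      rw [show o + 1 + k = o + (k + 1) by omega] at this
      rw [projs, ← mul_assoc, ← T.proj_comm _ _ (by omega), mul_assoc, this]

/-- The idempotent `proj false` at the vertex `v₁` cuts a band. -/
theorem bandTail_mul_projs (i : ℕ) (κ : List Bool) {k : ℕ} (hk : k < 3)
    (h : κ[k]? = some false) :
    T.bandTail (2 * i) * T.projs κ i =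
      (loopValue A)⁻¹ • (T.bandCup (2 * i) * T.cup (2 * (i + k)) * T.projs κ i) := by
  rw [← T.projs_mul_projs_of_getElem h, ← mul_assoc, T.bandTail_mul_proj_false i hk,
    smul_mul_assoc, T.projs_mul_projs_of_getElem h]

theorem bandCup_mul_projs_of_ne {γ γ' : Bool} (h : γ ≠ γ') (i : ℕ) :
    T.bandCup (2 * i) * T.projs [γ, γ'] i = 0 := by
  rw [projs_pair, T.proj_comm _ _ le_rfl, ← mul_assoc, ← bandCup_mul_proj, mul_assoc,
    T.proj_mul_proj_of_ne h.symm, mul_zero]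

theorem block_cup : Block T T.cup 0 1 := ⟨floats_cup, fun h => h.cup⟩

theorem bandCup_mul_cup_mul_projs (i : ℕ) (γ γ' : Bool) {k : ℕ} (hk : k < 3) :
    T.bandCup (2 * i) * T.cup (2 * (i + k)) * T.projs ([γ, γ'].insertIdx k false) i =
      T.bandCup (2 * i) * T.projs [γ, γ'] i * T.cup (2 * (i + k)) := by
  rw [mul_assoc, mul_assoc]
  congr 1
  interval_cases k
  · have := T.block_cup.comm_projs_right [γ, γ'] (le_refl i)
    rw [Nat.add_zero] at this ⊢
    rw [List.insertIdx_zero, projs, ← mul_assoc, T.cup_mul_proj_false, this]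
    rfl
  · have e₁ := (floats_cup (T := T)).comm_projs_left [γ] (le_refl (i + 1))
    have e₂ := T.block_cup.comm_projs_right [γ'] (le_refl (i + 1))
    rw [show [γ, γ'].insertIdx 1 false = [γ] ++ ([false] ++ [γ']) from rfl, projs_append,
      projs_append, ← mul_assoc, List.length_singleton, List.length_singleton, ← e₁,
      mul_assoc, projs_singleton false, mul_mul_of_eq (T.cup_mul_proj_false _), e₂,
      ← mul_assoc]
    congr 1
    exact (projs_append [γ] [γ'] i).symm
  · have e₁ := (floats_cup (T := T)).comm_projs_left [γ, γ'] (le_refl (i + 2))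
    rw [show [γ, γ'].insertIdx 2 false = [γ, γ'] ++ [false] from rfl, projs_append,
      ← mul_assoc, show [γ, γ'].length = 2 from rfl, ← e₁, mul_assoc, projs_singleton,
      T.cup_mul_proj_false]

/-- If exactly one of three bands is not cut at the vertex `v₁`, the result is zero. -/
theorem bandTail_mul_projs_eq_zero (i : ℕ) (γ γ' : Bool) (h : γ ≠ γ') {k : ℕ} (hk : k < 3) :
    T.bandTail (2 * i) * T.projs ([γ, γ'].insertIdx k false) i = 0 := by
  rw [T.bandTail_mul_projs i _ hk (by interval_cases k <;> rfl),
    T.bandCup_mul_cup_mul_projs i γ γ' hk, T.bandCup_mul_projs_of_ne h, zero_mul, smul_zero]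

theorem colored_eq_zero {c : Fin 3 → Bool} {w : List ThetaSlice}
    (hw : ∃ s ∈ w, ThetaSlice.isTail s = true) (k : Fin 3) (hk : c k = false)
    (h : c (k + 1) ≠ c (k + 2)) : T.colored c w = 0 := by
  induction w with
  | nil => simp at hw
  | cons s w ih =>
    rw [colored_cons]
    by_cases hs : s.isTail = true
    · have : T.coloredSlice c s = 0 := by
        cases s with
        | tail i =>
          rw [coloredSlice, tailProj, thetaAt, ThetaSlice.pos]
          fin_cases k
          · have := T.bandTail_mul_projs_eq_zero i (c 1) (c 2) h (k := 0) (by omega)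
            simp only [Fin.zero_eta] at hk
            rwa [List.insertIdx_zero, ← hk] at this
          · have := T.bandTail_mul_projs_eq_zero i (c 0) (c 2) (Ne.symm h) (k := 1) (by omega)
            simp only [Fin.mk_one] at hk
            rwa [← hk] at this
          · have := T.bandTail_mul_projs_eq_zero i (c 0) (c 1) h (k := 2) (by omega)
            simp only [Fin.reduceFinMk] at hk
            rwa [← hk] at this
        | strand s => simp [isTail] at hs
        | head i => simp [isTail] at hs
      rw [this, zero_mul]
    · rw [ih, mul_zero]
      obtain ⟨s', hs', h'⟩ := hw
      rcases List.mem_cons.1 hs' with rfl | hs'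
      · exact absurd h' hs
      · exact ⟨s', hs', h'⟩

end TemperleyLieb
end ThetaCurve

/-! ### Cutting edges: subknots and the completely cut theta-curve. -/

namespace ThetaCurve
namespace TemperleyLieb

variable {K : Type} [Field K] {A : K} {R : Type} [Ring R] [Algebra K R] (T : TemperleyLieb A R)

/-- Cups in the bands `o, o + 1, …` which a list of idempotents cuts. -/
def cuts : List Bool → ℕ → R
  | [], _ => 1
  | true :: κ, o => cuts κ (o + 1)
  | false :: κ, o => T.cup (2 * o) * cuts κ (o + 1)

theorem cuts_append (κ κ' : List Bool) (o : ℕ) :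
    T.cuts (κ ++ κ') o = T.cuts κ o * T.cuts κ' (o + κ.length) := by
  induction κ generalizing o with
  | nil => simp [cuts]
  | cons γ κ ih =>
    cases γ <;> simp only [List.cons_append, cuts, ih, mul_assoc, List.length_cons] <;>
      rw [show o + 1 + κ.length = o + (κ.length + 1) by omega]

variable {T} in
theorem Block.comm_cuts {X : ℕ → R} {a b : ℕ} (hX : Block T X a b) (κ : List Bool) {i j : ℕ}
    (h : i ≤ j) : X (2 * i) * T.cuts κ (j + b) = T.cuts κ (j + a) * X (2 * i) := by
  induction κ generalizing j with
  | nil => simp [cuts]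
  | cons γ κ ih =>
    have := ih (j := j + 1) (by omega)
    rw [Nat.add_right_comm, Nat.add_right_comm j 1 a] at this
    cases γ
    · rw [cuts, cuts, ← mul_assoc, hX.comm_right floats_cup h, mul_assoc, this, mul_assoc]
    · rw [cuts, cuts, this]

-- Every cut creates a band out of nothing, so an element lying to the right of the cuts has that
-- many fewer bands on its left once it is moved below them.
variable {T} in
theorem Floats.cuts_mul {Y : ℕ → R} (hY : Floats T Y) (κ : List Bool) {o i : ℕ}
    (h : o + κ.length ≤ i) :
    T.cuts κ o * Y (2 * i) = Y (2 * (i - κ.count false)) * T.cuts κ o := by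
  induction κ generalizing o with
  | nil => simp [cuts]
  | cons γ κ ih =>
    simp only [List.length_cons] at h
    have hc : κ.count false ≤ κ.length := List.count_le_length
    have := ih (o := o + 1) (by omega)
    cases γ
    · have e := T.block_cup.comm_right hY (show o ≤ i - κ.count false - 1 by omega)
      rw [show i - κ.count false - 1 + 1 = i - κ.count false by omega] at e
      rw [cuts, mul_assoc, this, ← mul_assoc, e, mul_assoc, List.count_cons_self, Nat.sub_sub,
        Nat.add_zero]
    · rw [cuts, this]
      simp

/-- A cup absorbs `proj false`. On the cut bands the idempotents disappear; those on the other bands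
move below the cuts, where these bands are adjacent. -/
theorem cuts_mul_projs (κ : List Bool) (o : ℕ) : T.cuts κ o * T.projs κ o =
    T.projs (List.replicate (κ.count true) true) o * T.cuts κ o := by
  induction κ generalizing o with
  | nil => simp [cuts, projs]
  | cons γ κ ih =>
    have e := (block_proj (T := T) γ).comm_cuts κ (le_refl o)
    cases γ
    · have e' := T.block_cup.comm_projs_right (List.replicate (κ.count true) true) (le_refl o)
      rw [cuts, projs, mul_assoc, ← mul_assoc (T.cuts κ _), ← e, mul_assoc, ← mul_assoc,
        cup_mul_proj_false, ih, ← mul_assoc, e', mul_assoc]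
      simp
    · rw [cuts, projs, ← mul_assoc, ← e, mul_assoc, ih, List.count_cons_self, List.replicate_succ,
        projs, mul_assoc]

/-- The cuts at a level. -/
def levelCuts (c : Fin 3 → Bool) (l : Level (Fin 3)) : R := T.cuts (l.map fun p => c p.1) 0

/-- The number of bands at a level which are not cut. -/
def uncut (c : Fin 3 → Bool) (l : Level (Fin 3)) : ℕ := l.countP fun p => c p.1

/-- The number of cut bands at a level which are oriented upwards. -/
def cutUp (c : Fin 3 → Bool) (l : Level (Fin 3)) : ℤ := (l.countP fun p => !c p.1 && p.2 : ℕ)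

theorem levelCuts_mul_levelProj (c : Fin 3 → Bool) (l : Level (Fin 3)) :
    T.levelCuts c l * T.levelProj c l = T.fullProj (uncut c l) * T.levelCuts c l := by
  rw [levelCuts, levelProj, cuts_mul_projs, fullProj, uncut, List.count, List.countP_map]
  congr 4
  funext p
  cases h : c p.1 <;> simp [h]

theorem uncut_append (c : Fin 3 → Bool) (l l' : Level (Fin 3)) :
    uncut c (l ++ l') = uncut c l + uncut c l' := List.countP_append

theorem cutUp_append (c : Fin 3 → Bool) (l l' : Level (Fin 3)) :
    cutUp c (l ++ l') = cutUp c l + cutUp c l' := by simp [cutUp]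

theorem projs_comm_cuts (μ κ : List Bool) {i j : ℕ} (h : i + μ.length ≤ j) :
    T.projs μ i * T.cuts κ j = T.cuts κ j * T.projs μ i := by
  induction μ generalizing i with
  | nil => simp [projs]
  | cons γ μ ih =>
    simp only [List.length_cons] at h
    have e := (block_proj (T := T) γ).comm_cuts κ (show i ≤ j - 1 by omega)
    rw [show j - 1 + 1 = j by omega] at e
    rw [projs, mul_assoc, ih (by omega), ← mul_assoc, e, mul_assoc]

theorem projs_mul_levelProj (c : Fin 3 → Bool) (l₁ m l₂ : Level (Fin 3)) :
    T.projs (m.map fun p => c p.1) l₁.length * T.levelProj c (l₁ ++ m ++ l₂) =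
      T.levelProj c (l₁ ++ m ++ l₂) := by
  rw [levelProj, List.map_append, List.map_append, projs_append, projs_append]
  simp only [List.length_map, zero_add]
  rw [← mul_assoc, ← mul_assoc, ← projs_comm _ _ (by simp), mul_assoc (T.projs _ 0),
    projs_mul_self]

/-- The effect of cuts below a slice, if the cut bands carry the idempotent `proj false`: the slice
is replaced by `Z`, with a factor `r`. -/
def Cuts (c : Fin 3 → Bool) (s : ThetaSlice) (l : Level (Fin 3)) (r : K) (Z : R) : Prop :=
  ∀ F : R, T.levelProj c (s.step l) * F = F → T.levelCuts c l * (T.thetaAt s (2 * s.pos) * F) =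
    r • (Z * (T.levelCuts c (s.step l) * F))

-- Cuts to the right of the slice commute with it; cuts to the left let `Z` pass and lower its
-- position to the number of uncut bands there. The idempotents needed in the local computation are
-- borrowed from `F`, which absorbs them.
variable {T} in
theorem Cuts.of_local {c : Fin 3 → Bool} {s : ThetaSlice} {l₁ m : Level (Fin 3)}
    (l₂ : Level (Fin 3)) (hi : l₁.length = s.pos) (hm : m.length = s.ins) {r : K} {Z : ℕ → R}
    (hZ : Floats T Z)
    (h : T.cuts (m.map fun p => c p.1) l₁.length *
      (T.thetaAt s (2 * l₁.length) * T.projs ((s.top m).map fun p => c p.1) l₁.length) =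
        r • (Z (2 * l₁.length) * (T.cuts ((s.top m).map fun p => c p.1) l₁.length *
          T.projs ((s.top m).map fun p => c p.1) l₁.length))) :
    T.Cuts c s (l₁ ++ m ++ l₂) r (Z (2 * uncut c l₁)) := by
  intro F hF
  rw [s.step_append l₂ hi hm] at hF ⊢
  have hm' := s.top_length hm
  have hF' : T.projs ((s.top m).map fun p => c p.1) l₁.length * F = F := by
    rw [← hF, ← mul_assoc, projs_mul_levelProj]
  have e₁ := (block_thetaAt (T := T) s).comm_cuts (l₂.map fun p => c p.1) (le_refl l₁.length)
  have e₂ := T.projs_comm_cuts ((s.top m).map fun p => c p.1) (l₂.map fun p => c p.1)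
    (i := l₁.length) (j := l₁.length + s.outs) (by simp [hm'])
  have e₃ := hZ.cuts_mul (l₁.map fun p => c p.1) (o := 0) (i := l₁.length) (by simp)
  have hu : l₁.length - (l₁.map fun p => c p.1).count false = uncut c l₁ := by
    rw [uncut, List.count, List.countP_map, List.length_eq_countP_add_countP (fun p => c p.1)]
    have : (fun a : Fin 3 × Bool => decide ¬(c a.1 = true)) =
        (fun x => x == false) ∘ fun p : Fin 3 × Bool => c p.1 := by
      funext p
      cases hp : c p.1 <;> simp [hp]
    rw [this]
    omega
  rw [hu] at e₃
  rw [← hi]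
  simp only [levelCuts, List.map_append, cuts_append, List.length_append, List.length_map,
    zero_add, hm, hm']
  calc _ = T.cuts (l₁.map fun p => c p.1) 0 * (T.cuts (m.map fun p => c p.1) l₁.length *
        (T.cuts (l₂.map fun p => c p.1) (l₁.length + s.ins) * T.thetaAt s (2 * l₁.length)) *
          (T.projs ((s.top m).map fun p => c p.1) l₁.length * F)) := by
        rw [hF']
        simp only [mul_assoc]
    _ = T.cuts (l₁.map fun p => c p.1) 0 * ((T.cuts (m.map fun p => c p.1) l₁.length *
        (T.thetaAt s (2 * l₁.length) * T.projs ((s.top m).map fun p => c p.1) l₁.length)) *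
          (T.cuts (l₂.map fun p => c p.1) (l₁.length + s.outs) * F)) := by
        rw [← e₁]
        simp only [mul_assoc]
        rw [mul_mul_of_eq_mul e₂]
    _ = r • ((T.cuts (l₁.map fun p => c p.1) 0 * Z (2 * l₁.length)) *
          (T.cuts ((s.top m).map fun p => c p.1) l₁.length *
          (T.cuts (l₂.map fun p => c p.1) (l₁.length + s.outs) *
            (T.projs ((s.top m).map fun p => c p.1) l₁.length * F)))) := by
        rw [h, ← mul_mul_of_eq_mul e₂]
        simp only [smul_mul_assoc, mul_smul_comm, mul_assoc]
    _ = _ := by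
        rw [e₃, hF']
        simp only [mul_assoc]

/-- What remains of a slice after the bands of some edges are cut. -/
def reducedAt (c : Fin 3 → Bool) : Slice (Fin 3) → Level (Fin 3) → R
  | .cup i a _, l => if c a then T.bandCup (2 * uncut c (l.take i)) else 1
  | .cap i, l =>
    match l[i]? with
    | some (a, _) => if c a then T.bandCap (2 * uncut c (l.take i)) else 1
    | none => 1
  | .cross i ov, l =>
    match (l.drop i).take 2 with
    | [(a, _), (b, _)] => if c a ∧ c b then T.bandCross ov (2 * uncut c (l.take i)) else 1
    | _ => 1

/-- One copy of `proj false` is written as `δ⁻¹` times a hook, which severs the minimum into two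
ends of bands. -/
theorem bandCup_mul_projs_false (i : ℕ) : T.bandCup (2 * i) * T.projs [false, false] i =
    (loopValue A)⁻¹ • (T.cup (2 * i) * T.cup (2 * (i + 1)) * T.projs [false, false] i) := by
  have h : T.projs [false, false] i = T.proj false (2 * i) * T.projs [false, false] i :=
    (T.projs_mul_projs_of_getElem (k := 0) rfl i).symm
  conv_lhs => rw [h]
  rw [← mul_assoc, proj, if_neg (by simp), mul_smul_comm, smul_mul_assoc, hook,
    ← mul_assoc, bandCup_mul_cap, ← T.cup_mul_cup_add_two, mul_add]

/-- A cut minimum costs `δ⁻¹`, and at a cut maximum a loop `δ` falls off. Just one of the two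
strands at an extremum is directed upwards, so the change of `cutUp` records these exponents. At a
crossing the end of a cut band retracts past the other band without a factor. -/
theorem cuts_strand (c : Fin 3 → Bool) (s : Slice (Fin 3)) {l : Level (Fin 3)} (hs : s.Valid l) :
    T.Cuts c (.strand s) l (loopValue A ^ (cutUp c l - cutUp c (s.step l))) (T.reducedAt c s l) := by
  have h₀ := T.loopValue_ne_zero
  obtain ⟨l₁, m, l₂, rfl, h₁, hm⟩ := Slice.exists_append hs.le
  have hstep := s.step_append l₂ h₁ hm
  rw [hstep, cutUp_append, cutUp_append, cutUp_append, cutUp_append, add_sub_add_right_eq_sub,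
    add_sub_add_left_eq_sub]
  cases s with
  | cup i a up =>
    obtain rfl : m = [] := List.eq_nil_of_length_eq_zero hm
    obtain rfl : l₁.length = i := h₁
    cases ha : c a
    · have hr : cutUp c [] - cutUp c ((Slice.cup l₁.length a up).top []) = -1 := by
        cases up <;> simp [cutUp, Slice.top, ha]
      have hZ : T.reducedAt c (.cup l₁.length a up) (l₁ ++ [] ++ l₂) = 1 := by
        simp [reducedAt, ha]
      rw [hr, hZ]
      refine Cuts.of_local (Z := fun _ => 1) l₂ rfl rfl floats_one ?_
      simp only [ThetaSlice.top, Slice.top, List.map_nil, List.map_cons, ha, cuts, thetaAt, bandAt,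
        one_mul, mul_one, bandCup_mul_projs_false, zpow_neg_one]
    · have hr : cutUp c [] - cutUp c ((Slice.cup l₁.length a up).top []) = 0 := by
        simp [cutUp, Slice.top, ha]
      have hZ : T.reducedAt c (.cup l₁.length a up) (l₁ ++ [] ++ l₂) =
          T.bandCup (2 * uncut c l₁) := by
        simp [reducedAt, ha]
      rw [hr, hZ]
      refine Cuts.of_local (Z := T.bandCup) l₂ rfl rfl floats_bandCup ?_
      simp [ThetaSlice.top, Slice.top, ha, cuts, thetaAt, bandAt]
  | cap i =>
    obtain rfl : l₁.length = i := h₁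
    match m, hm with
    | [(a, u), (b, v)], _ =>
      obtain ⟨a', u', hs⟩ := hs
      simp at hs
      obtain ⟨⟨rfl, rfl⟩, rfl, rfl⟩ := hs
      cases hb : c b
      · have hr : cutUp c [(b, u), (b, !u)] - cutUp c ((Slice.cap l₁.length).top
            [(b, u), (b, !u)]) = 1 := by
          cases u <;> simp [cutUp, Slice.top, hb]
        have hZ : T.reducedAt c (.cap l₁.length) (l₁ ++ [(b, u), (b, !u)] ++ l₂) = 1 := by
          simp [reducedAt, hb]
        rw [hr, hZ]
        refine Cuts.of_local (Z := fun _ => 1) l₂ rfl rfl floats_one ?_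
        have := T.cup_add_two_mul_bandCap (2 * l₁.length)
        simp [ThetaSlice.top, Slice.top, hb, cuts, thetaAt, bandAt, projs, mul_add, mul_assoc,
          this, T.loop]
      · have hr : cutUp c [(b, u), (b, !u)] - cutUp c ((Slice.cap l₁.length).top
            [(b, u), (b, !u)]) = 0 := by
          simp [cutUp, Slice.top, hb]
        have hZ : T.reducedAt c (.cap l₁.length) (l₁ ++ [(b, u), (b, !u)] ++ l₂) =
            T.bandCap (2 * uncut c l₁) := by
          simp [reducedAt, hb]
        rw [hr, hZ]
        refine Cuts.of_local (Z := T.bandCap) l₂ rfl rfl floats_bandCap ?_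
        simp [ThetaSlice.top, Slice.top, hb, cuts, thetaAt, bandAt, projs]
  | cross i ov =>
    obtain rfl : l₁.length = i := h₁
    match m, hm with
    | [(a, u), (b, v)], _ =>
      have hr : cutUp c [(a, u), (b, v)] - cutUp c ((Slice.cross l₁.length ov).top
          [(a, u), (b, v)]) = 0 := by
        simp [cutUp, Slice.top, List.countP_cons, add_comm]
      have hZ : T.reducedAt c (.cross l₁.length ov) (l₁ ++ [(a, u), (b, v)] ++ l₂) =
          if c a ∧ c b then T.bandCross ov (2 * uncut c l₁) else 1 := by
        simp [reducedAt]
      rw [hr, hZ]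
      have e₁ := T.cup_mul_bandCross ov (2 * l₁.length)
      have e₂ := T.cup_add_two_mul_bandCross ov (2 * l₁.length)
      have e₃ := T.cup_mul_cup_add_two (2 * l₁.length)
      split_ifs with hab
      · refine Cuts.of_local (Z := T.bandCross ov) l₂ rfl rfl (floats_bandCross ov) ?_
        simp [ThetaSlice.top, Slice.top, hab, cuts, thetaAt, bandAt]
      · refine Cuts.of_local (Z := fun _ => 1) l₂ rfl rfl floats_one ?_
        simp only [ThetaSlice.top, Slice.top, List.map_cons, List.map_nil, List.reverse_cons,
          List.reverse_nil, List.nil_append, List.cons_append, thetaAt, bandAt, zpow_zero, one_smul,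
          one_mul]
        cases ha : c a <;> cases hb : c b <;>
          simp only [cuts, mul_add, mul_one, one_mul, mul_assoc]
        · rw [mul_mul_of_eq e₂, ← mul_assoc, ← e₃, mul_assoc]
        · rw [mul_mul_of_eq e₁]
        · rw [mul_mul_of_eq e₂]
        · simp [ha, hb] at hab

/-- The vertex `v₁`, where one edge is cut. -/
theorem cuts_tail (k : Fin 3) {i : ℕ} {l : Level (Fin 3)} (hi : i ≤ l.length) :
    T.Cuts (fun e => decide (e ≠ k)) (.tail i) l (loopValue A)⁻¹
      (T.bandCup (2 * uncut (fun e => decide (e ≠ k)) (l.take i))) := by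
  obtain ⟨l₁, m, l₂, rfl, h₁, hm⟩ := Slice.exists_append (k := 0) hi
  obtain rfl : m = [] := List.eq_nil_of_length_eq_zero hm
  obtain rfl : l₁.length = i := h₁
  rw [List.append_nil, List.take_left]
  have := Cuts.of_local (T := T) (c := fun e => decide (e ≠ k)) (s := .tail l₁.length) (m := [])
    (r := (loopValue A)⁻¹) l₂ rfl rfl floats_bandCup ?_
  · rwa [List.append_nil] at this
  · have h := T.bandTail_mul_projs l₁.length [decide (0 ≠ k), decide (1 ≠ k), decide (2 ≠ k)]
      (k := k) k.2 (by fin_cases k <;> rfl)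
    simp only [ThetaSlice.top, List.map_cons, List.map_nil, thetaAt, cuts, one_mul]
    rw [h, ← mul_assoc]
    fin_cases k <;> simp [cuts]

theorem exists_of_head_valid {i : ℕ} {l : Level (Fin 3)} (hi : (ThetaSlice.head i).Valid l) :
    ∃ l₁ l₂, l = l₁ ++ [(0, true), (1, true), (2, true)] ++ l₂ ∧ l₁.length = i := by
  obtain ⟨l₁, m, l₂, rfl, h₁, hm⟩ := Slice.exists_append hi.le
  obtain rfl : l₁.length = i := h₁
  match m, hm with
  | [a, b, c], _ =>
    simp [ThetaSlice.Valid] at hi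
    obtain ⟨rfl, rfl, rfl⟩ := hi
    exact ⟨l₁, l₂, rfl, rfl⟩

/-- The vertex `v₂`, where one edge is cut. -/
theorem cuts_head (k : Fin 3) {i : ℕ} {l : Level (Fin 3)} (hi : (ThetaSlice.head i).Valid l) :
    T.Cuts (fun e => decide (e ≠ k)) (.head i) l 1
      (T.bandCap (2 * uncut (fun e => decide (e ≠ k)) (l.take i))) := by
  obtain ⟨l₁, l₂, rfl, rfl⟩ := exists_of_head_valid hi
  rw [List.append_assoc, List.take_left, ← List.append_assoc]
  refine Cuts.of_local (Z := T.bandCap) l₂ rfl rfl floats_bandCap ?_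
  have h := T.cup_mul_bandHead (2 * l₁.length) k.2
  rw [← mul_add] at h
  simp only [ThetaSlice.top, List.map_cons, List.map_nil, thetaAt, one_smul, projs, cuts, mul_one]
  rw [← h]
  fin_cases k <;> simp [cuts]

/-- The vertex `v₁`, where all edges are cut. -/
theorem cuts_tail_all {i : ℕ} {l : Level (Fin 3)} (hi : i ≤ l.length) :
    T.Cuts (fun _ => false) (.tail i) l ((loopValue A)⁻¹ ^ 2) 1 := by
  obtain ⟨l₁, m, l₂, rfl, h₁, hm⟩ := Slice.exists_append (k := 0) hi
  obtain rfl : m = [] := List.eq_nil_of_length_eq_zero hm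
  obtain rfl : l₁.length = i := h₁
  refine Cuts.of_local (Z := fun _ => 1) l₂ rfl rfl floats_one ?_
  have h := T.bandTail_mul_projs l₁.length [false, false, false] (k := 2) (by omega) rfl
  have e₁ := (floats_cup (T := T)).comm_projs_left [false, false] (le_refl (l₁.length + 2))
  have e : T.projs [false, false, false] l₁.length =
      T.projs [false, false] l₁.length * T.projs [false] (l₁.length + 2) :=
    projs_append [false, false] [false] l₁.length
  simp only [ThetaSlice.top, List.map_cons, List.map_nil, thetaAt, cuts, one_mul, mul_one]
  rw [h, e, mul_assoc (T.bandCup _), ← mul_assoc (T.cup _) (T.projs _ _), ← e₁,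
    mul_assoc (T.projs _ _) (T.cup _), ← mul_assoc (T.bandCup _), bandCup_mul_projs_false,
    smul_mul_assoc, smul_smul, pow_two, mul_assoc (T.cup _ * T.cup _),
    mul_mul_of_eq_mul e₁]
  simp only [mul_assoc]

/-- The vertex `v₂`, where all edges are cut. -/
theorem cuts_head_all {i : ℕ} {l : Level (Fin 3)} (hi : (ThetaSlice.head i).Valid l) :
    T.Cuts (fun _ => false) (.head i) l (loopValue A) 1 := by
  obtain ⟨l₁, l₂, rfl, rfl⟩ := exists_of_head_valid hi
  refine Cuts.of_local (Z := fun _ => 1) l₂ rfl rfl floats_one ?_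
  have h := T.cup_mul_bandHead (2 * l₁.length) (k := 2) (by omega)
  rw [← mul_add] at h
  have h' := T.cup_add_two_mul_bandCap (2 * l₁.length)
  rw [← mul_one 2, mul_assoc 2, one_mul, ← mul_add] at h'
  simp only [ThetaSlice.top, List.map_cons, List.map_nil, thetaAt, projs, cuts, mul_one,
    mul_assoc, Nat.add_assoc, Nat.reduceAdd]
  rw [h, h', T.loop]

theorem cutUp_step_tail (c : Fin 3 → Bool) (i : ℕ) (l : Level (Fin 3)) :
    cutUp c ((ThetaSlice.tail i).step l) =
      cutUp c l + cutUp c [(0, true), (1, true), (2, true)] := by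
  conv_rhs => rw [← List.take_append_drop i l]
  rw [ThetaSlice.step, cutUp_append, cutUp_append, cutUp_append]
  ring

theorem cutUp_step_head (c : Fin 3 → Bool) {i : ℕ} {l : Level (Fin 3)}
    (hi : (ThetaSlice.head i).Valid l) : cutUp c ((ThetaSlice.head i).step l) +
      cutUp c [(0, true), (1, true), (2, true)] = cutUp c l := by
  obtain ⟨l₁, l₂, rfl, rfl⟩ := exists_of_head_valid hi
  have := (ThetaSlice.head l₁.length).step_append (l₁ := l₁)
    (m := [(0, true), (1, true), (2, true)]) l₂ rfl rfl
  rw [this, cutUp_append, cutUp_append, cutUp_append, cutUp_append]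
  simp [ThetaSlice.top, cutUp]
  ring

theorem allColored_absorb (c : Fin 3 → Bool) (w : List ThetaSlice) (l : Level (Fin 3)) :
    T.levelProj c l * T.allColored c w l = T.allColored c w l := by
  cases w <;> simp only [allColored, ← mul_assoc] <;> simp only [levelProj, projs_mul_self]

theorem levelCuts_mul_allColored_cons {c : Fin 3 → Bool} {s : ThetaSlice} {l : Level (Fin 3)} {r : K}
    {Z : R} (h : T.Cuts c s l r Z) (w : List ThetaSlice) :
    T.levelCuts c l * T.allColored c (s :: w) l =
      r • (T.fullProj (uncut c l) * (Z * (T.levelCuts c (s.step l) * T.allColored c w (s.step l)))) := by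
  rw [allColored, ← mul_assoc, levelCuts_mul_levelProj, mul_assoc,
    h _ (T.allColored_absorb c w _), mul_smul_comm]

/-- If all edges are cut at the vertex `v₁`, only a scalar remains. -/
theorem levelCuts_mul_allColored_false (w : List ThetaSlice) (l : Level (Fin 3))
    (hw : ThetaClosesFrom w l) :
    T.levelCuts (fun _ => false) l * T.allColored (fun _ => false) w l =
      (loopValue A ^ (cutUp (fun _ => false) l + w.countP ThetaSlice.isTail -
        2 * w.countP ThetaSlice.isHead)) • (1 : R) := by
  have h₀ := T.loopValue_ne_zero
  induction w generalizing l with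
  | nil =>
    have : l = [] := hw
    simp [this, levelCuts, cuts, allColored, levelProj_nil, cutUp]
  | cons s w ih =>
    have hu : uncut (fun _ => false) l = 0 := by simp [uncut]
    -- The exponent telescopes: at `v₁` the number of upward cut strands grows by three while the
    -- factor is `δ⁻²`, at `v₂` it drops by three while the factor is `δ`. The coefficients `1` and
    -- `-2` of the vertices make up for the differences.
    have key : ∀ r : K, T.Cuts (fun _ => false) s l r 1 →
        ( r = loopValue A ^ (cutUp (fun _ => false) l - cutUp (fun _ => false) (s.step l) +
          (if s.isTail then 1 else 0) - 2 * (if s.isHead then 1 else 0))) →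
        T.levelCuts (fun _ => false) l * T.allColored (fun _ => false) (s :: w) l =
          (loopValue A ^ (cutUp (fun _ => false) l + (s :: w).countP ThetaSlice.isTail -
            2 * (s :: w).countP ThetaSlice.isHead)) • (1 : R) := by
      intro r h hr
      rw [T.levelCuts_mul_allColored_cons h, hu, fullProj_zero, one_mul, one_mul, ih _ hw.2,
        smul_smul, hr, ← zpow_add₀ h₀, List.countP_cons, List.countP_cons]
      congr 2
      push_cast
      ring
    match s, hw.1, key with
    | .strand s, hs, key =>
      have h := T.cuts_strand (fun _ => false) s hs
      have e : T.reducedAt (fun _ => false) s l = 1 := by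
        cases s with
        | cup i a up => simp [reducedAt]
        | cap i => rcases h' : l[i]? with _ | ⟨a, u⟩ <;> simp [reducedAt, h']
        | cross i ov =>
          simp only [reducedAt]
          split
          · simp
          · rfl
      rw [e] at h
      refine key _ h ?_
      simp [ThetaSlice.isTail, ThetaSlice.isHead, ThetaSlice.step]
    | .tail i, hs, key =>
      refine key _ (T.cuts_tail_all hs) ?_
      have h₃ : cutUp (fun _ => false) [(0, true), (1, true), (2, true)] = 3 := rfl
      rw [cutUp_step_tail, h₃, if_pos (show (ThetaSlice.tail i).isTail = true from rfl),
        if_neg (by simp [ThetaSlice.isHead]), inv_pow,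
        ← zpow_natCast, ← zpow_neg]
      congr 1
      push_cast
      ring
    | .head i, hs, key =>
      refine key _ (T.cuts_head_all hs) ?_
      have h₃ : cutUp (fun _ => false) [(0, true), (1, true), (2, true)] = 3 := rfl
      rw [← cutUp_step_head _ hs, h₃, if_neg (by simp [ThetaSlice.isTail]),
        if_pos (show (ThetaSlice.head i).isHead = true from rfl)]
      conv_lhs => rw [← zpow_one (loopValue A)]
      congr 1
      ring

/-- If all edges are cut at the vertex `v₁`, only a scalar remains. -/
theorem colored_false (D : ThetaDiagram) :
    T.colored (fun _ => false) D.word = (loopValue A)⁻¹ • (1 : R) := by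
  have := T.levelCuts_mul_allColored_false D.word [] D.closes
  rw [D.one_tail, D.one_head, levelCuts, List.map_nil, cuts, one_mul] at this
  rw [colored_word, this, ← zpow_neg_one]
  rfl

theorem fullProj_mul_bandAt_mul_barred (s : Slice Unit) (w : List (Slice Unit)) {n n' i : ℕ}
    (h : s.pos = i) (hn : n' = n - s.ins + s.outs) :
    T.fullProj n * (T.bandAt s (2 * i) * T.barred w n') = T.barred (s :: w) n := by
  rw [barred, hn, h]

theorem kept_eq_uncut (k : Fin 3) (l : Level (Fin 3)) (p : ℕ) :
    ThetaSlice.deleteEdge.kept k l p = uncut (fun e => decide (e ≠ k)) (l.take p) := by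
  rw [ThetaSlice.deleteEdge.kept, uncut, List.countP_eq_length_filter]

theorem uncut_step (s : ThetaSlice) (c : Fin 3 → Bool) {l₁ m l₂ : Level (Fin 3)}
    (hi : l₁.length = s.pos) (hm : m.length = s.ins) :
    uncut c (s.step (l₁ ++ m ++ l₂)) + uncut c m = uncut c (l₁ ++ m ++ l₂) + uncut c (s.top m) := by
  rw [s.step_append l₂ hi hm, uncut_append, uncut_append, uncut_append, uncut_append]
  ring

/-- What cutting leaves of a slice is precisely the band picture of the slice after deletion of the
edge `k`. If nothing is left, the bars of two consecutive levels merge. -/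
theorem reducedAt_mul_barred (k : Fin 3) {s : Slice (Fin 3)} {l : Level (Fin 3)} (hs : s.Valid l)
    (v : List (Slice Unit)) :
    T.fullProj (uncut (fun e => decide (e ≠ k)) l) *
      (T.reducedAt (fun e => decide (e ≠ k)) s l *
        T.barred v (uncut (fun e => decide (e ≠ k)) (s.step l))) =
      T.barred ((ThetaSlice.strand s).deleteEdge k l ++ v)
        (uncut (fun e => decide (e ≠ k)) l) := by
  have hk (p : ℕ) := kept_eq_uncut k l p
  have hc (a : Fin 3) : decide (a ≠ k) = true ↔ a ≠ k := by simp
  obtain ⟨l₁, m, l₂, rfl, h₁, hm⟩ := Slice.exists_append hs.le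
  have hu := uncut_step (.strand s) (fun e => decide (e ≠ k)) (l₂ := l₂) h₁ hm
  simp only [ThetaSlice.step, ThetaSlice.top] at hu
  generalize hcc : (fun e => decide (e ≠ k)) = c at *
  have hc : ∀ a, c a = decide (a ≠ k) := fun a => by rw [← hcc]
  generalize hn : uncut c (s.step _) = n' at *
  cases s with
  | cup i a up =>
    obtain rfl : m = [] := List.eq_nil_of_length_eq_zero hm
    simp only [ThetaSlice.deleteEdge, reducedAt, hk, hc]
    by_cases ha : a = k
    · have e : uncut c ((Slice.cup i a up).top []) = 0 := by simp [uncut, Slice.top, hc, ha]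
      rw [e] at hu
      rw [if_neg (by simpa using ha), if_pos ha, List.nil_append, one_mul,
        show n' = uncut c (l₁ ++ [] ++ l₂) from hu, fullProj_mul_barred]
    · have e : uncut c ((Slice.cup i a up).top []) = 2 := by simp [uncut, Slice.top, hc, ha]
      rw [e] at hu
      rw [if_pos (by simpa using ha), if_neg ha]
      exact T.fullProj_mul_bandAt_mul_barred (.cup _ _ _) v rfl hu
  | cap i =>
    obtain rfl : l₁.length = i := h₁
    match m, hm with
    | [(a, u), (b, u')], _ =>
      obtain ⟨a', u', hs⟩ := hs
      simp at hs
      obtain ⟨⟨rfl, rfl⟩, rfl, rfl⟩ := hs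
      have hl : (l₁ ++ [(b, u), (b, !u)] ++ l₂)[l₁.length]? = some (b, u) := by simp
      simp only [ThetaSlice.deleteEdge, reducedAt, hk, hc, hl]
      have e' : uncut c ((Slice.cap l₁.length).top [(b, u), (b, !u)]) = 0 := rfl
      by_cases ha : b = k
      · have e : uncut c [(b, u), (b, !u)] = 0 := by simp [uncut, hc, ha]
        rw [e, e'] at hu
        rw [if_neg (by simpa using ha), if_pos ha, List.nil_append, one_mul,
          show n' = uncut c (l₁ ++ [(b, u), (b, !u)] ++ l₂) from hu, fullProj_mul_barred]
      · have e : uncut c [(b, u), (b, !u)] = 2 := by simp [uncut, hc, ha]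
        rw [e, e'] at hu
        rw [if_pos (by simpa using ha), if_neg ha]
        exact T.fullProj_mul_bandAt_mul_barred (.cap _) v rfl
          (by simp only [Slice.ins, Slice.outs]; omega)
  | cross i ov =>
    obtain rfl : l₁.length = i := h₁
    match m, hm with
    | [(a, u), (b, u')], _ =>
      have hl : ((l₁ ++ [(a, u), (b, u')] ++ l₂).drop l₁.length).take 2 = [(a, u), (b, u')] := by
        simp
      simp only [ThetaSlice.deleteEdge, reducedAt, hk, hc, hl]
      have e' : uncut c ((Slice.cross l₁.length ov).top [(a, u), (b, u')]) =
          uncut c [(a, u), (b, u')] := by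
        simp [uncut, Slice.top, List.countP_cons, add_comm]
      rw [e'] at hu
      have hn' : n' = uncut c (l₁ ++ [(a, u), (b, u')] ++ l₂) := Nat.add_right_cancel hu
      by_cases ha : a = k ∨ b = k
      · rw [if_neg (by simp; tauto), if_pos ha, List.nil_append, one_mul, hn', fullProj_mul_barred]
      · rw [if_pos (by simp; tauto), if_neg ha]
        have e : uncut c [(a, u), (b, u')] = 2 := by
          simp only [not_or] at ha
          simp [uncut, hc, ha]
        have hu₁ := uncut_append c l₁ [(a, u), (b, u')]
        have hu₂ := uncut_append c (l₁ ++ [(a, u), (b, u')]) l₂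
        exact T.fullProj_mul_bandAt_mul_barred (.cross _ _) v rfl
          (by simp only [Slice.ins, Slice.outs]; omega)

/-- The edge `k` is deleted if it is cut at the vertex `v₁`. -/
theorem levelCuts_mul_allColored (k : Fin 3) (w : List ThetaSlice) (l : Level (Fin 3))
    (hw : ThetaClosesFrom w l) :
    T.levelCuts (fun e => decide (e ≠ k)) l * T.allColored (fun e => decide (e ≠ k)) w l =
      (loopValue A ^ (cutUp (fun e => decide (e ≠ k)) l - w.countP ThetaSlice.isHead)) •
        T.barred (ThetaDiagram.subknot.go k w l) (uncut (fun e => decide (e ≠ k)) l) := by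
  have h₀ := T.loopValue_ne_zero
  induction w generalizing l with
  | nil =>
    have : l = [] := hw
    simp [this, levelCuts, cuts, allColored, levelProj_nil, cutUp, ThetaDiagram.subknot.go, barred,
      uncut, fullProj_zero]
  | cons s w ih =>
    -- Again the exponent telescopes: one cut strand begins at `v₁` with the factor `δ⁻¹` and ends
    -- at `v₂` with the factor `1`, which explains the correction for `v₂` only.
    have key : ∀ (r : K) (Z : R), T.Cuts (fun e => decide (e ≠ k)) s l r Z →
        (r = loopValue A ^ (cutUp (fun e => decide (e ≠ k)) l -
          cutUp (fun e => decide (e ≠ k)) (s.step l) - (if s.isHead then 1 else 0))) →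
        (T.fullProj (uncut (fun e => decide (e ≠ k)) l) *
          (Z * T.barred (ThetaDiagram.subknot.go k w (s.step l))
            (uncut (fun e => decide (e ≠ k)) (s.step l))) =
          T.barred (ThetaDiagram.subknot.go k (s :: w) l) (uncut (fun e => decide (e ≠ k)) l)) →
        T.levelCuts (fun e => decide (e ≠ k)) l *
          T.allColored (fun e => decide (e ≠ k)) (s :: w) l =
          (loopValue A ^ (cutUp (fun e => decide (e ≠ k)) l -
            (s :: w).countP ThetaSlice.isHead)) •
            T.barred (ThetaDiagram.subknot.go k (s :: w) l)
              (uncut (fun e => decide (e ≠ k)) l) := by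
      intro r Z h hr hZ
      rw [T.levelCuts_mul_allColored_cons h, ih _ hw.2, mul_smul_comm, mul_smul_comm, hZ,
        smul_smul, hr, ← zpow_add₀ h₀, List.countP_cons]
      congr 2
      push_cast
      ring
    have hup : cutUp (fun e => decide (e ≠ k)) [(0, true), (1, true), (2, true)] = 1 := by
      fin_cases k <;> rfl
    have hun : uncut (fun e => decide (e ≠ k)) [(0, true), (1, true), (2, true)] = 2 := by
      fin_cases k <;> rfl
    match s, hw.1, key with
    | .strand s, hs, key =>
      exact key _ _ (T.cuts_strand _ s hs) (by simp [ThetaSlice.isHead, ThetaSlice.step])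
        (T.reducedAt_mul_barred k hs _)
    | .tail i, hs, key =>
      refine key _ _ (T.cuts_tail k hs) ?_ ?_
      · rw [cutUp_step_tail, hup, if_neg (by simp [ThetaSlice.isHead]), ← zpow_neg_one]
        congr 1
        ring
      · refine T.fullProj_mul_bandAt_mul_barred (.cup _ _ _) _ (kept_eq_uncut _ _ _) ?_
        rw [ThetaSlice.step, uncut_append, uncut_append, hun, Slice.ins, Slice.outs]
        conv_rhs => rw [← List.take_append_drop i l, uncut_append]
        omega
    | .head i, hs, key =>
      refine key _ _ (T.cuts_head k hs) ?_ ?_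
      · rw [← cutUp_step_head _ hs, hup, if_pos (show (ThetaSlice.head i).isHead = true from rfl)]
        simp
      · refine T.fullProj_mul_bandAt_mul_barred (.cap _) _ (kept_eq_uncut _ _ _) ?_
        obtain ⟨l₁, l₂, rfl, rfl⟩ := exists_of_head_valid hs
        have := uncut_step (.head l₁.length) (fun e => decide (e ≠ k))
          (m := [(0, true), (1, true), (2, true)]) (l₂ := l₂) rfl rfl
        rw [hun] at this
        simp only [ThetaSlice.top, Slice.ins, Slice.outs] at this ⊢
        have e : uncut (fun e => decide (e ≠ k)) [] = 0 := rfl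
        omega

/-- Cutting the edge `k` at the vertex `v₁` yields the subknot of the other two edges. -/
theorem colored_subknot (D : ThetaDiagram) (k : Fin 3) :
    T.colored (fun e => decide (e ≠ k)) D.word =
      (loopValue A)⁻¹ • T.barred (D.subknot k) 0 := by
  have := T.levelCuts_mul_allColored k D.word [] D.closes
  rw [D.one_head, levelCuts, List.map_nil, cuts, one_mul] at this
  rw [colored_word, this, ← zpow_neg_one]
  rfl

end TemperleyLieb
end ThetaCurve

/-! ### Expansion of the twisted bands into idempotents. -/

namespace ThetaCurve
namespace TemperleyLieb

variable {K : Type} [Field K] {A : K} {R : Type} [Ring R] [Algebra K R] (T : TemperleyLieb A R)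

open ThetaSlice

/-- The eigenvalue of `n` full twists of a band on the idempotent `proj γ`. -/
def twistValue (A : K) (γ : Bool) (n : ℤ) : K := if γ then A ^ (2 * n) else A ^ (-6 * n)

theorem cross_pow (ov : Bool) (m n : ℕ) : T.cross ov m ^ n =
    (weight A ov ^ n) • T.proj true m + ((-(weight A (!ov)) ^ 3) ^ n) • T.proj false m := by
  induction n with
  | zero => simp [proj_true_add_proj_false]
  | succ n ih =>
    rw [pow_succ', ih, mul_add, mul_smul_comm, mul_smul_comm, cross_mul_proj_true,
      cross_mul_proj_false, smul_smul, smul_smul, ← pow_succ, ← pow_succ]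

theorem word_fullTwists (i : ℕ) (n : ℤ) : T.word (fullTwists i n) =
    twistValue A true n • T.proj true (2 * i) + twistValue A false n • T.proj false (2 * i) := by
  have hA := T.ne_zero
  have e : T.word (fullTwists i n) = T.cross (decide (0 ≤ n)) (2 * i) ^ (2 * n.natAbs) := by
    simp [word, fullTwists, slice]
  rw [e, cross_pow]
  rcases n with n | n
  · have h : decide (0 ≤ Int.ofNat n) = true := by simp
    have h₁ : twistValue A true (Int.ofNat n) = A ^ (2 * n) := by
      rw [← zpow_natCast]
      simp [twistValue]
    have h₂ : twistValue A false (Int.ofNat n) = (A⁻¹ ^ 3) ^ (2 * n) := by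
      rw [← pow_mul, ← zpow_natCast, inv_zpow']
      simp only [twistValue, Bool.false_eq_true, if_false]
      congr 1
      push_cast
      simp
      ring
    rw [h, h₁, h₂]
    simp [weight, Even.neg_pow]
  · have h : decide (0 ≤ Int.negSucc n) = false := by simp
    have h₁ : twistValue A true (Int.negSucc n) = A⁻¹ ^ (2 * (n + 1)) := by
      rw [← zpow_natCast, inv_zpow']
      rfl
    have h₂ : twistValue A false (Int.negSucc n) = (A ^ 3) ^ (2 * (n + 1)) := by
      rw [← pow_mul, ← zpow_natCast]
      simp only [twistValue, Bool.false_eq_true, if_false]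
      congr 1
      push_cast
      rw [Int.negSucc_eq]
      ring
    rw [h, h₁, h₂]
    simp [weight, Even.neg_pow]

/-- The product of the eigenvalues of the twists in the three bands. -/
def twistProduct (A : K) (t : Fin 3 → ℤ) (b₀ b₁ b₂ : Bool) : K :=
  twistValue A b₀ (t 0) * twistValue A b₁ (t 1) * twistValue A b₂ (t 2)

theorem word_bands_tail (t : Fin 3 → ℤ) (i : ℕ) : T.word ((ThetaSlice.tail i).bands t) =
    ∑ b₀, ∑ b₁, ∑ b₂, twistProduct A t b₀ b₁ b₂ • T.coloredSlice ![b₀, b₁, b₂] (.tail i) := by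
  have e : T.word [.cup (2 * i) (1 : Fin 3) false, .cup (2 * i + 1) 2 true, .cup (2 * i + 3) 0 true] =
      T.bandTail (2 * i) := by simp [word, slice, bandTail, mul_assoc]
  rw [bands, word_append, word_append, word_append, e, word_fullTwists, word_fullTwists,
    word_fullTwists]
  simp only [Fintype.sum_bool, coloredSlice, tailProj, thetaAt, ThetaSlice.pos, projs, mul_one,
    twistProduct, Matrix.cons_val_zero, Matrix.cons_val_one, Matrix.cons_val]
  simp only [mul_add, add_mul, mul_smul_comm, smul_mul_assoc, mul_assoc]
  module

theorem word_bands (c : Fin 3 → Bool) (t : Fin 3 → ℤ) {s : ThetaSlice} (hs : s.isTail = false) :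
    T.word (s.bands t) = T.coloredSlice c s := by
  cases s with
  | tail i => simp [isTail] at hs
  | strand s => exact (T.word_bands_zero (.strand s)).trans (mul_one _).symm
  | head i => exact (T.word_bands_zero (.head i)).trans (mul_one _).symm

theorem word_flatMap_bands (c : Fin 3 → Bool) (t : Fin 3 → ℤ) {w : List ThetaSlice}
    (hw : w.countP isTail = 0) : T.word (w.flatMap (bands t)) = T.colored c w := by
  induction w with
  | nil => simp [word, colored]
  | cons s w ih =>
    rw [List.countP_cons] at hw
    rw [List.flatMap_cons, word_append, colored_cons, ih (by omega), T.word_bands c t]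
    by_contra h
    simp [h] at hw

/-- Twists in the bands next to the vertex `v₁` are diagonalized by the idempotents. -/
theorem word_flatMap_bands_eq_sum (t : Fin 3 → ℤ) {w : List ThetaSlice}
    (hw : w.countP isTail = 1) : T.word (w.flatMap (bands t)) =
      ∑ b₀, ∑ b₁, ∑ b₂, twistProduct A t b₀ b₁ b₂ • T.colored ![b₀, b₁, b₂] w := by
  induction w with
  | nil => simp at hw
  | cons s w ih =>
    rw [List.countP_cons] at hw
    rw [List.flatMap_cons, word_append]
    by_cases hs : s.isTail = true
    · simp only [hs, if_true] at hw
      have hw' : w.countP isTail = 0 := by omega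
      obtain ⟨i, rfl⟩ : ∃ i, s = .tail i := by cases s <;> simp_all [isTail]
      rw [word_bands_tail]
      simp only [Finset.sum_mul, colored_cons]
      refine Finset.sum_congr rfl fun b₀ _ => Finset.sum_congr rfl fun b₁ _ =>
        Finset.sum_congr rfl fun b₂ _ => ?_
      rw [T.word_flatMap_bands ![b₀, b₁, b₂] t hw', smul_mul_assoc]
    · rw [ih (by simpa [hs] using hw)]
      simp only [Finset.mul_sum, colored_cons]
      refine Finset.sum_congr rfl fun b₀ _ => Finset.sum_congr rfl fun b₁ _ =>
        Finset.sum_congr rfl fun b₂ _ => ?_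
      rw [T.word_bands ![b₀, b₁, b₂] t (by simpa using hs), mul_smul_comm]

/-- The element of the twisted band diagram of a theta-curve. -/
theorem word_bandLink (D : ThetaDiagram) (t : Fin 3 → ℤ) :
    T.word (D.bandLink t) =
      twistProduct A t true true true • T.colored (fun _ => true) D.word +
      (loopValue A)⁻¹ • (twistProduct A t false true true • T.barred (D.subknot 0) 0 +
        twistProduct A t true false true • T.barred (D.subknot 1) 0 +
        twistProduct A t true true false • T.barred (D.subknot 2) 0 +
        twistProduct A t false false false • (1 : R)) := by
  have hw : ∃ s ∈ D.word, ThetaSlice.isTail s = true := by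
    have := D.one_tail
    rw [← List.countP_pos_iff]
    omega
  -- Of the eight colourings those with exactly two cut edges vanish.
  have z₀ : T.colored ![true, false, false] D.word = 0 := T.colored_eq_zero hw 2 rfl (by decide)
  have z₁ : T.colored ![false, true, false] D.word = 0 := T.colored_eq_zero hw 2 rfl (by decide)
  have z₂ : T.colored ![false, false, true] D.word = 0 := T.colored_eq_zero hw 1 rfl (by decide)
  have h₀ := T.colored_subknot D 0
  have h₁ := T.colored_subknot D 1
  have h₂ := T.colored_subknot D 2
  have h₃ := T.colored_false D
  have e₀ : (fun e : Fin 3 => decide (e ≠ 0)) = ![false, true, true] := by decide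
  have e₁ : (fun e : Fin 3 => decide (e ≠ 1)) = ![true, false, true] := by decide
  have e₂ : (fun e : Fin 3 => decide (e ≠ 2)) = ![true, true, false] := by decide
  have e₃ : (fun _ : Fin 3 => false) = ![false, false, false] := by decide
  have e₄ : (fun _ : Fin 3 => true) = ![true, true, true] := by decide
  rw [e₀] at h₀
  rw [e₁] at h₁
  rw [e₂] at h₂
  rw [e₃] at h₃
  rw [e₄, ThetaDiagram.bandLink, T.word_flatMap_bands_eq_sum t D.one_tail]
  simp only [Fintype.sum_bool, z₀, z₁, z₂, h₀, h₁, h₂, h₃, smul_zero, zero_add, add_zero, smul_add,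
    smul_comm (loopValue A)⁻¹]
  abel

end TemperleyLieb
end ThetaCurve

/-! ### Linking numbers, writhes and twist numbers. -/

namespace ThetaCurve

/-! ### Crossing signs of the band link -/

/-- The two boundary strands of the band over a strand. -/
def doubleStrand (p : Fin 3 × Bool) : Level (Fin 3) :=
  [(if p.2 then p.1 + 1 else p.1 + 2, false), (if p.2 then p.1 + 2 else p.1 + 1, true)]

/-- The boundary strands of the bands over a level. -/
def doubleLevel (l : Level (Fin 3)) : Level (Fin 3) := l.flatMap doubleStrand

theorem doubleLevel_append (l l' : Level (Fin 3)) :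
    doubleLevel (l ++ l') = doubleLevel l ++ doubleLevel l' := List.flatMap_append

theorem doubleLevel_length (l : Level (Fin 3)) : (doubleLevel l).length = 2 * l.length := by
  induction l with
  | nil => rfl
  | cons p l ih =>
    rw [doubleLevel, List.flatMap_cons, List.length_append, ← doubleLevel, ih, List.length_cons]
    simp [doubleStrand]
    ring

/-- The characteristic function of a condition on labels. -/
def indicator (f : Fin 3 → Fin 3 → Bool) (i j : Fin 3) : ℤ := if f i j then 1 else 0

/-- The sum of crossing signs at which the labels satisfy `f`, at a crossing of the bands of `i` and
`j`. -/
def bandWeight (f : Fin 3 → Fin 3 → Bool) (i j : Fin 3) : ℤ :=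
  -- The two sides of a band are antiparallel: of the four crossings at a crossing of bands, those
  -- between corresponding sides count positively and the others negatively.
  indicator f (i + 1) (j + 1) + indicator f (i + 2) (j + 2) - indicator f (i + 2) (j + 1) -
    indicator f (i + 1) (j + 2)

/-- Sum of signs of crossings with weights depending on the labels. -/
def weightedSign (g : Fin 3 → Fin 3 → ℤ) : ThetaSlice → Level (Fin 3) → ℤ
  | .strand (.cross i ov), l =>
    match (l.drop i).take 2 with
    | [(a, u), (b, v)] => g a b * Slice.crossingSign ov u v
    | _ => 0
  | _, _ => 0

/-- Sum of signs of crossings with weights depending on the labels. -/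
def weightedSum (g : Fin 3 → Fin 3 → ℤ) : List ThetaSlice → Level (Fin 3) → ℤ
  | [], _ => 0
  | s :: w, l => weightedSign g s l + weightedSum g w (s.step l)

/-- A word fits on a level, ends at another one, and has the given sum of crossing signs. -/
def Leads {α : Type} (f : α → α → Bool) (w : List (Slice α)) (l l' : Level α) (k : ℤ) : Prop :=
  Runs w l ∧ levelAfter w l = l' ∧ signSumFrom f w l = k

section Leads

variable {α : Type} {f : α → α → Bool}

theorem leads_nil (l : Level α) : Leads f [] l l 0 := ⟨trivial, rfl, rfl⟩

theorem runs_append (u w : List (Slice α)) (l : Level α) :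
    Runs (u ++ w) l ↔ Runs u l ∧ Runs w (levelAfter u l) := by
  induction u generalizing l with
  | nil => simp [Runs, levelAfter]
  | cons s u ih => simp [Runs, levelAfter, ih, and_assoc]

theorem levelAfter_append (u w : List (Slice α)) (l : Level α) :
    levelAfter (u ++ w) l = levelAfter w (levelAfter u l) := by simp [levelAfter]

theorem Leads.append {u w : List (Slice α)} {l l' l'' : Level α} {k k' : ℤ}
    (h : Leads f u l l' k) (h' : Leads f w l' l'' k') : Leads f (u ++ w) l l'' (k + k') := by
  obtain ⟨h₁, rfl, rfl⟩ := h
  obtain ⟨h₁', rfl, rfl⟩ := h'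
  exact ⟨(runs_append _ _ _).2 ⟨h₁, h₁'⟩, levelAfter_append _ _ _, signSumFrom_append _ _ _ _⟩

theorem Leads.shift {w : List (Slice α)} {l l' : Level α} {k : ℤ} (h : Leads f w l l' k)
    (l₁ : Level α) : Leads f (w.map (Slice.shift l₁.length)) (l₁ ++ l) (l₁ ++ l') k := by
  obtain ⟨h₁, rfl, rfl⟩ := h
  exact ⟨(runs_shift _ _ _).2 h₁, levelAfter_shift _ _ _ h₁, signSumFrom_shift _ _ _ _ h₁⟩

theorem Leads.cons {s : Slice α} {w : List (Slice α)} {l l' : Level α} {k : ℤ} (hs : s.Valid l)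
    (h : Leads f w (s.step l) l' k) : Leads f (s :: w) l l' (s.sign f l + k) := by
  obtain ⟨h₁, rfl, rfl⟩ := h
  exact ⟨⟨hs, h₁⟩, rfl, rfl⟩

theorem Leads.closesFrom {w v : List (Slice α)} {l l' : Level α} {k : ℤ} (h : Leads f w l l' k)
    (hv : ClosesFrom v l') : ClosesFrom (w ++ v) l := by
  obtain ⟨h₁, rfl, rfl⟩ := h
  exact (closesFrom_append _ _ _).2 ⟨h₁, hv⟩

end Leads

open ThetaSlice

theorem map_shift_fullTwists (m n : ℕ) (t : ℤ) :
    (fullTwists m t).map (Slice.shift (2 * n)) = fullTwists (n + m) t := by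
  simp [fullTwists, Slice.shift, Slice.setPos, Slice.pos, mul_add]

/-- The boundary strands of a band are antiparallel, so a crossing that would be positive for
parallel strands counts `-1`, and a full twist has two of them. The symmetry of `f` matters because
the strands have changed places at every second crossing. -/
theorem leads_fullTwists {f : Fin 3 → Fin 3 → Bool} (hf : ∀ i j, f i j = f j i) (k : Fin 3) (n : ℤ)
    (l : Level (Fin 3)) : Leads f (fullTwists 0 n) (doubleStrand (k, true) ++ l)
      (doubleStrand (k, true) ++ l) (-2 * n * indicator f (k + 1) (k + 2)) := by
  have key (ov : Bool) (N : ℕ) : Leads f (List.replicate (2 * N) (.cross 0 ov))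
      (doubleStrand (k, true) ++ l) (doubleStrand (k, true) ++ l)
        (-2 * (if ov then (N : ℤ) else -N) * indicator f (k + 1) (k + 2)) := by
    induction N with
    | zero => simpa using leads_nil _
    | succ N ih =>
      rw [show 2 * (N + 1) = 2 * N + 1 + 1 by ring, List.replicate_succ, List.replicate_succ]
      have h₁ : (Slice.cross 0 ov).Valid (doubleStrand (k, true) ++ l) := by
        simp [Slice.Valid, doubleStrand]
      have h₂ : (Slice.cross 0 ov).Valid ((Slice.cross 0 ov).step (doubleStrand (k, true) ++ l)) := by
        simp [Slice.Valid, doubleStrand, Slice.step, swapAt]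
      have e : (Slice.cross 0 ov).step ((Slice.cross 0 ov).step (doubleStrand (k, true) ++ l)) =
          doubleStrand (k, true) ++ l := by
        simp [doubleStrand, Slice.step, swapAt]
      have := (Leads.cons h₂ (by rw [e]; exact ih)).cons h₁
      convert this using 1
      have s₁ : (Slice.cross 0 ov).sign f (doubleStrand (k, true) ++ l) =
          -(if ov then 1 else -1) * indicator f (k + 1) (k + 2) := by
        simp [Slice.sign, doubleStrand, indicator, Slice.crossingSign]
      have s₂ : (Slice.cross 0 ov).sign f ((Slice.cross 0 ov).step (doubleStrand (k, true) ++ l)) =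
          -(if ov then 1 else -1) * indicator f (k + 1) (k + 2) := by
        simp [Slice.sign, doubleStrand, indicator, Slice.crossingSign, Slice.step, swapAt,
          hf (k + 2) (k + 1)]
      rw [s₁, s₂]
      cases ov <;> push_cast <;> simp <;> ring
  rcases n with n | n
  · have := key true n
    simpa [fullTwists] using this
  · have := key false (n + 1)
    have h : decide (0 ≤ Int.negSucc n) = false := by simp
    have e : (Int.negSucc n) = -((n + 1 : ℕ) : ℤ) := rfl
    have e' : (Int.negSucc n).natAbs = n + 1 := rfl
    rw [fullTwists, h, e']
    convert this using 1
    simp [e]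

/-- The contribution of the twists to the crossing signs. -/
def twistSign (f : Fin 3 → Fin 3 → Bool) (t : Fin 3 → ℤ) : ℤ :=
  -2 * t 0 * indicator f 1 2 + -2 * t 1 * indicator f 2 0 + -2 * t 2 * indicator f 0 1

theorem leads_bands_tail {f : Fin 3 → Fin 3 → Bool} (hf : ∀ i j, f i j = f j i) (t : Fin 3 → ℤ)
    (l : Level (Fin 3)) : Leads f ((ThetaSlice.tail 0).bands t) l
      (doubleLevel [(0, true), (1, true), (2, true)] ++ l) (twistSign f t) := by
  have e : doubleLevel [(0, true), (1, true), (2, true)] ++ l = doubleStrand (0, true) ++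
      (doubleStrand (1, true) ++ (doubleStrand (2, true) ++ l)) := by simp [doubleLevel]
  have h₀ : Leads f [.cup 0 1 false, .cup 1 2 true, .cup 3 0 true] l
      (doubleLevel [(0, true), (1, true), (2, true)] ++ l) 0 := by
    refine ⟨?_, ?_, ?_⟩
    · simp [Runs, Slice.Valid, Slice.step]
    · simp [levelAfter, Slice.step, doubleLevel, doubleStrand]
    · rfl
  have h₁ := leads_fullTwists hf 0 (t 0) (doubleStrand (1, true) ++ (doubleStrand (2, true) ++ l))
  have h₂ := (leads_fullTwists hf 1 (t 1) (doubleStrand (2, true) ++ l)).shift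
    (doubleStrand (0, true))
  have h₃ := (leads_fullTwists hf 2 (t 2) l).shift
    (doubleStrand (0, true) ++ doubleStrand (1, true))
  rw [show (doubleStrand (0, true)).length = 2 * 1 from rfl, map_shift_fullTwists] at h₂
  rw [show (doubleStrand (0, true) ++ doubleStrand (1, true)).length = 2 * 2 from rfl,
    map_shift_fullTwists, List.append_assoc] at h₃
  rw [e] at h₀ ⊢
  have := h₀.append ((h₁.append h₂).append h₃)
  simp only [zero_add] at this
  exact this

theorem leads_bands_strand {f : Fin 3 → Fin 3 → Bool} (t : Fin 3 → ℤ) (s : Slice (Fin 3))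
    {m : Level (Fin 3)} (hm : m.length = s.ins) (hs : (s.setPos 0).Valid m)
    (l : Level (Fin 3)) :
    Leads f ((ThetaSlice.strand (s.setPos 0)).bands t) (doubleLevel m ++ l)
      (doubleLevel (s.top m) ++ l) (weightedSign (bandWeight f) (.strand (s.setPos 0)) m) := by
  cases s with
  | cup i a up =>
    obtain rfl : m = [] := List.eq_nil_of_length_eq_zero hm
    refine ⟨?_, ?_, rfl⟩
    · simp [Slice.setPos, bands, Slice.double, Runs, Slice.Valid, Slice.step, doubleLevel]
    · cases up <;> simp [Slice.setPos, bands, Slice.double, levelAfter, Slice.step, doubleLevel,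
        Slice.top, doubleStrand]
  | cap i =>
    match m, hm with
    | [(a, u), (b, v)], _ =>
      obtain ⟨a', u', hs⟩ := hs
      simp at hs
      obtain ⟨⟨rfl, rfl⟩, rfl, rfl⟩ := hs
      refine ⟨?_, ?_, rfl⟩
      · cases u <;> simp [Slice.setPos, bands, Slice.double, Runs, Slice.Valid, Slice.step,
          doubleLevel, doubleStrand]
      · simp [Slice.setPos, bands, Slice.double, levelAfter, Slice.step,
          doubleLevel, Slice.top, doubleStrand]
  | cross i ov =>
    match m, hm with
    | [(a, u), (b, v)], _ =>
      refine ⟨?_, ?_, ?_⟩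
      · simp [Slice.setPos, bands, Slice.double, Runs, Slice.Valid, Slice.step,
          doubleLevel, doubleStrand, swapAt]
      · simp [Slice.setPos, bands, Slice.double, levelAfter, Slice.step, swapAt,
          doubleLevel, Slice.top, doubleStrand]
      · simp [Slice.setPos, bands, Slice.double, signSumFrom, Slice.sign, Slice.step, swapAt,
          doubleLevel, doubleStrand, weightedSign, bandWeight, indicator, Slice.crossingSign]
        cases u <;> cases v <;> cases ov <;> simp <;> split_ifs <;> rfl

theorem leads_bands_head {f : Fin 3 → Fin 3 → Bool} (t : Fin 3 → ℤ) (l : Level (Fin 3)) :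
    Leads f ((ThetaSlice.head 0).bands t)
      (doubleLevel [(0, true), (1, true), (2, true)] ++ l) l 0 := by
  refine ⟨?_, ?_, rfl⟩
  · simp [bands, Runs, Slice.Valid, Slice.step, doubleLevel, doubleStrand]
  · simp [bands, levelAfter, Slice.step, doubleLevel, doubleStrand]

theorem bands_strand_eq_map_shift (t : Fin 3 → ℤ) (s : Slice (Fin 3)) :
    (ThetaSlice.strand s).bands t =
      ((ThetaSlice.strand (s.setPos 0)).bands t).map (Slice.shift (2 * s.pos)) := by
  cases s <;> rfl

theorem bands_tail_eq_map_shift (t : Fin 3 → ℤ) (i : ℕ) :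
    (ThetaSlice.tail i).bands t =
      ((ThetaSlice.tail 0).bands t).map (Slice.shift (2 * i)) := by
  simp only [bands, List.map_append, map_shift_fullTwists]
  rfl

theorem bands_head_eq_map_shift (t : Fin 3 → ℤ) (i : ℕ) :
    (ThetaSlice.head i).bands t =
      ((ThetaSlice.head 0).bands t).map (Slice.shift (2 * i)) := rfl

theorem weightedSign_append (g : Fin 3 → Fin 3 → ℤ) (s : Slice (Fin 3)) {l₁ m : Level (Fin 3)}
    (l₂ : Level (Fin 3)) (h₁ : l₁.length = s.pos) (hm : m.length = s.ins) :
    weightedSign g (.strand s) (l₁ ++ m ++ l₂) = weightedSign g (.strand (s.setPos 0)) m := by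
  cases s with
  | cup i a up => rfl
  | cap i => rfl
  | cross i ov =>
    obtain rfl : l₁.length = i := h₁
    match m, hm with
    | [p, q], _ => simp [weightedSign, Slice.setPos]

theorem Slice.Valid.setPos_zero {α : Type} {s : Slice α} {l₁ m l₂ : Level α}
    (hs : s.Valid (l₁ ++ m ++ l₂)) (h₁ : l₁.length = s.pos) (hm : m.length = s.ins) :
    (s.setPos 0).Valid m := by
  cases s with
  | cup i a up => simp [Slice.setPos, Slice.Valid]
  | cap i =>
    obtain rfl : l₁.length = i := h₁
    match m, hm with
    | [p, q], _ => simpa [Slice.setPos, Slice.Valid] using hs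
  | cross i ov => simp [Slice.setPos, Slice.Valid, hm, Slice.ins]

theorem leads_bands {f : Fin 3 → Fin 3 → Bool} (hf : ∀ i j, f i j = f j i) (t : Fin 3 → ℤ)
    {s : ThetaSlice} {l : Level (Fin 3)} (hs : s.Valid l) :
    Leads f (s.bands t) (doubleLevel l) (doubleLevel (s.step l))
      (weightedSign (bandWeight f) s l + if s.isTail then twistSign f t else 0) := by
  match s, hs with
  | .strand s, hs =>
    obtain ⟨l₁, m, l₂, rfl, h₁, hm⟩ := Slice.exists_append (Slice.Valid.le hs)
    have := (leads_bands_strand (f := f) t s hm (Slice.Valid.setPos_zero hs h₁ hm)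
      (doubleLevel l₂)).shift (doubleLevel l₁)
    rw [doubleLevel_length, h₁, ← bands_strand_eq_map_shift] at this
    rw [weightedSign_append _ s l₂ h₁ hm, ThetaSlice.step, s.step_append l₂ h₁ hm]
    simpa [doubleLevel_append, isTail] using this
  | .tail i, hs =>
    obtain ⟨l₁, m, l₂, rfl, h₁, hm⟩ := Slice.exists_append (k := 0) hs
    obtain rfl : m = [] := List.eq_nil_of_length_eq_zero hm
    have := (leads_bands_tail hf t (doubleLevel l₂)).shift (doubleLevel l₁)
    rw [doubleLevel_length, h₁, ← bands_tail_eq_map_shift] at this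
    rw [(ThetaSlice.tail i).step_append l₂ h₁ hm, ThetaSlice.top, List.append_nil]
    simpa only [doubleLevel_append, List.append_assoc, isTail, weightedSign, if_true, zero_add]
      using this
  | .head i, hs =>
    obtain ⟨l₁, l₂, rfl, h₁⟩ := TemperleyLieb.exists_of_head_valid hs
    have := (leads_bands_head (f := f) t (doubleLevel l₂)).shift (doubleLevel l₁)
    rw [doubleLevel_length, h₁, ← bands_head_eq_map_shift] at this
    rw [(ThetaSlice.head i).step_append l₂ h₁ rfl, ThetaSlice.top, List.append_nil]
    simpa only [doubleLevel_append, List.append_assoc, isTail, weightedSign, Bool.false_eq_true,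
      if_false, zero_add] using this

theorem closesFrom_bands (t : Fin 3 → ℤ) {w : List ThetaSlice} {l : Level (Fin 3)}
    (hw : ThetaClosesFrom w l) : ClosesFrom (w.flatMap (bands t)) (doubleLevel l) := by
  induction w generalizing l with
  | nil =>
    obtain rfl : l = [] := hw
    rfl
  | cons s w ih =>
    exact (leads_bands (f := fun _ _ => true) (fun _ _ => rfl) t hw.1).closesFrom (ih hw.2)

theorem signSumFrom_bands {f : Fin 3 → Fin 3 → Bool} (hf : ∀ i j, f i j = f j i) (t : Fin 3 → ℤ)
    {w : List ThetaSlice} {l : Level (Fin 3)} (hw : ThetaClosesFrom w l) :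
    signSumFrom f (w.flatMap (bands t)) (doubleLevel l) =
      weightedSum (bandWeight f) w l + w.countP isTail * twistSign f t := by
  induction w generalizing l with
  | nil => simp [signSumFrom, weightedSum]
  | cons s w ih =>
    obtain ⟨h₁, h₂, h₃⟩ := leads_bands hf t hw.1
    rw [List.flatMap_cons, signSumFrom_append, h₂, h₃, ih hw.2, weightedSum, List.countP_cons]
    split_ifs <;> push_cast <;> ring

theorem ThetaDiagram.isLinkDiagram_bandLink (D : ThetaDiagram) (t : Fin 3 → ℤ) :
    IsLinkDiagram (D.bandLink t) := closesFrom_bands t D.closes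

theorem weightedSum_eq (g : Fin 3 → Fin 3 → ℤ) (hg : ∀ i j, g i j = g j i) (w : List ThetaSlice)
    (l : Level (Fin 3)) :
    let W (i j : Fin 3) : ℤ :=
      ThetaDiagram.signSumFrom (fun a b => (a = i ∧ b = j) ∨ (a = j ∧ b = i)) w l
    weightedSum g w l = g 0 0 * W 0 0 + g 1 1 * W 1 1 + g 2 2 * W 2 2 + g 0 1 * W 0 1 +
      g 1 2 * W 1 2 + g 2 0 * W 2 0 := by
  induction w generalizing l with
  | nil => simp [weightedSum, ThetaDiagram.signSumFrom]
  | cons s w ih =>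
    simp only [weightedSum, ThetaDiagram.signSumFrom, ih]
    suffices h : weightedSign g s l = g 0 0 * s.sign (fun a b => (a = 0 ∧ b = 0) ∨ (a = 0 ∧ b = 0)) l +
        g 1 1 * s.sign (fun a b => (a = 1 ∧ b = 1) ∨ (a = 1 ∧ b = 1)) l +
        g 2 2 * s.sign (fun a b => (a = 2 ∧ b = 2) ∨ (a = 2 ∧ b = 2)) l +
        g 0 1 * s.sign (fun a b => (a = 0 ∧ b = 1) ∨ (a = 1 ∧ b = 0)) l +
        g 1 2 * s.sign (fun a b => (a = 1 ∧ b = 2) ∨ (a = 2 ∧ b = 1)) l +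
        g 2 0 * s.sign (fun a b => (a = 2 ∧ b = 0) ∨ (a = 0 ∧ b = 2)) l by
      rw [h]
      ring
    rcases s with (_ | _ | ⟨i, ov⟩) | _ | _ <;>
      simp only [weightedSign, ThetaSlice.sign, Slice.sign, mul_zero, add_zero]
    rcases (l.drop i).take 2 with _ | ⟨⟨a, u⟩, _ | ⟨⟨b, v⟩, _ | ⟨p, m⟩⟩⟩ <;>
      simp only [mul_zero, add_zero]
    generalize Slice.crossingSign ov u v = σ
    fin_cases a <;> fin_cases b <;> simp [hg 1 0, hg 2 1, hg 0 2]

theorem bandWeight_comm {f : Fin 3 → Fin 3 → Bool} (hf : ∀ i j, f i j = f j i) (i j : Fin 3) :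
    bandWeight f i j = bandWeight f j i := by
  simp only [bandWeight, indicator, hf (j + 1) (i + 1), hf (j + 2) (i + 2), hf (j + 2) (i + 1),
    hf (j + 1) (i + 2)]
  ring

/-- The sums of crossing signs in the band link. -/
theorem ThetaDiagram.signSumFrom_bandLink (D : ThetaDiagram) {f : Fin 3 → Fin 3 → Bool}
    (hf : ∀ i j, f i j = f j i) (t : Fin 3 → ℤ) :
    ThetaCurve.signSumFrom f (D.bandLink t) [] =
      bandWeight f 0 0 * D.omega 0 0 + bandWeight f 1 1 * D.omega 1 1 +
      bandWeight f 2 2 * D.omega 2 2 + bandWeight f 0 1 * D.omega 0 1 +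
      bandWeight f 1 2 * D.omega 1 2 + bandWeight f 2 0 * D.omega 2 0 + twistSign f t := by
  have h := signSumFrom_bands hf t D.closes
  rw [weightedSum_eq _ (bandWeight_comm hf), D.one_tail, Nat.cast_one, one_mul] at h
  exact h

/-- The four signs at each crossing of bands cancel, hence only the twists contribute. -/
theorem ThetaDiagram.writhe_bandLink (D : ThetaDiagram) (t : Fin 3 → ℤ) :
    writhe (D.bandLink t) = -2 * (t 0 + t 1 + t 2) := by
  rw [writhe, D.signSumFrom_bandLink (fun _ _ => rfl)]
  simp [bandWeight, indicator, twistSign]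
  ring

theorem ThetaDiagram.omega_comm (D : ThetaDiagram) (i j : Fin 3) : D.omega i j = D.omega j i := by
  simp only [omega]
  congr 1
  funext a b
  congr 1
  apply propext
  tauto

/-- The components `k + 1` and `k + 2` run side by side only along the band of the edge `k`. So the
vanishing of their linking number is an equation in which `t k` is the only twist. -/
theorem ThetaDiagram.two_mul_twist_of_seifertFormZero {D : ThetaDiagram} {t : Fin 3 → ℤ}
    (h : D.SeifertFormZero t) (k : Fin 3) : 2 * t k = -2 * D.omega k k +
      (D.omega k (k + 1) + D.omega k (k + 2) - D.omega (k + 1) (k + 2)) := by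
  have hs (i j : Fin 3) : ∀ a b : Fin 3,
      (decide ((a = i ∧ b = j) ∨ (a = j ∧ b = i)) : Bool) =
        decide ((b = i ∧ a = j) ∨ (b = j ∧ a = i)) := by
    intro a b
    congr 1
    apply propext
    tauto
  have h₀ := h 1 2 (by decide)
  have h₁ := h 2 0 (by decide)
  have h₂ := h 0 1 (by decide)
  rw [D.signSumFrom_bandLink (hs _ _)] at h₀ h₁ h₂
  simp [bandWeight, indicator, twistSign] at h₀ h₁ h₂
  have c₁ := D.omega_comm 1 0
  have c₂ := D.omega_comm 2 1
  have c₃ := D.omega_comm 0 2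
  fin_cases k <;> simp <;> omega

/-- The preceding equation shows that the sum of mixed crossing signs is even, so the integer
division in `twistNumber` is exact. -/
theorem ThetaDiagram.twist_eq_of_seifertFormZero {D : ThetaDiagram} {t : Fin 3 → ℤ}
    (h : D.SeifertFormZero t) (k : Fin 3) : t k = D.twistNumber k := by
  have := two_mul_twist_of_seifertFormZero h k
  rw [twistNumber]
  omega

end ThetaCurve

namespace ThetaCurve

/-! ### Crossing signs of the subknots -/

/-- The strand over a point after deleting the edge `k`. -/
def keepStrand (k : Fin 3) (p : Fin 3 × Bool) : Level Unit :=
  if p.1 = k then [] else [((), if p.1 = k + 1 then p.2 else !p.2)]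

/-- The level that remains after deleting the edge `k`. -/
def keepLevel (k : Fin 3) (l : Level (Fin 3)) : Level Unit := l.flatMap (keepStrand k)

theorem keepLevel_append (k : Fin 3) (l l' : Level (Fin 3)) :
    keepLevel k (l ++ l') = keepLevel k l ++ keepLevel k l' := List.flatMap_append

theorem keepLevel_length (k : Fin 3) (l : Level (Fin 3)) :
    (keepLevel k l).length = (l.filter fun p => p.1 ≠ k).length := by
  induction l with
  | nil => rfl
  | cons p l ih =>
    rw [keepLevel, List.flatMap_cons, List.length_append, ← keepLevel, ih]
    by_cases h : p.1 = k <;> simp [keepStrand, h]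
    ring

theorem kept_append (k : Fin 3) (l₁ l : Level (Fin 3)) :
    ThetaSlice.deleteEdge.kept k (l₁ ++ l) l₁.length = (keepLevel k l₁).length := by
  rw [ThetaSlice.deleteEdge.kept, List.take_left, keepLevel_length]

/-- The coefficients with which crossings contribute to the writhe after deleting the edge `k`. -/
def keepWeight (k i j : Fin 3) : ℤ := if i = k ∨ j = k then 0 else if i = j then 1 else -1

theorem leads_singleton {α : Type} {f : α → α → Bool} {s : Slice α} {l₁ m l₂ : Level α}
    (h₁ : l₁.length = s.pos) (hm : m.length = s.ins) (hs : s.Valid (l₁ ++ m ++ l₂)) :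
    Leads f [s] (l₁ ++ m ++ l₂) (l₁ ++ s.top m ++ l₂) (s.sign f (l₁ ++ m ++ l₂)) := by
  rw [← s.step_append l₂ h₁ hm]
  simpa using (leads_nil _).cons hs

/-- The subknot runs along one of the remaining edges and against the other. This reverses the signs
of the crossings between them and preserves those of self-crossings, as `keepWeight` prescribes. -/
theorem leads_deleteEdge (k : Fin 3) {s : ThetaSlice} {l : Level (Fin 3)} (hs : s.Valid l) :
    Leads (fun _ _ => true) (s.deleteEdge k l) (keepLevel k l) (keepLevel k (s.step l))
      (weightedSign (keepWeight k) s l) := by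
  match s, hs with
  | .strand s, hs =>
    obtain ⟨l₁, m, l₂, rfl, h₁, hm⟩ := Slice.exists_append (Slice.Valid.le hs)
    rw [weightedSign_append _ s l₂ h₁ hm, ThetaSlice.step, s.step_append l₂ h₁ hm]
    have hkept := kept_append k l₁ (m ++ l₂)
    rw [← List.append_assoc, h₁] at hkept
    simp only [keepLevel_append]
    cases s with
    | cup i a up =>
      obtain rfl : m = [] := List.eq_nil_of_length_eq_zero hm
      simp only [Slice.pos] at hkept
      simp only [ThetaSlice.deleteEdge, Slice.top]
      by_cases ha : a = k
      · simpa [ha, keepLevel, keepStrand, weightedSign, Slice.setPos] using leads_nil _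
      · have := leads_singleton (f := fun _ _ => true) (l₁ := keepLevel k l₁) (m := [])
          (l₂ := keepLevel k l₂)
          (s := .cup (keepLevel k l₁).length () (if a = k + 1 then up else !up)) rfl rfl
          (by simp [Slice.Valid])
        have e : keepLevel k [(a, up), (a, !up)] = [((), if a = k + 1 then up else !up),
            ((), !(if a = k + 1 then up else !up))] := by
          by_cases ha' : a = k + 1 <;> simp [keepLevel, keepStrand, ha, ha']
        rw [if_neg ha, hkept, e]
        exact this
    | cap i =>
      match m, hm with
      | [(a, u), (b, v)], _ =>
        obtain rfl : l₁.length = i := h₁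
        obtain ⟨a', u', hs⟩ := hs
        simp at hs
        obtain ⟨⟨rfl, rfl⟩, rfl, rfl⟩ := hs
        have hl : (l₁ ++ [(b, u), (b, !u)] ++ l₂)[l₁.length]? = some (b, u) := by simp
        simp only [Slice.pos] at hkept
        simp only [ThetaSlice.deleteEdge, Slice.top, hl]
        by_cases hb : b = k
        · simpa [hb, keepLevel, keepStrand, weightedSign, Slice.setPos] using leads_nil _
        · have e : keepLevel k [(b, u), (b, !u)] = [((), if b = k + 1 then u else !u),
              ((), !(if b = k + 1 then u else !u))] := by
            by_cases hb' : b = k + 1 <;> simp [keepLevel, keepStrand, hb, hb']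
          have := leads_singleton (f := fun _ _ => true) (l₁ := keepLevel k l₁)
            (m := keepLevel k [(b, u), (b, !u)]) (l₂ := keepLevel k l₂)
            (s := .cap (keepLevel k l₁).length) rfl (by rw [e]; rfl)
            (by rw [e]; exact ⟨(), if b = k + 1 then u else !u, by simp⟩)
          rw [if_neg hb, hkept]
          exact this
    | cross i ov =>
      match m, hm with
      | [(a, u), (b, v)], _ =>
        obtain rfl : l₁.length = i := h₁
        have hl : ((l₁ ++ [(a, u), (b, v)] ++ l₂).drop l₁.length).take 2 = [(a, u), (b, v)] := by
          simp
        simp only [Slice.pos] at hkept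
        simp only [ThetaSlice.deleteEdge, Slice.top, hl]
        by_cases hab : a = k ∨ b = k
        · have hw : weightedSign (keepWeight k) (.strand ((Slice.cross l₁.length ov).setPos 0))
              [(a, u), (b, v)] = 0 := by simp [weightedSign, Slice.setPos, keepWeight, hab]
          have e : keepLevel k [(a, u), (b, v)] = keepLevel k [(a, u), (b, v)].reverse := by
            rcases hab with h | h <;> simp [keepLevel, keepStrand, h]
          rw [hw, if_pos hab, ← e]
          exact leads_nil _
        · have ha : a ≠ k := fun h => hab (.inl h)
          have hb : b ≠ k := fun h => hab (.inr h)
          have e : keepLevel k [(a, u), (b, v)] = [((), if a = k + 1 then u else !u),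
              ((), if b = k + 1 then v else !v)] := by simp [keepLevel, keepStrand, ha, hb]
          have e' : keepLevel k [(a, u), (b, v)].reverse =
              (keepLevel k [(a, u), (b, v)]).reverse := by simp [keepLevel, keepStrand, ha, hb]
          have := leads_singleton (f := fun _ _ => true) (l₁ := keepLevel k l₁)
            (m := keepLevel k [(a, u), (b, v)]) (l₂ := keepLevel k l₂)
            (s := .cross (keepLevel k l₁).length ov) rfl (by rw [e]; rfl)
            (by rw [e]; simp [Slice.Valid])
          have hsign : weightedSign (keepWeight k)
              (.strand ((Slice.cross l₁.length ov).setPos 0)) [(a, u), (b, v)] =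
              (Slice.cross (keepLevel k l₁).length ov).sign (fun _ _ => true)
                (keepLevel k l₁ ++ keepLevel k [(a, u), (b, v)] ++ keepLevel k l₂) := by
            rw [e]
            simp only [weightedSign, Slice.setPos, Slice.sign, List.drop_zero,
              List.take_succ_cons, List.take_zero, List.append_assoc, List.drop_left,
              List.cons_append, if_true, keepWeight, hab, if_false]
            revert ha hb
            clear e e' this hab hl hkept hs
            fin_cases k <;> fin_cases a <;> fin_cases b <;> cases u <;> cases v <;> cases ov <;>
              simp [Slice.crossingSign]
          rw [if_neg hab, hkept, e', hsign]
          exact this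
  | .tail i, hs =>
    obtain ⟨l₁, m, l₂, rfl, h₁, hm⟩ := Slice.exists_append (k := 0) hs
    obtain rfl : m = [] := List.eq_nil_of_length_eq_zero hm
    obtain rfl : l₁.length = i := h₁
    rw [(ThetaSlice.tail l₁.length).step_append l₂ rfl rfl, List.append_nil, ThetaSlice.deleteEdge,
      kept_append]
    have := leads_singleton (f := fun _ _ => true) (l₁ := keepLevel k l₁) (m := [])
      (l₂ := keepLevel k l₂) (s := .cup (keepLevel k l₁).length () (decide (k ≠ 1))) rfl rfl
      (by simp [Slice.Valid])
    simp only [keepLevel_append, ThetaSlice.top]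
    have e : keepLevel k [(0, true), (1, true), (2, true)] =
        [((), decide (k ≠ 1)), ((), !(decide (k ≠ 1)))] := by
      fin_cases k <;> rfl
    rw [e]
    simpa [Slice.top, weightedSign, Slice.sign] using this
  | .head i, hs =>
    obtain ⟨l₁, l₂, rfl, rfl⟩ := TemperleyLieb.exists_of_head_valid hs
    have e : keepLevel k [(0, true), (1, true), (2, true)] =
        [((), decide (k ≠ 1)), ((), !(decide (k ≠ 1)))] := by
      fin_cases k <;> rfl
    have := leads_singleton (f := fun _ _ => true) (l₁ := keepLevel k l₁)
      (m := keepLevel k [(0, true), (1, true), (2, true)])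
      (l₂ := keepLevel k l₂) (s := .cap (keepLevel k l₁).length) rfl (by rw [e]; rfl)
      (by rw [e]; exact ⟨(), decide (k ≠ 1), by simp⟩)
    rw [(ThetaSlice.head l₁.length).step_append l₂ rfl rfl, ThetaSlice.deleteEdge,
      List.append_assoc, kept_append]
    simpa only [keepLevel_append, ThetaSlice.top, List.append_assoc, List.append_nil, Slice.top,
      weightedSign, Slice.sign] using this

theorem closesFrom_go (k : Fin 3) {w : List ThetaSlice} {l : Level (Fin 3)}
    (hw : ThetaClosesFrom w l) : ClosesFrom (ThetaDiagram.subknot.go k w l) (keepLevel k l) := by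
  induction w generalizing l with
  | nil =>
    obtain rfl : l = [] := hw
    rfl
  | cons s w ih => exact (leads_deleteEdge k hw.1).closesFrom (ih hw.2)

theorem signSumFrom_go (k : Fin 3) {w : List ThetaSlice} {l : Level (Fin 3)}
    (hw : ThetaClosesFrom w l) :
    signSumFrom (fun _ _ => true) (ThetaDiagram.subknot.go k w l) (keepLevel k l) =
      weightedSum (keepWeight k) w l := by
  induction w generalizing l with
  | nil => simp [signSumFrom, weightedSum, ThetaDiagram.subknot.go]
  | cons s w ih =>
    obtain ⟨h₁, h₂, h₃⟩ := leads_deleteEdge k hw.1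
    rw [ThetaDiagram.subknot.go, signSumFrom_append, h₂, h₃, ih hw.2, weightedSum]

namespace ThetaDiagram

variable (D : ThetaDiagram)

theorem isLinkDiagram_subknot (k : Fin 3) : IsLinkDiagram (D.subknot k) :=
  closesFrom_go k D.closes

theorem writhe_subknot (k : Fin 3) : writhe (D.subknot k) =
    D.omega (k + 1) (k + 1) + D.omega (k + 2) (k + 2) - D.omega (k + 1) (k + 2) := by
  have h := signSumFrom_go k D.closes
  have hg (i j : Fin 3) : keepWeight k i j = keepWeight k j i := by
    simp only [keepWeight, or_comm, eq_comm]
  rw [weightedSum_eq _ hg] at h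
  have e : writhe (D.subknot k) = _ := h
  rw [e]
  change keepWeight k 0 0 * D.omega 0 0 + keepWeight k 1 1 * D.omega 1 1 +
    keepWeight k 2 2 * D.omega 2 2 + keepWeight k 0 1 * D.omega 0 1 +
    keepWeight k 1 2 * D.omega 1 2 + keepWeight k 2 0 * D.omega 2 0 = _
  fin_cases k <;> simp [keepWeight] <;> ring

variable {D} in
-- In the sum of two of the twist numbers the crossings with the third edge cancel; what remains is
-- minus the writhe of the knot formed by the two edges.
theorem writhe_subknot_of_seifertFormZero {t : Fin 3 → ℤ} (h : D.SeifertFormZero t) (k : Fin 3) :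
    writhe (D.subknot k) = -(t (k + 1) + t (k + 2)) := by
  rw [writhe_subknot]
  have h₀ := two_mul_twist_of_seifertFormZero h 0
  have h₁ := two_mul_twist_of_seifertFormZero h 1
  have h₂ := two_mul_twist_of_seifertFormZero h 2
  have c₁ := D.omega_comm 1 0
  have c₂ := D.omega_comm 2 1
  have c₃ := D.omega_comm 0 2
  fin_cases k <;> simp at h₀ h₁ h₂ ⊢ <;> omega

end ThetaDiagram

end ThetaCurve

/-! ### Comparison of the powers of `A` and conclusion. -/

namespace ThetaCurve

/-- The theorem for the band link itself and the diagrams of the subknots obtained by deleting an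
edge. -/
theorem ThetaDiagram.jaegerNormalized_sub_jones_bandLink {K R : Type} [Field K] [Ring R]
    [Algebra K R] [Nontrivial R] {A : K} (T : TemperleyLieb A R) (hA : A ≠ 0) (D : ThetaDiagram)
    {t : Fin 3 → ℤ} (ht : D.SeifertFormZero t) :
    D.jaegerNormalized A - jones A (D.bandLink t) =
      -(loopValue A)⁻¹ * ∑ i, jaegerKnotNormalized A (D.subknot i) - (loopValue A)⁻¹ ^ 2 := by
  have hδ := T.loopValue_ne_zero
  apply mul_left_cancel₀ hδ
  apply smul_left_injective K (one_ne_zero (α := R))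
  -- The normalization is undone: `A^(8 ω)` with `ω` the writhe of the subknot, expressed through
  -- the twists.
  have hk (k : Fin 3) : T.barred (D.subknot k) 0 =
      (loopValue A * (A ^ (-8 * (t (k + 1) + t (k + 2))) * jaegerKnotNormalized A (D.subknot k))) •
        (1 : R) := by
    have := T.jaegerKnotNormalized_smul_one (D.isLinkDiagram_subknot k)
    rw [writhe_subknot_of_seifertFormZero ht, ← zpow_natCast, ← zpow_mul] at this
    rw [mul_left_comm, mul_smul, this, smul_smul, ← zpow_add₀ hA]
    convert (one_smul K _).symm using 2
    rw [← zpow_zero A]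
    congr 1
    push_cast
    ring
  have hj : (loopValue A * D.jaegerNormalized A) • (1 : R) =
      (A ^ (8 * (t 0 + t 1 + t 2))) • T.colored (fun _ => true) D.word := by
    rw [← T.jaeger_smul_one, smul_smul, jaegerNormalized]
    congr 1
    simp only [Fin.sum_univ_three, ← twist_eq_of_seifertFormZero ht]
    rw [zpow_mul, show (-A ^ 4) ^ (2 : ℤ) = A ^ (8 : ℤ) by norm_cast; ring, ← zpow_mul]
    ring
  have hV := T.jones_smul_one (D.isLinkDiagram_bandLink t)
  rw [T.word_bandLink, D.writhe_bandLink, hk, hk, hk] at hV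
  have hw : (-A ^ 3) ^ (- (-2 * (t 0 + t 1 + t 2))) = A ^ (6 * (t 0 + t 1 + t 2)) := by
    rw [show - (-2 * (t 0 + t 1 + t 2)) = 2 * (t 0 + t 1 + t 2) by ring, zpow_mul,
      show (-A ^ 3) ^ (2 : ℤ) = A ^ (6 : ℤ) by norm_cast; ring, ← zpow_mul]
  change (_ * (_ - _)) • (1 : R) = (_ * _) • (1 : R)
  rw [mul_sub, sub_smul, hV, hj, hw]
  have hpow (n : ℤ) (k : Fin 3) : A ^ (n * t k) = (A ^ t k) ^ n := by rw [mul_comm, zpow_mul]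
  have hx (k : Fin 3) : A ^ t k ≠ 0 := zpow_ne_zero _ hA
  -- The writhe of the band link contributes `6` and the twists of the uncut bands `2` to the
  -- exponent. Their sum is the exponent in the normalization of the Jaeger polynomial of `D`, so
  -- the terms without cuts cancel.
  have hC : A ^ (8 * (t 0 + t 1 + t 2)) =
      A ^ (6 * (t 0 + t 1 + t 2)) * TemperleyLieb.twistProduct A t true true true := by
    simp only [TemperleyLieb.twistProduct, TemperleyLieb.twistValue, if_true]
    rw [← zpow_add₀ hA, ← zpow_add₀ hA, ← zpow_add₀ hA]
    ring_nf
  rw [smul_add, ← sub_sub, smul_smul _ _ (T.colored _ _), ← hC, sub_self, zero_sub]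
  simp only [smul_smul, ← add_smul, ← neg_smul]
  congr 1
  -- In each remaining term the powers of `A` cancel. If only the edge `k` is cut, its twist enters
  -- with `6 - 6 = 0` and the other two with `6 + 2 - 8 = 0`; if all edges are cut, every twist
  -- enters with `6 - 6 = 0`.
  simp only [TemperleyLieb.twistProduct, TemperleyLieb.twistValue, if_true, Fin.sum_univ_three,
    Bool.false_eq_true, if_false, mul_add, zpow_add₀ hA, hpow]
  generalize loopValue A = δ at hδ
  generalize jaegerKnotNormalized A (D.subknot 0) = p
  generalize jaegerKnotNormalized A (D.subknot 1) = q
  generalize jaegerKnotNormalized A (D.subknot 2) = r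
  simp only [show (0 + 1 : Fin 3) = 1 from rfl, show (0 + 2 : Fin 3) = 2 from rfl,
    show (1 + 1 : Fin 3) = 2 from rfl, show (1 + 2 : Fin 3) = 0 from rfl,
    show (2 + 1 : Fin 3) = 0 from rfl, show (2 + 2 : Fin 3) = 1 from rfl]
  have h₀ := hx 0
  have h₁ := hx 1
  have h₂ := hx 2
  generalize A ^ t 0 = x at *
  generalize A ^ t 1 = y at *
  generalize A ^ t 2 = z at *
  field_simp
  ring

end ThetaCurve

theorem theorem1
    (D : ThetaCurve.ThetaDiagram)
    (L : List (ThetaCurve.Slice (Fin 3))) (hL : D.IsAssociatedLink L)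
    (K : Fin 3 → List (ThetaCurve.Slice Unit))
    (hK : ∀ i, ThetaCurve.Isotopic (D.subknot i) (K i))
    (A φ : RatFunc ℚ) (hA : A = RatFunc.X) (hφ : φ = A ^ 2 + A ^ (-2 : ℤ)) :
    D.jaegerNormalized A - ThetaCurve.jones A L
      = 1 / φ * ∑ i, ThetaCurve.jaegerKnotNormalized A (K i) - 1 / φ ^ 2 := by
  obtain ⟨t, ht, hiso⟩ := hL
  have h₀ : A ≠ 0 := hA ▸ RatFunc.X_ne_zero
  -- Since `A` is transcendental, the nondegeneracy conditions hold: `n = 4` handles `φ`, and `n =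
  -- 2` handles `A + A⁻¹`.
  have hpow (n : ℕ) (hn : 0 < n) : A ^ n + 1 ≠ 0 := by
    have : A ^ n + 1 = algebraMap (Polynomial ℚ) (RatFunc ℚ) (Polynomial.X ^ n + 1) := by
      simp [hA]
    rw [this]
    exact RatFunc.algebraMap_ne_zero (Polynomial.Monic.ne_zero (Polynomial.monic_X_pow_add_C 1 hn.ne'))
  have h₁ : A ^ 2 + A ^ (-2 : ℤ) ≠ 0 := by
    intro h
    apply hpow 4 (by norm_num)
    have e : A ^ (-2 : ℤ) = (A ^ 2)⁻¹ := by norm_cast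
    rw [e] at h
    field_simp at h
    linear_combination h
  have h₂ : A + A⁻¹ ≠ 0 := by
    intro h
    apply hpow 2 (by norm_num)
    field_simp at h
    linear_combination h
  let T := ThetaCurve.tensorModel A h₀ h₁ h₂
  -- The loop value is `-φ`; this turns the signs of the preceding formula into those of the
  -- statement.
  have hδ : (ThetaCurve.loopValue A)⁻¹ = -(1 / φ) := by
    rw [ThetaCurve.loopValue, hφ, one_div, ← inv_neg]
    congr 1
    ring
  rw [← T.jones_eq_of_isotopic hiso]
  simp only [← fun i => T.jaegerKnotNormalized_eq_of_isotopic (hK i)]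
  rw [D.jaegerNormalized_sub_jones_bandLink T h₀ ht, hδ]
  ring
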